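/- **Setting.** Let $\mathbb T=\mathbb R/2\pi\mathbb Z$, $\hat f(n)=\frac1{\sqrt{2\pi}}\int_0^{2\pi}e^{-inx}f(x)\,dx$, and let $\mathcal F f(\tau,n)=\int_{\mathbb R}e^{-it\tau}\hat f(t,n)\,dt$ be the space-time Fourier transform of $f(t,x)$. Fix $c_1,c_2\ge 0$ and put $\mu(n)=n^5+c_1n^3+c_2n$. Fix a smooth $\eta_0:\mathbb R\to[0,1]$ supported in $[-2,2]$ and equal to $1$ on $[-1,1]$; let $\chi_0=\eta_0$, $\chi_k(x)=\eta_0(x/2^k)-\eta_0(x/2^{k-1})$ for $k\ge1$, $\eta_j=\chi_j$ for $j\ge 0$, $\widehat{P_kf}(n)=\chi_k(n)\hat f(n)$, $P_{\le K}=\sum_{k\le K}P_k$, $I_0=\{n \in\mathbb Z:|n|\le2\}$ and $I_k=\{n\in\mathbb Z:2^{k-1}\le|n|\le2^{k+1}\}$ for $k\ge1$. Let $$\|g\|_{X_k}=\sum_{j\ge0}2^{j/2}\|\eta_j(\tau-\mu(n))g(\tau,n)\|_{L^2_\tau\ell^2_n},\qquad \|f\|_{F_k}=\sup_{t_k\in\mathbb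 R}\|\mathcal F[f\,\eta_0(2^{2k}(t-t_k))]\|_{X_k},$$ $$\|f\|_{N_k}=\sup_{t_k\in\mathbb R}\|(\tau-\mu(n)+i2^{2k})^{-1}\mathcal F[f\,\eta_0(2^{2k}(t-t_k))]\|_{X_k}$$ for complex-valued $f\in L^2(\mathbb R\times\mathbb T)$ whose Fourier transform is supported in $\mathbb R\times I_k$; $F_k$ and $N_k$ consist of those $f$ with finite norm. For $T\in(0,1]$, $F_k(T)$ and $N_k(T)$ consist of the $f\in C([-T,T];L^2(\mathbb T))$ for which $\|f\|_{F_k(T)}$, respectively $\|f\|_{N_k(T)}$, the infimum of $\|\tilde f\|_{F_k}$, respectively $\|\tilde f\|_{N_k}$, over all $\tilde f$ in $F_k$, respectively $N_k$, with $\tilde f=f$ on $[-T,T]\times\mathbb T$, is finite. Finally, for $s\ge 0$, $$\|u\|_{F^s(T)}^2=\sum_{k\ge0}2^{2sk}\|P_ku\|_{F_k(T)}^2,\qquad \|f\|_{N^s(T)}^2=\sum_{k\ge0}2^{2sk}\|P_kf\|_{N_k(T)}^2,$$ and $F^s(T)$, $N^s(T)$ consist of the $u$, respectively $f$, all of whose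 pieces $P_ku$, $P_kf$ lie in $F_k(T)$, $N_k(T)$ and whose norm is finite; elements of $N^s(T)$ may take values in the periodic distributions on $\mathbb T$. **The nonlinear terms.** Let $\mathcal N_{3,n}$ be the set of $(n_1,n_2,n_3)\in\mathbb Z^3$ with $n_1+n_2+n_3=n$ and $(n_1+n_2)(n_1+n_3)(n_2+n_3)\ne0$, and $\mathcal N_{5,n}$ the set of $(n_1,\dots,n_5)\in\mathbb Z^5$ with sum $n$ and $n_i+n_j+n_k+n_l\neq0$ for all $1\le i<j<k<l\le5$. Define, through Fourier coefficients in $x$, $$\hat N_1(u,v,w)(n)=-20in^3\,\hat u(n)\hat v(-n)\hat w(n),\qquad \hat N_2(v_1,\dots,v_5)(n)=6in\sum_{\mathcal N_{5,n}}\hat v_1(n_1)\cdots\hat v_5(n_5),$$ $$\hat N_3(u,v,w)(n)=10in\sum_{\mathcal N_{3,n}}\hat u(n_1)\hat v(n_2)\,n_3^2\hat w(n_3),\qquad \hat N_4(u,v,w)(n)=10in\sum_{\mathcal N_{3,n}}\hat u(n_1)\,n_2\hat v(n_2)\,n_3\hat w(n_3).$$ The series are said to converge if, for every $n$, they converge absolutely,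 uniformly in $t\in[-T,T]$. **Proposition.** (a) Let $s>1$. There is a constant $C$, depending only on $s,c_1,c_2,\eta_0$, such that for all $T\in(0,1]$ and all $u,v,w,v_1,\dots,v_5\in F^s(T)$ the series defining $N_i(u,v,w)$ ($i=3,4$) and $N_2(v_1,\dots,v_5)$ converge, $N_i(u,v,w)\in N^s(T)$ for $i=1,3,4$, $N_2(v_1,\dots,v_5)\in N^s(T)$, and $$\|N_i(u,v,w)\|_{N^s(T)}\le C\|u\|_{F^s(T)}\|v\|_{F^s(T)}\|w\|_{F^s(T)}\quad(i=1,3,4),\qquad \|N_2(v_1,\dots,v_5)\|_{N^s(T)}\le C\prod_{i=1}^5\|v_i\|_{F^s(T)}.$$ (b) Let $\varepsilon>0$. There is a constant $C$, depending only on $\varepsilon,c_1,c_2,\eta_0$, such that the following holds for all $T\in(0,1]$. Let one of $u,v,w$ (in any of the three positions) lie in $F^0(T)$ and the other two in $F^{1+\varepsilon}(T)$, and let $B$ be the product of the $F^0(T)$ norm of the former and the $F^{1+\varepsilon}(T)$ norms of the latter. Then $N_1(u,v,w)\in N^0(T)$ and $\|N_1(u,v,w)\|_{N^0(T)}\le CB$.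 For $i=3,4$: if the series defining $N_i(u,v,w)$ converge, then $N_i(u,v,w)\in N^0(T)$ and $\|N_i(u,v,w)\|_{N^0(T)}\le CB$. In general, if $P_{\le K}$ is applied to the entry in $F^0(T)$, then for each $K \geq 0$ the series converge, the resulting functions lie in $N^0(T)$ with norm at most $CB$, and they form a Cauchy sequence in $N^0(T)$ as $K\to\infty$ (so that $N_i(u,v,w)$ is defined in the completion, with the same bound). If one of $v_1,\dots,v_5$ lies in $F^0(T)$ and the others in $F^{1+\varepsilon}(T)$, then the series defining $N_2(v_1,\dots,v_5)$ converge, $N_2(v_1,\dots,v_5)\in N^0(T)$, and $\|N_2(v_1,\dots,v_5)\|_{N^0(T)}$ is at most $C$ times the product of the $F^0(T)$ norm of that entry and the $F^{1+\varepsilon}(T)$ norms of the other four. -/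

import Mathlib

open MeasureTheory Set Filter
open scoped ENNReal NNReal Topology ContDiff

noncomputable section

namespace FifthMKdV

instance factTwoPiPos : Fact (0 < 2 * Real.pi) := ⟨Real.two_pi_pos⟩

/-- The torus `𝕋 = ℝ / 2πℤ`. -/
abbrev Torus : Type := AddCircle (2 * Real.pi)

/-- The space `L²(𝕋)` of complex-valued functions. -/
abbrev L2T : Type := Lp ℂ 2 (AddCircle.haarAddCircle : Measure Torus)

/-- Fourier coefficients `f̂(n) = (2π)^{-1/2} ∫₀^{2π} e^{-inx} f(x) dx`. Mathlib's `fourierCoeff` is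
the mean of `e^{-inx} f(x)` over the circle, hence the factor `√(2π)`. -/
def hat (f : L2T) (n : ℤ) : ℂ :=
  (Real.sqrt (2 * Real.pi) : ℂ) * fourierCoeff (f : Torus → ℂ) n

/-- A smooth bump function `η₀ : ℝ → [0,1]`, supported in `[-2,2]` and equal to `1` on `[-1,1]`. -/
structure IsBump (η : ℝ → ℝ) : Prop where
  smooth : ContDiff ℝ ∞ η
  mem_Icc : ∀ x, η x ∈ Icc (0 : ℝ) 1
  support_subset : Function.support η ⊆ Icc (-2) 2
  eq_one : ∀ x ∈ Icc (-1 : ℝ) 1, η x = 1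

/-- The dyadic cut-offs `χ₀ = η₀` and `χ_k = η₀(·/2^k) - η₀(·/2^{k-1})`, `k ≥ 1`; they are used both
for frequencies `n` and (then called `η_j`) for modulations `τ - μ(n)`. -/
def chi (η : ℝ → ℝ) : ℕ → ℝ → ℝ
  | 0, x => η x
  | k + 1, x => η (x / 2 ^ (k + 1)) - η (x / 2 ^ k)

/-- The dyadic frequency sets `I₀ = {|n| ≤ 2}`, `I_k = {2^{k-1} ≤ |n| ≤ 2^{k+1}}`, `k ≥ 1`. -/
def dyadic : ℕ → Set ℤ
  | 0 => {n | |n| ≤ 2}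
  | k + 1 => {n | 2 ^ k ≤ |n| ∧ |n| ≤ 2 ^ (k + 2)}

/-- The dispersion relation `μ(n) = n⁵ + c₁ n³ + c₂ n`. -/
def mu (c₁ c₂ : ℝ) (n : ℤ) : ℝ := (n : ℝ) ^ 5 + c₁ * (n : ℝ) ^ 3 + c₂ * (n : ℝ)

/-- The Littlewood-Paley projection `P_k` of the periodic distribution with Fourier coefficients
`a`: the trigonometric polynomial with Fourier coefficients `χ_k(n) a(n)`. (The sum runs over
`|n| ≤ 2^{k+1}`, which contains the support of `χ_k`, and `e^{inx}` has the single nonzero Fourier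
coefficient `√(2π)`.) -/
def proj (η : ℝ → ℝ) (k : ℕ) (a : ℤ → ℂ) : L2T :=
  ∑ n ∈ Finset.Icc (-(2 ^ (k + 1)) : ℤ) (2 ^ (k + 1)),
    ((chi η k (n : ℝ) : ℂ) * a n / (Real.sqrt (2 * Real.pi) : ℂ)) • fourierLp 2 n

/-- `P_{≤ K} = ∑_{k ≤ K} P_k` on `L²(𝕋)`. -/
def projLE (η : ℝ → ℝ) (K : ℕ) (f : L2T) : L2T :=
  ∑ k ∈ Finset.range (K + 1), proj η k (hat f)

/-- The space-time Fourier transform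
`(2π)^{-1/2} ∫_ℝ ∫₀^{2π} e^{-ixn} e^{-itτ} f(t,x) dx dt`. It is only applied to functions that are
square integrable and compactly supported in time. -/
def spaceTimeFourier (f : ℝ → L2T) (τ : ℝ) (n : ℤ) : ℂ :=
  ∫ t : ℝ, Complex.exp (-(Complex.I * (t : ℂ) * (τ : ℂ))) * hat (f t) n

/-- The time-localized function `f(t) η₀(2^{2k}(t - t₀))`. -/
def window (η : ℝ → ℝ) (k : ℕ) (t₀ : ℝ) (f : ℝ → L2T) (t : ℝ) : L2T :=
  (η (2 ^ (2 * k) * (t - t₀)) : ℂ) • f t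

/-- The norm `∑_{j ≥ 0} 2^{j/2} ‖η_j(τ - μ(n)) g(τ,n)‖_{L²_τ ℓ²_n}` of `X_k`. -/
def xNorm (η : ℝ → ℝ) (c₁ c₂ : ℝ) (g : ℝ → ℤ → ℂ) : ℝ≥0∞ :=
  ∑' j : ℕ, ENNReal.ofReal ((2 : ℝ) ^ ((j : ℝ) / 2)) *
    (∑' n : ℤ, ∫⁻ τ : ℝ, ‖(chi η j (τ - mu c₁ c₂ n) : ℂ) * g τ n‖ₑ ^ 2) ^ (1 / 2 : ℝ)

/-- The norm of `F_k`. -/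
def normFk (η : ℝ → ℝ) (c₁ c₂ : ℝ) (k : ℕ) (f : ℝ → L2T) : ℝ≥0∞ :=
  ⨆ t₀ : ℝ, xNorm η c₁ c₂ (spaceTimeFourier (window η k t₀ f))

/-- The norm of `N_k`. -/
def normNk (η : ℝ → ℝ) (c₁ c₂ : ℝ) (k : ℕ) (f : ℝ → L2T) : ℝ≥0∞ :=
  ⨆ t₀ : ℝ, xNorm η c₁ c₂ (fun τ n =>
    (((τ - mu c₁ c₂ n : ℝ) : ℂ) + Complex.I * 2 ^ (2 * k))⁻¹ *
      spaceTimeFourier (window η k t₀ f) τ n)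

/-- `f ∈ L²(ℝ × 𝕋) = L²(ℝ; L²(𝕋))` with space-time Fourier transform supported in `ℝ × I_k`; as
`I_k` restricts only the spatial frequency, this says that `f̂(t,n) = 0` for almost every `t` when
`n ∉ I_k`. -/
def LocalizedL2 (k : ℕ) (f : ℝ → L2T) : Prop :=
  MemLp f 2 volume ∧ ∀ n : ℤ, n ∉ dyadic k → ∀ᵐ t : ℝ, hat (f t) n = 0

/-- The space `F_k`. -/
def MemFk (η : ℝ → ℝ) (c₁ c₂ : ℝ) (k : ℕ) (f : ℝ → L2T) : Prop :=
  LocalizedL2 k f ∧ normFk η c₁ c₂ k f < ⊤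

/-- The space `N_k`. -/
def MemNk (η : ℝ → ℝ) (c₁ c₂ : ℝ) (k : ℕ) (f : ℝ → L2T) : Prop :=
  LocalizedL2 k f ∧ normNk η c₁ c₂ k f < ⊤

/-- `f̃ = f` on `[-T,T] × 𝕋`. -/
def IsExtension (T : ℝ) (f F : ℝ → L2T) : Prop :=
  ∀ᵐ t ∂(volume.restrict (Icc (-T) T)), F t = f t

/-- The norm of `F_k(T)`: the infimum of the norms of the extensions in `F_k` (`⊤` if none). -/
def normFkT (η : ℝ → ℝ) (c₁ c₂ : ℝ) (k : ℕ) (T : ℝ) (f : ℝ → L2T) : ℝ≥0∞ :=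
  ⨅ (F : ℝ → L2T) (_ : MemFk η c₁ c₂ k F) (_ : IsExtension T f F), normFk η c₁ c₂ k F

/-- The norm of `N_k(T)`: the infimum of the norms of the extensions in `N_k` (`⊤` if none). -/
def normNkT (η : ℝ → ℝ) (c₁ c₂ : ℝ) (k : ℕ) (T : ℝ) (f : ℝ → L2T) : ℝ≥0∞ :=
  ⨅ (F : ℝ → L2T) (_ : MemNk η c₁ c₂ k F) (_ : IsExtension T f F), normNk η c₁ c₂ k F

/-- The norm of `F^s(T)`, the square root of `∑_k 2^{2sk} ‖P_k u‖²_{F_k(T)}`. -/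
def normF (η : ℝ → ℝ) (c₁ c₂ : ℝ) (s T : ℝ) (u : ℝ → L2T) : ℝ≥0∞ :=
  (∑' k : ℕ, ENNReal.ofReal ((2 : ℝ) ^ (2 * s * (k : ℝ))) *
    normFkT η c₁ c₂ k T (fun t => proj η k (hat (u t))) ^ 2) ^ (1 / 2 : ℝ)

/-- The space `F^s(T)`: every `P_k u` lies in `F_k(T)`, in particular in `C([-T,T]; L²)`, and the
norm of `u` is finite. -/
def MemF (η : ℝ → ℝ) (c₁ c₂ : ℝ) (s T : ℝ) (u : ℝ → L2T) : Prop :=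
  (∀ k : ℕ, ContinuousOn (fun t => proj η k (hat (u t))) (Icc (-T) T)) ∧
    normF η c₁ c₂ s T u < ⊤

/-- The norm of `N^s(T)`, the square root of `∑_k 2^{2sk} ‖P_k f‖²_{N_k(T)}`. The elements of
`N^s(T)` need not take values in `L²(𝕋)`: at each time they are periodic distributions, given by
their Fourier coefficients `f t : ℤ → ℂ`. -/
def normN (η : ℝ → ℝ) (c₁ c₂ : ℝ) (s T : ℝ) (f : ℝ → ℤ → ℂ) : ℝ≥0∞ :=
  (∑' k : ℕ, ENNReal.ofReal ((2 : ℝ) ^ (2 * s * (k : ℝ))) *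
    normNkT η c₁ c₂ k T (fun t => proj η k (f t)) ^ 2) ^ (1 / 2 : ℝ)

/-- The space `N^s(T)`. -/
def MemN (η : ℝ → ℝ) (c₁ c₂ : ℝ) (s T : ℝ) (f : ℝ → ℤ → ℂ) : Prop :=
  (∀ k : ℕ, ContinuousOn (fun t => proj η k (f t)) (Icc (-T) T)) ∧
    normN η c₁ c₂ s T f < ⊤

/-- The cubic non-resonant set `𝒩_{3,n}`. -/
def nonres3 (n : ℤ) : Set (Fin 3 → ℤ) :=
  {m | m 0 + m 1 + m 2 = n ∧ (m 0 + m 1) * (m 0 + m 2) * (m 1 + m 2) ≠ 0}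

/-- The quintic non-resonant set `𝒩_{5,n}`: no four of the five frequencies (all but the `j`-th)
add up to zero. -/
def nonres5 (n : ℤ) : Set (Fin 5 → ℤ) :=
  {m | ∑ i, m i = n ∧ ∀ j, ∑ i ∈ Finset.univ.erase j, m i ≠ 0}

/-- The resonant cubic term: the `n`-th Fourier coefficient of `N₁(u,v,w)` is
`-20 i n³ û(n) v̂(-n) ŵ(n)`. For real-valued `u = v = w` this is `-20 i n³ |û(n)|² û(n)`. -/
def N₁ (u : Fin 3 → ℝ → L2T) (t : ℝ) (n : ℤ) : ℂ :=
  -20 * Complex.I * (n : ℂ) ^ 3 * (hat (u 0 t) n * hat (u 1 t) (-n) * hat (u 2 t) n)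

/-- The terms of the series of the quintic nonlinearity. -/
def quinticTerm (u : Fin 5 → ℝ → L2T) (n : ℤ) (m : Fin 5 → ℤ) (t : ℝ) : ℂ :=
  6 * Complex.I * (n : ℂ) * ∏ j, hat (u j t) (m j)

/-- The terms of the series of a cubic non-resonant nonlinearity with derivative symbol `σ`. -/
def cubicTerm (σ : (Fin 3 → ℤ) → ℤ) (u : Fin 3 → ℝ → L2T) (n : ℤ) (m : Fin 3 → ℤ) (t : ℝ) : ℂ :=
  10 * Complex.I * (n : ℂ) * ((σ m : ℂ) * ∏ j, hat (u j t) (m j))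

/-- The derivative symbol `n₃²` of `N₃`. -/
def sigma₃ (m : Fin 3 → ℤ) : ℤ := m 2 ^ 2

/-- The derivative symbol `n₂ n₃` of `N₄`. -/
def sigma₄ (m : Fin 3 → ℤ) : ℤ := m 1 * m 2

/-- The quintic nonlinearity `N₂`, through its Fourier coefficients. -/
def N₂ (u : Fin 5 → ℝ → L2T) (t : ℝ) (n : ℤ) : ℂ :=
  ∑' m : nonres5 n, quinticTerm u n m t

/-- The cubic non-resonant nonlinearity with symbol `σ`, through its Fourier coefficients. -/
def cubicNonres (σ : (Fin 3 → ℤ) → ℤ) (u : Fin 3 → ℝ → L2T) (t : ℝ) (n : ℤ) : ℂ :=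
  ∑' m : nonres3 n, cubicTerm σ u n m t

/-- `N₃(u,v,w)`, with Fourier coefficients `10 i n ∑_{𝒩_{3,n}} û(n₁) v̂(n₂) n₃² ŵ(n₃)`. -/
abbrev N₃ : (Fin 3 → ℝ → L2T) → ℝ → ℤ → ℂ := cubicNonres sigma₃

/-- `N₄(u,v,w)`, with Fourier coefficients `10 i n ∑_{𝒩_{3,n}} û(n₁) n₂ v̂(n₂) n₃ ŵ(n₃)`. -/
abbrev N₄ : (Fin 3 → ℝ → L2T) → ℝ → ℤ → ℂ := cubicNonres sigma₄

/-- A series of functions of time converges absolutely, uniformly on `[-T,T]`. -/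
def ConvergesOn {ι : Type*} (T : ℝ) (f : ι → ℝ → ℂ) : Prop :=
  SummableUniformlyOn (fun i t => ‖f i t‖) (Icc (-T) T)

/-- The series that define the Fourier coefficients of `N₂(v₁,…,v₅)` converge. -/
def QuinticConverges (T : ℝ) (u : Fin 5 → ℝ → L2T) : Prop :=
  ∀ n : ℤ, ConvergesOn T (fun (m : nonres5 n) t => quinticTerm u n m t)

/-- The series that define the Fourier coefficients of `cubicNonres σ u` converge. -/
def CubicConverges (σ : (Fin 3 → ℤ) → ℤ) (T : ℝ) (u : Fin 3 → ℝ → L2T) : Prop :=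
  ∀ n : ℤ, ConvergesOn T (fun (m : nonres3 n) t => cubicTerm σ u n m t)

/-- The tuple `u` with `P_{≤ K}` applied to its `i`-th entry. -/
def truncAt (η : ℝ → ℝ) (i : Fin 3) (K : ℕ) (u : Fin 3 → ℝ → L2T) : Fin 3 → ℝ → L2T :=
  Function.update u i (fun t => projLE η K (u i t))

end FifthMKdV

end

open FifthMKdV
open scoped NNReal ENNReal

noncomputable section

/-! Everything reduces to one estimate for dyadic blocks, `BlockBound`. Let the entries have
frequencies of size `2^{k_j}` and the output frequency size `2^k`. For every choice of an index `i`,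
the `N_k` norm of the block is at most a constant times `∏_{j≠i} 2^{k_j}` times the product of the
`F_{k_j}` sizes of the entries. The entry `i` loses nothing and each other entry loses one
derivative, so entries in `F^{1+ε}` have `2^{-εk_j}` to spare. The frequencies of a nonzero block
add up, hence `|k - k_i| ≤ Σ_{j≠i} k_j + 5`. Half of the spare decay sums over the other `k_j`, the
other half becomes decay in `|k - k_i|`, and Schur's test concludes (`sn_tsum_blocks_le`). In (b)
the index `i` is the rough entry; in (a) it is an entry whose frequency dominates that of the output
and which receives the weight `2^{sk}`.

A window of `N_k` has length about `2^{-2k}` and the symbol `τ - μ(n) + i2^{2k}` is at least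
`2^{2k}` in size. A bound that ignores modulations therefore gains `2^{-2k}` over the `ℓ²` operator
norm of the block (`xNorm_blkT_le`). This is enough for `N₁`, for `N₂`, and for cubic blocks whose
four frequencies are comparable. For the other cubic blocks, with largest frequency `2^K`, the
resonance function factors as `(n₁+n₂)(n₁+n₃)(n₂+n₃)(5/2(n₁²+n₂²+n₃²+n²)+3c₁)` and is at least of
order `2^{4K}` (`resonance_lower`). The window is cut into about `2^{2(K-k)}` pieces of length
`2^{-2K}`, on which every entry is a superposition of exponentials. Either some modulation is at
least of order `2^{4K}`, or the time integral over the piece oscillates at that rate. Both cases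
gain a further `2^{-K}` (`xNorm_blkT_le_of_resonance`).

The nonlinearity is extended by zero outside `(-T,T)`. Sharp cut-offs in time are harmless because
only the decay `1/|θ|` of oscillatory integrals is used; the resulting factor `K` is absorbed by a
power of `2^K`. The convergence of the series is a separate, fixed-time argument at a fixed output
frequency, and it is also what permits summing the block bounds. -/

namespace FifthMKdV

/-! ### The Fourier transform in time. -/

open FourierTransform SchwartzMap in
/-- The `L²` Fourier transform of an integrable function is given by the Fourier integral. -/
theorem fourier_toLp_ae {f : ℝ → ℂ} (h1 : Integrable f) (h2 : MemLp f 2) :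
    (𝓕 (h2.toLp f) : Lp ℂ 2 (volume : Measure ℝ)) =ᵐ[volume] 𝓕 f := by
  have hcont : Continuous (𝓕 f) := by
    have := VectorFourier.fourierIntegral_continuous Real.continuous_fourierChar
      (L := innerₗ ℝ) (by exact continuous_inner) h1
    exact this
  apply ae_eq_of_integral_contDiff_smul_eq
  · exact (Lp.memLp (𝓕 (h2.toLp f))).locallyIntegrable (by norm_num)
  · exact hcont.locallyIntegrable
  · intro g hg hgc
    set G : 𝓢(ℝ, ℂ) := (HasCompactSupport.toSchwartzMap
      (f := fun x => (g x : ℂ)) (hgc.comp_left (g := fun x : ℝ => (x : ℂ)) (by simp))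
      (Complex.ofRealCLM.contDiff.comp hg)) with hG
    have hGg : ∀ x, G x = (g x : ℂ) := fun x => rfl
    -- Both transforms are tested against a smooth compactly supported function, viewed as the
    -- Schwartz function `G`. For the `L²` transform, compatibility with tempered distributions
    -- moves the transform onto `G`; `e3` is the same exchange for the Fourier integral.
    have e1 := congrArg (fun D : 𝓢'(ℝ, ℂ) => D G) (Lp.fourier_toTemperedDistribution_eq (h2.toLp f))
    simp only [TemperedDistribution.fourier_apply, Lp.toTemperedDistribution_apply] at e1
    have e2 : ∫ x, (𝓕 G) x • (h2.toLp f : ℝ → ℂ) x = ∫ x, (𝓕 G) x • f x := by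
      apply integral_congr_ae
      filter_upwards [h2.coeFn_toLp] with x hx
      rw [hx]
    have e3 : ∫ x, (𝓕 (G : ℝ → ℂ)) x • f x = ∫ x, G x • 𝓕 f x := by
      have := VectorFourier.integral_fourierIntegral_smul_eq_flip (L := innerₗ ℝ)
        (μ := volume) (ν := volume) Real.continuous_fourierChar (by exact continuous_inner)
        G.integrable h1
      simpa using! this
    have e4 : ∀ x, g x • 𝓕 f x = G x • 𝓕 f x := fun x => by simp [hGg]
    have e5 : ∀ x, g x • (𝓕 (h2.toLp f) : Lp ℂ 2 (volume : Measure ℝ)) x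
      = G x • (𝓕 (h2.toLp f) : Lp ℂ 2 (volume : Measure ℝ)) x := fun x => by simp [hGg]
    simp_rw [e4, e5]
    rw [← e1, ← e3, e2]
    rfl

open FourierTransform in
/-- Plancherel's identity for functions in `L¹ ∩ L²`. -/
theorem lintegral_fourier_sq {f : ℝ → ℂ} (h1 : Integrable f) (h2 : MemLp f 2) :
    ∫⁻ x, ‖𝓕 f x‖ₑ ^ 2 = ∫⁻ x, ‖f x‖ₑ ^ 2 := by
  have key : eLpNorm (𝓕 f) 2 volume = eLpNorm f 2 volume := by
    rw [← eLpNorm_congr_ae (fourier_toLp_ae h1 h2), ← eLpNorm_congr_ae h2.coeFn_toLp,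
      ← Lp.enorm_def, ← Lp.enorm_def, ← ofReal_norm, ← ofReal_norm, Lp.norm_fourier_eq]
  have conv : ∀ g : ℝ → ℂ, ∫⁻ x, ‖g x‖ₑ ^ 2 = eLpNorm g 2 volume ^ 2 := fun g => by
    rw [eLpNorm_eq_lintegral_rpow_enorm_toReal (by norm_num) (by norm_num)]
    rw [← ENNReal.rpow_natCast, ← ENNReal.rpow_mul]
    simp
  rw [conv, conv, key]

/-- The Fourier transform `∫ e^{-itτ} f(t) dt`. -/
def ft (f : ℝ → ℂ) (τ : ℝ) : ℂ := ∫ t : ℝ, Complex.exp (-(Complex.I * (t : ℂ) * (τ : ℂ))) * f t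

open FourierTransform in
theorem ft_eq_fourier (f : ℝ → ℂ) (τ : ℝ) : ft f τ = 𝓕 f (τ / (2 * Real.pi)) := by
  rw [Real.fourier_real_eq_integral_exp_smul, ft]
  congr 1; ext t
  rw [smul_eq_mul]; congr 2
  push_cast; field_simp

theorem norm_exp_I_mul (t τ : ℝ) : ‖Complex.exp (Complex.I * (t : ℂ) * (τ : ℂ))‖ = 1 := by
  rw [Complex.norm_exp]; simp

theorem norm_exp_neg_I_mul (t τ : ℝ) :
    ‖Complex.exp (-(Complex.I * (t : ℂ) * (τ : ℂ)))‖ = 1 := by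
  rw [Complex.norm_exp]; simp

open FourierTransform in
theorem continuous_ft {f : ℝ → ℂ} (h1 : Integrable f) : Continuous (ft f) := by
  have : Continuous (𝓕 f) := VectorFourier.fourierIntegral_continuous Real.continuous_fourierChar
      (L := innerₗ ℝ) (by exact continuous_inner) h1
  have h : ft f = fun τ => 𝓕 f (τ / (2 * Real.pi)) := funext (ft_eq_fourier f)
  rw [h]; fun_prop

theorem lintegral_comp_div (f : ℝ → ℝ≥0∞) (hf : Measurable f) {a : ℝ} (ha : 0 < a) :
    ∫⁻ x, f (x / a) = ENNReal.ofReal a * ∫⁻ x, f x := by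
  have h := Real.map_volume_mul_left (a := a⁻¹) (inv_ne_zero ha.ne')
  have h2 : ∫⁻ x, f x ∂(Measure.map (a⁻¹ * ·) volume) = ∫⁻ x, f (a⁻¹ * x) :=
    lintegral_map hf (measurable_const_mul _)
  rw [h, lintegral_smul_measure] at h2
  rw [inv_inv, abs_of_pos ha, smul_eq_mul] at h2
  rw [h2]; congr 1; ext x; ring_nf

/-- Plancherel's identity for `ft`. -/
theorem lintegral_ft_sq {f : ℝ → ℂ} (h1 : Integrable f) (h2 : MemLp f 2) :
    ∫⁻ τ, ‖ft f τ‖ₑ ^ 2 = ENNReal.ofReal (2 * Real.pi) * ∫⁻ x, ‖f x‖ₑ ^ 2 := by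
  rw [← lintegral_fourier_sq h1 h2]
  simp_rw [ft_eq_fourier]
  apply lintegral_comp_div (fun x => ‖FourierTransform.fourier f x‖ₑ ^ 2) _ Real.two_pi_pos
  have : Continuous (FourierTransform.fourier f : ℝ → ℂ) :=
    VectorFourier.fourierIntegral_continuous Real.continuous_fourierChar
      (L := innerₗ ℝ) (by exact continuous_inner) h1
  fun_prop

/-- The inverse transform `∫ e^{itτ} g(τ) dτ`, without normalization. -/
def ift (g : ℝ → ℂ) (t : ℝ) : ℂ := ∫ τ : ℝ, Complex.exp (Complex.I * (t : ℂ) * (τ : ℂ)) * g τ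

theorem ift_eq_ft (g : ℝ → ℂ) (t : ℝ) : ift g t = ft g (-t) := by
  rw [ift, ft]; congr 1; ext τ; congr 2; push_cast; ring

theorem continuous_ift {g : ℝ → ℂ} (h1 : Integrable g) : Continuous (ift g) := by
  have h : ift g = fun t => ft g (-t) := funext (ift_eq_ft g)
  rw [h]; exact (continuous_ft h1).comp continuous_neg

theorem lintegral_ift_sq {g : ℝ → ℂ} (h1 : Integrable g) (h2 : MemLp g 2) :
    ∫⁻ t, ‖ift g t‖ₑ ^ 2 = ENNReal.ofReal (2 * Real.pi) * ∫⁻ x, ‖g x‖ₑ ^ 2 := by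
  rw [← lintegral_ft_sq h1 h2]
  simp_rw [ift_eq_ft]
  exact lintegral_neg_eq_self (fun t => ‖ft g t‖ₑ ^ 2)

theorem enorm_ift_le (g : ℝ → ℂ) (t : ℝ) : ‖ift g t‖ₑ ≤ ∫⁻ τ, ‖g τ‖ₑ := by
  refine (enorm_integral_le_lintegral_enorm _).trans (lintegral_mono fun τ => ?_)
  rw [enorm_mul, ← ofReal_norm, norm_exp_I_mul]; simp

open FourierTransform in
/-- Fourier inversion at points of continuity. -/
theorem ift_ft {f : ℝ → ℂ} (h1 : Integrable f) (h2 : Integrable (ft f)) {t : ℝ}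
    (ht : ContinuousAt f t) : f t = (2 * Real.pi : ℂ)⁻¹ * ift (ft f) t := by
  have e : (𝓕 f : ℝ → ℂ) = fun x => ft f (x * (2 * Real.pi)) := by
    ext x; rw [ft_eq_fourier]; field_simp
  have h3 : Integrable (𝓕 f) := by
    rw [e]; exact h2.comp_mul_right' Real.two_pi_pos.ne'
  rw [← h1.fourierInv_fourier_eq h3 ht, Real.fourierInv_eq']
  have : ∀ v : ℝ, Complex.exp (↑(2 * Real.pi * inner ℝ v t) * Complex.I) • 𝓕 f v
     = (fun τ : ℝ => Complex.exp (Complex.I * (t : ℂ) * (τ : ℂ)) * ft f τ) (v * (2 * Real.pi)) := by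
    intro v
    rw [e]; simp only [smul_eq_mul]; congr 2
    simp; ring
  simp_rw [this]
  rw [Measure.integral_comp_mul_right (fun τ : ℝ => Complex.exp (Complex.I * (t : ℂ) * (τ : ℂ)) * ft f τ) (2 * Real.pi), ift, abs_of_pos (inv_pos.mpr Real.two_pi_pos)]
  simp

/-! ### `L²` and `ℓ²` norms with values in `[0,∞]`. -/

/-- The `L²` norm of a nonnegative function. -/
def nrm {α : Type*} [MeasurableSpace α] (ν : Measure α) (f : α → ℝ≥0∞) : ℝ≥0∞ :=
  (∫⁻ x, f x ^ 2 ∂ν) ^ (1 / 2 : ℝ)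

theorem sq_rpow_half (x : ℝ≥0∞) : (x ^ 2) ^ (1 / 2 : ℝ) = x := by
  rw [← ENNReal.rpow_natCast, ← ENNReal.rpow_mul]; simp

theorem rpow_half_sq (x : ℝ≥0∞) : (x ^ (1 / 2 : ℝ)) ^ 2 = x := by
  rw [← ENNReal.rpow_natCast, ← ENNReal.rpow_mul]; simp

theorem rpow_half_le_iff {x b : ℝ≥0∞} : x ^ (1 / 2 : ℝ) ≤ b ↔ x ≤ b ^ 2 := by
  constructor
  · intro h; rw [← rpow_half_sq x]; gcongr
  · intro h; rw [← sq_rpow_half b]; gcongr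

section nrm
variable {α : Type*} [MeasurableSpace α] {ν : Measure α}

theorem nrm_sq (f : α → ℝ≥0∞) : nrm ν f ^ 2 = ∫⁻ x, f x ^ 2 ∂ν := rpow_half_sq _

theorem nrm_le_iff {f : α → ℝ≥0∞} {b : ℝ≥0∞} : nrm ν f ≤ b ↔ ∫⁻ x, f x ^ 2 ∂ν ≤ b ^ 2 :=
  rpow_half_le_iff

theorem nrm_mono {f g : α → ℝ≥0∞} (h : ∀ x, f x ≤ g x) : nrm ν f ≤ nrm ν g := by
  unfold nrm; gcongr with x; exact h x

theorem nrm_const_mul (c : ℝ≥0∞) {f : α → ℝ≥0∞} (hf : Measurable f) :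
    nrm ν (fun x => c * f x) = c * nrm ν f := by
  unfold nrm
  simp_rw [mul_pow]
  rw [lintegral_const_mul _ (hf.pow_const 2), ENNReal.mul_rpow_of_nonneg _ _ (by norm_num),
    sq_rpow_half]

theorem nrm_add_le {f g : α → ℝ≥0∞} (hf : Measurable f) (hg : Measurable g) :
    nrm ν (fun x => f x + g x) ≤ nrm ν f + nrm ν g := by
  have := ENNReal.lintegral_Lp_add_le (μ := ν) hf.aemeasurable hg.aemeasurable
    (p := 2) (by norm_num)
  simpa [nrm] using this

theorem nrm_sum_le {ι : Type*} (s : Finset ι) {f : ι → α → ℝ≥0∞} (hf : ∀ i, Measurable (f i)) :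
    nrm ν (fun x => ∑ i ∈ s, f i x) ≤ ∑ i ∈ s, nrm ν (f i) := by
  classical
  induction s using Finset.induction_on with
  | empty => simp [nrm]
  | insert a s ha ih =>
    simp_rw [Finset.sum_insert ha]
    refine (nrm_add_le (hf a) (Finset.measurable_sum s fun i _ => hf i)).trans ?_
    gcongr

/-- Minkowski's inequality for countable sums. -/
theorem nrm_tsum_le {ι : Type*} [Countable ι] {f : ι → α → ℝ≥0∞} (hf : ∀ i, Measurable (f i)) :
    nrm ν (fun x => ∑' i, f i x) ≤ ∑' i, nrm ν (f i) := by
  rw [nrm_le_iff]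
  -- The sum is a directed supremum of finite partial sums and squaring is monotone and continuous,
  -- so monotone convergence reduces the claim to finite sums.
  have e : ∀ x, (∑' i, f i x) ^ 2 = ⨆ s : Finset ι, (∑ i ∈ s, f i x) ^ 2 := by
    intro x
    rw [ENNReal.tsum_eq_iSup_sum]
    have hm : Monotone fun y : ℝ≥0∞ => y ^ 2 := fun a b h => by dsimp only; gcongr
    exact hm.map_iSup_of_continuousAt
      (ENNReal.continuous_pow 2).continuousAt (by simp)
  simp_rw [e]
  rw [lintegral_iSup_directed]
  · refine iSup_le fun s => ?_
    rw [← nrm_le_iff]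
    exact (nrm_sum_le s hf).trans (ENNReal.sum_le_tsum s)
  · intro s
    exact ((Finset.measurable_sum s fun i _ => hf i).pow_const 2).aemeasurable
  · classical
    intro s t
    refine ⟨s ∪ t, fun x => ?_, fun x => ?_⟩
    · dsimp only; gcongr; exact Finset.subset_union_left
    · dsimp only; gcongr; exact Finset.subset_union_right

/-- The Cauchy-Schwarz inequality. -/
theorem lintegral_mul_le_nrm {f g : α → ℝ≥0∞} (hf : Measurable f) (hg : Measurable g) :
    ∫⁻ x, f x * g x ∂ν ≤ nrm ν f * nrm ν g := by
  have := ENNReal.lintegral_mul_le_Lp_mul_Lq ν (p := 2) (q := 2)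
    (Real.holderConjugate_iff.mpr (by norm_num)) hf.aemeasurable hg.aemeasurable
  simpa [nrm] using this

end nrm

/-- The `ℓ²` norm of a nonnegative family. -/
def sn {ι : Type*} (a : ι → ℝ≥0∞) : ℝ≥0∞ := (∑' i, a i ^ 2) ^ (1 / 2 : ℝ)

section sn
variable {ι : Type*}

theorem sn_eq_nrm [Countable ι] (a : ι → ℝ≥0∞) :
    sn a = @nrm ι ⊤ (@Measure.count ι ⊤) a := by
  let : MeasurableSpace ι := ⊤
  rw [sn, nrm, lintegral_count]

theorem sn_sq (a : ι → ℝ≥0∞) : sn a ^ 2 = ∑' i, a i ^ 2 := rpow_half_sq _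

theorem sn_le_iff {a : ι → ℝ≥0∞} {b : ℝ≥0∞} : sn a ≤ b ↔ ∑' i, a i ^ 2 ≤ b ^ 2 :=
  rpow_half_le_iff

theorem sn_mono {a b : ι → ℝ≥0∞} (h : ∀ i, a i ≤ b i) : sn a ≤ sn b := by
  unfold sn; gcongr with i; exact h i

theorem le_sn (a : ι → ℝ≥0∞) (i : ι) : a i ≤ sn a := by
  rw [← sq_rpow_half (a i)]
  unfold sn; gcongr; exact ENNReal.le_tsum (f := fun i => a i ^ 2) i

theorem sn_const_mul (c : ℝ≥0∞) (a : ι → ℝ≥0∞) : sn (fun i => c * a i) = c * sn a := by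
  unfold sn
  simp_rw [mul_pow]
  rw [ENNReal.tsum_mul_left, ENNReal.mul_rpow_of_nonneg _ _ (by norm_num), sq_rpow_half]

theorem sn_tsum_le [Countable ι] {κ : Type*} [Countable κ] (a : κ → ι → ℝ≥0∞) :
    sn (fun i => ∑' k, a k i) ≤ ∑' k, sn (a k) := by
  let : MeasurableSpace ι := ⊤
  simp_rw [sn_eq_nrm]
  exact nrm_tsum_le fun k => measurable_from_top

theorem sn_sum_le [Countable ι] {κ : Type*} (s : Finset κ) (a : κ → ι → ℝ≥0∞) :
    sn (fun i => ∑ k ∈ s, a k i) ≤ ∑ k ∈ s, sn (a k) := by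
  let : MeasurableSpace ι := ⊤
  simp_rw [sn_eq_nrm]
  exact nrm_sum_le s fun k => measurable_from_top

theorem tsum_mul_le_sn [Countable ι] (a b : ι → ℝ≥0∞) : ∑' i, a i * b i ≤ sn a * sn b := by
  let : MeasurableSpace ι := ⊤
  simp_rw [sn_eq_nrm]
  rw [← lintegral_count]
  exact lintegral_mul_le_nrm measurable_from_top measurable_from_top

theorem sn_comp_equiv {κ : Type*} (e : κ ≃ ι) (a : ι → ℝ≥0∞) : sn (fun k => a (e k)) = sn a := by
  unfold sn; rw [e.tsum_eq (fun i => a i ^ 2)]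

end sn

/-- The `L²_τ ℓ²_n` norm. -/
def ln (G : ℝ → ℤ → ℝ≥0∞) : ℝ≥0∞ := (∑' n : ℤ, ∫⁻ τ : ℝ, G τ n ^ 2) ^ (1 / 2 : ℝ)

theorem ln_sq (G : ℝ → ℤ → ℝ≥0∞) : ln G ^ 2 = ∑' n : ℤ, ∫⁻ τ : ℝ, G τ n ^ 2 := rpow_half_sq _

theorem ln_le_iff {G : ℝ → ℤ → ℝ≥0∞} {b : ℝ≥0∞} :
    ln G ≤ b ↔ ∑' n : ℤ, ∫⁻ τ : ℝ, G τ n ^ 2 ≤ b ^ 2 := rpow_half_le_iff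

theorem ln_mono {F G : ℝ → ℤ → ℝ≥0∞} (h : ∀ τ n, F τ n ≤ G τ n) : ln F ≤ ln G := by
  unfold ln; gcongr with n τ; exact h τ n

theorem ln_eq_nrm {G : ℝ → ℤ → ℝ≥0∞} (hG : ∀ n, Measurable fun τ => G τ n) :
    ln G = nrm ((Measure.count : Measure ℤ).prod volume) (fun p => G p.2 p.1) := by
  unfold ln nrm
  have hm : Measurable fun p : ℤ × ℝ => G p.2 p.1 :=
    measurable_from_prod_countable_right hG
  rw [lintegral_prod _ (hm.pow_const 2).aemeasurable, lintegral_count]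

theorem ln_const_mul (c : ℝ≥0∞) {G : ℝ → ℤ → ℝ≥0∞} (hG : ∀ n, Measurable fun τ => G τ n) :
    ln (fun τ n => c * G τ n) = c * ln G := by
  unfold ln
  simp_rw [mul_pow, lintegral_const_mul _ ((hG _).pow_const 2)]
  rw [ENNReal.tsum_mul_left, ENNReal.mul_rpow_of_nonneg _ _ (by norm_num), sq_rpow_half]

theorem ln_tsum_le {ι : Type*} [Countable ι] {G : ι → ℝ → ℤ → ℝ≥0∞}
    (hG : ∀ i n, Measurable fun τ => G i τ n) :
    ln (fun τ n => ∑' i, G i τ n) ≤ ∑' i, ln (G i) := by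
  rw [ln_eq_nrm fun n => Measurable.tsum fun i => hG i n]
  simp_rw [ln_eq_nrm (hG _)]
  exact nrm_tsum_le fun i => measurable_from_prod_countable_right (hG i)

/-! ### Powers of `√2` and geometric sums. -/

/-- The square root of `2`. -/
def rt : ℝ≥0∞ := (2 : ℝ≥0∞) ^ (1 / 2 : ℝ)

theorem rt_sq : rt ^ 2 = 2 := rpow_half_sq 2

theorem one_lt_rt : 1 < rt := by
  unfold rt; exact ENNReal.one_lt_rpow (by norm_num) (by norm_num)

theorem rt_ne_top : rt ≠ ⊤ := by unfold rt; simp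

theorem rt_ne_zero : rt ≠ 0 := (zero_lt_one.trans one_lt_rt).ne'

theorem rt_mul_inv : rt * rt⁻¹ = 1 := ENNReal.mul_inv_cancel rt_ne_zero rt_ne_top

theorem rt_pow_mul_inv (j : ℕ) : rt ^ j * rt⁻¹ ^ j = 1 := by
  rw [← mul_pow, rt_mul_inv, one_pow]

theorem rt_inv_lt_one : rt⁻¹ < 1 := ENNReal.inv_lt_one.mpr one_lt_rt

theorem rt_pow_two_mul (j : ℕ) : rt ^ (2 * j) = 2 ^ j := by rw [pow_mul, rt_sq]

theorem rt_inv_pow_two_mul (j : ℕ) : rt⁻¹ ^ (2 * j) = (2 ^ j)⁻¹ := by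
  rw [← rt_pow_two_mul, ENNReal.inv_pow]

/-- All half-integer powers of two are written as natural powers of `rt`, so that comparing dyadic
factors becomes linear arithmetic in the exponents. -/
theorem ofReal_two_rpow_half (j : ℕ) : ENNReal.ofReal ((2 : ℝ) ^ ((j : ℝ) / 2)) = rt ^ j := by
  rw [← ENNReal.ofReal_rpow_of_pos (by norm_num), rt, ← ENNReal.rpow_natCast, ← ENNReal.rpow_mul]
  norm_num; ring_nf

/-- The distance of two natural numbers. -/
def nd (j a : ℕ) : ℕ := (j - a) + (a - j)

theorem nd_comm (j a : ℕ) : nd j a = nd a j := by unfold nd; omega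

theorem tsum_pow_nd_le (ρ : ℝ≥0∞) (a : ℕ) : ∑' j, ρ ^ nd j a ≤ 2 * (1 - ρ)⁻¹ := by
  -- The sum splits into `j < a` and `j ≥ a`; each part is dominated by the full geometric series.
  have h : ∀ a, ∑' j, ρ ^ nd j a = ∑ i ∈ Finset.range a, ρ ^ (i + 1) + ∑' j, ρ ^ j := by
    intro a
    induction a with
    | zero => simp [nd]
    | succ a ih =>
      rw [tsum_eq_zero_add' ENNReal.summable, Finset.sum_range_succ]
      have : ∀ j, nd (j + 1) (a + 1) = nd j a := fun j => by unfold nd; omega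
      simp_rw [this, ih]
      simp [nd]; ring
  rw [h, ENNReal.tsum_geometric, two_mul]
  gcongr
  rw [← ENNReal.tsum_geometric]
  calc ∑ i ∈ Finset.range a, ρ ^ (i + 1) ≤ ∑' i, ρ ^ (i + 1) := ENNReal.sum_le_tsum _
    _ ≤ ρ ^ 0 + ∑' i, ρ ^ (i + 1) := le_add_self
    _ = _ := (tsum_eq_zero_add' ENNReal.summable).symm

/-- The value of the geometric series with ratio `1 / √2`. -/
def geomQ : ℝ≥0∞ := (1 - rt⁻¹)⁻¹

theorem geomQ_ne_top : geomQ ≠ ⊤ := by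
  unfold geomQ; rw [ENNReal.inv_ne_top]; exact (tsub_pos_of_lt rt_inv_lt_one).ne'

/-! ### The dyadic cut-offs. -/

section chi
variable {η : ℝ → ℝ}

theorem abs_chi_le (hη : IsBump η) (k : ℕ) (x : ℝ) : |chi η k x| ≤ 1 := by
  cases k with
  | zero => have := hη.mem_Icc x; simp only [chi]; rw [abs_le]; constructor <;> linarith [this.1, this.2]
  | succ k =>
    have h1 := hη.mem_Icc (x / 2 ^ (k + 1)); have h2 := hη.mem_Icc (x / 2 ^ k)
    simp only [chi]; rw [abs_le]; constructor <;> linarith [h1.1, h1.2, h2.1, h2.2]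

theorem bump_eq_zero (hη : IsBump η) {x : ℝ} (h : 2 < |x|) : η x = 0 := by
  by_contra h0
  have := hη.support_subset h0
  rw [mem_Icc, ← abs_le] at this; linarith

theorem bump_eq_one (hη : IsBump η) {x : ℝ} (h : |x| ≤ 1) : η x = 1 :=
  hη.eq_one x (abs_le.mp h)

theorem bump_div_eq_zero (hη : IsBump η) {x : ℝ} {k : ℕ} (h : 2 ^ (k + 1) < |x|) :
    η (x / 2 ^ k) = 0 := by
  apply bump_eq_zero hη
  rw [abs_div, abs_of_pos (by positivity : (0 : ℝ) < 2 ^ k), lt_div_iff₀ (by positivity)]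
  calc _ = (2 : ℝ) ^ (k + 1) := by ring
    _ < _ := h

theorem bump_div_eq_one (hη : IsBump η) {x : ℝ} {k : ℕ} (h : |x| ≤ 2 ^ k) :
    η (x / 2 ^ k) = 1 := by
  apply bump_eq_one hη
  rw [abs_div, abs_of_pos (by positivity : (0 : ℝ) < 2 ^ k), div_le_one (by positivity)]
  exact h

theorem chi_eq_zero_of_gt (hη : IsBump η) {k : ℕ} {x : ℝ} (h : 2 ^ (k + 1) < |x|) :
    chi η k x = 0 := by
  cases k with
  | zero => exact bump_eq_zero hη (by simpa using h)
  | succ k =>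
    simp only [chi]
    rw [bump_div_eq_zero hη h, bump_div_eq_zero hη, sub_zero]
    refine lt_of_le_of_lt ?_ h
    exact pow_le_pow_right₀ (by norm_num) (by omega)

theorem chi_eq_zero_of_le (hη : IsBump η) {k : ℕ} {x : ℝ} (h : |x| ≤ 2 ^ k) :
    chi η (k + 1) x = 0 := by
  simp only [chi]
  rw [bump_div_eq_one hη h, bump_div_eq_one hη, sub_self]
  exact h.trans (pow_le_pow_right₀ (by norm_num) (by omega))

theorem abs_le_of_chi_ne (hη : IsBump η) {k : ℕ} {x : ℝ} (h : chi η k x ≠ 0) :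
    |x| ≤ 2 ^ (k + 1) := by
  by_contra! h'; exact h (chi_eq_zero_of_gt hη h')

theorem lt_abs_of_chi_ne (hη : IsBump η) {k : ℕ} {x : ℝ} (h : chi η (k + 1) x ≠ 0) :
    2 ^ k < |x| := by
  by_contra! h'; exact h (chi_eq_zero_of_le hη h')

theorem abs_int_le_of_chi_ne (hη : IsBump η) {k : ℕ} {n : ℤ} (h : chi η k n ≠ 0) :
    |n| ≤ 2 ^ (k + 1) := by
  have := abs_le_of_chi_ne hη h; exact_mod_cast this

theorem lt_abs_int_of_chi_ne (hη : IsBump η) {k : ℕ} {n : ℤ} (h : chi η (k + 1) n ≠ 0) :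
    2 ^ k < |n| := by
  have := lt_abs_of_chi_ne hη h; exact_mod_cast this

theorem mem_dyadic_of_chi_ne (hη : IsBump η) {k : ℕ} {n : ℤ} (h : chi η k n ≠ 0) :
    n ∈ dyadic k := by
  cases k with
  | zero => simpa [dyadic] using abs_int_le_of_chi_ne hη h
  | succ k => exact ⟨(lt_abs_int_of_chi_ne hη h).le, abs_int_le_of_chi_ne hη h⟩

theorem sum_chi (η : ℝ → ℝ) (K : ℕ) (x : ℝ) :
    ∑ k ∈ Finset.range (K + 1), chi η k x = η (x / 2 ^ K) := by
  induction K with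
  | zero => simp [chi]
  | succ K ih => rw [Finset.sum_range_succ, ih]; simp [chi]

theorem measurable_chi (hη : IsBump η) (k : ℕ) : Measurable (chi η k) := by
  have := hη.smooth.continuous
  cases k with
  | zero => exact this.measurable
  | succ k => unfold chi; fun_prop

theorem enorm_chi_le (hη : IsBump η) (k : ℕ) (x : ℝ) : ‖(chi η k x : ℂ)‖ₑ ≤ 1 := by
  rw [← ofReal_norm, Complex.norm_real, Real.norm_eq_abs]
  exact ENNReal.ofReal_le_one.mpr (abs_chi_le hη k x)

theorem exists_two_pow_ge (x : ℝ) : ∃ K : ℕ, |x| ≤ 2 ^ K :=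
  (pow_unbounded_of_one_lt |x| (by norm_num)).imp fun _ h => h.le

/-- The cut-offs `χ_j`, `j ≥ J`, cover `|x| > 2^J`. -/
theorem one_le_tsum_chi_of_gt (hη : IsBump η) {J : ℕ} {x : ℝ} (h : 2 ^ J < |x|) :
    1 ≤ ∑' j, if J ≤ j then ‖(chi η j x : ℂ)‖ₑ else 0 := by
  obtain ⟨K, hK⟩ := exists_two_pow_ge x
  have h1 := sum_chi η K x
  rw [bump_div_eq_one hη hK] at h1
  calc (1 : ℝ≥0∞) = ‖(∑ k ∈ Finset.range (K + 1), (chi η k x : ℂ))‖ₑ := by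
        rw [← Complex.ofReal_sum, h1]; simp
    _ ≤ ∑ k ∈ Finset.range (K + 1), ‖(chi η k x : ℂ)‖ₑ := enorm_sum_le _ _
    _ ≤ ∑ k ∈ Finset.range (K + 1), if J ≤ k then ‖(chi η k x : ℂ)‖ₑ else 0 := by
        apply Finset.sum_le_sum
        intro k _
        split_ifs with hk
        · exact le_rfl
        · rw [chi_eq_zero_of_gt hη]; · simp
          refine lt_of_le_of_lt (pow_le_pow_right₀ (by norm_num) (by omega)) h
    _ ≤ _ := ENNReal.sum_le_tsum _

theorem one_le_tsum_chi (hη : IsBump η) (x : ℝ) : 1 ≤ ∑' j, ‖(chi η j x : ℂ)‖ₑ := by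
  obtain ⟨K, hK⟩ := exists_two_pow_ge x
  have h1 := sum_chi η K x
  rw [bump_div_eq_one hη hK] at h1
  calc (1 : ℝ≥0∞) = ‖(∑ k ∈ Finset.range (K + 1), (chi η k x : ℂ))‖ₑ := by
        rw [← Complex.ofReal_sum, h1]; simp
    _ ≤ ∑ k ∈ Finset.range (K + 1), ‖(chi η k x : ℂ)‖ₑ := enorm_sum_le _ _
    _ ≤ _ := ENNReal.sum_le_tsum _

end chi

/-! ### The `X_k` norm and the modulation weight of `N_k`. -/

section xNorm
variable {η : ℝ → ℝ} {c₁ c₂ : ℝ}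

theorem xNorm_eq (g : ℝ → ℤ → ℂ) :
    xNorm η c₁ c₂ g = ∑' j, rt ^ j * ln fun τ n => ‖(chi η j (τ - mu c₁ c₂ n) : ℂ) * g τ n‖ₑ := by
  unfold xNorm ln; simp_rw [ofReal_two_rpow_half]

theorem measurable_chi_mul (hη : IsBump η) {g : ℝ → ℤ → ℂ} (hg : ∀ n, Measurable fun τ => g τ n)
    (j : ℕ) (n : ℤ) : Measurable fun τ => ‖(chi η j (τ - mu c₁ c₂ n) : ℂ) * g τ n‖ₑ := by
  have := (measurable_chi hη j).comp (measurable_id.sub_const (mu c₁ c₂ n))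
  have h2 := (Complex.measurable_ofReal.comp this).mul (hg n)
  exact h2.enorm

/-- Above modulation `2^J` only the cut-offs with `j ≥ J` are nonzero, and their weights are at
least `2^{J/2}`. -/
theorem xNorm_high (hη : IsBump η) {g : ℝ → ℤ → ℂ} (hg : ∀ n, Measurable fun τ => g τ n) (J : ℕ) :
    ln (fun τ n => if 2 ^ J < |τ - mu c₁ c₂ n| then ‖g τ n‖ₑ else 0) ≤
      rt⁻¹ ^ J * xNorm η c₁ c₂ g := by
  have hm := measurable_chi_mul (c₁ := c₁) (c₂ := c₂) hη hg
  calc _ ≤ ln (fun τ n => ∑' j, if J ≤ j then ‖(chi η j (τ - mu c₁ c₂ n) : ℂ) * g τ n‖ₑ else 0) := by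
        apply ln_mono; intro τ n
        split_ifs with h
        · calc ‖g τ n‖ₑ = 1 * ‖g τ n‖ₑ := (one_mul _).symm
            _ ≤ _ := mul_le_mul_left (one_le_tsum_chi_of_gt hη h) _
            _ = _ := by
              rw [← ENNReal.tsum_mul_right]
              congr 1; ext j
              split_ifs <;> simp [enorm_mul]
        · exact zero_le
    _ ≤ ∑' j, ln (fun τ n => if J ≤ j then ‖(chi η j (τ - mu c₁ c₂ n) : ℂ) * g τ n‖ₑ else 0) := by
        apply ln_tsum_le
        intro j n
        split_ifs
        · exact hm j n
        · exact measurable_const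
    _ ≤ ∑' j, rt⁻¹ ^ J * (rt ^ j * ln fun τ n => ‖(chi η j (τ - mu c₁ c₂ n) : ℂ) * g τ n‖ₑ) := by
        apply ENNReal.tsum_le_tsum; intro j
        by_cases h : J ≤ j
        · simp only [h, if_true]
          have : 1 ≤ rt⁻¹ ^ J * rt ^ j := by
            obtain ⟨i, rfl⟩ := Nat.exists_eq_add_of_le h
            rw [pow_add, ← mul_assoc, mul_comm (rt⁻¹ ^ J), rt_pow_mul_inv, one_mul]
            exact one_le_pow₀ one_lt_rt.le
          rw [← mul_assoc]
          exact le_mul_of_one_le_left' this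
        · simp [h, ln]
    _ = _ := by rw [ENNReal.tsum_mul_left, xNorm_eq]

theorem nrm_indicator_modulation (a : ℝ) (j : ℕ) :
    nrm volume (fun τ : ℝ => if |τ - a| ≤ 2 ^ (j + 1) then (1 : ℝ≥0∞) else 0) = rt ^ (j + 2) := by
  have e : (fun τ : ℝ => (if |τ - a| ≤ 2 ^ (j + 1) then (1 : ℝ≥0∞) else 0) ^ 2)
      = (Icc (a - 2 ^ (j + 1)) (a + 2 ^ (j + 1))).indicator 1 := by
    ext τ
    have : |τ - a| ≤ 2 ^ (j + 1) ↔ τ ∈ Icc (a - 2 ^ (j + 1)) (a + 2 ^ (j + 1)) := by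
      rw [abs_le, mem_Icc]; constructor <;> rintro ⟨h1, h2⟩ <;> constructor <;> linarith
    by_cases h : τ ∈ Icc (a - 2 ^ (j + 1)) (a + 2 ^ (j + 1))
    · simp [this.mpr h, h]
    · simp [this, h]
  unfold nrm
  rw [e, lintegral_indicator_one measurableSet_Icc, Real.volume_Icc]
  have : a + 2 ^ (j + 1) - (a - 2 ^ (j + 1)) = (2 : ℝ) ^ (j + 2) := by ring
  rw [this, ENNReal.ofReal_pow (by norm_num), ← sq_rpow_half (rt ^ (j + 2)), ← pow_mul,
    mul_comm (j + 2) 2, rt_pow_two_mul]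
  simp

theorem measurable_indicator_modulation (a r : ℝ) :
    Measurable (fun τ : ℝ => if |τ - a| ≤ r then (1 : ℝ≥0∞) else 0) := by
  apply Measurable.ite _ measurable_const measurable_const
  exact measurableSet_le (by fun_prop) measurable_const

/-- Cauchy-Schwarz in `τ` over a shell contained in an interval of length `2^{j+2}` costs
`2·2^{j/2}`, which is twice the weight of that shell. This embedding into `ℓ²_n L¹_τ` underlies
every bound that is uniform in time. -/
theorem sn_lintegral_le_xNorm (hη : IsBump η) {g : ℝ → ℤ → ℂ}
    (hg : ∀ n, Measurable fun τ => g τ n) :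
    sn (fun n => ∫⁻ τ, ‖g τ n‖ₑ) ≤ 2 * xNorm η c₁ c₂ g := by
  have hm := measurable_chi_mul (c₁ := c₁) (c₂ := c₂) hη hg
  calc _ ≤ sn (fun n => ∑' j, ∫⁻ τ, ‖(chi η j (τ - mu c₁ c₂ n) : ℂ) * g τ n‖ₑ) := by
        apply sn_mono; intro n
        rw [← lintegral_tsum fun j => (hm j n).aemeasurable]
        apply lintegral_mono; intro τ
        dsimp only
        simp_rw [enorm_mul, ENNReal.tsum_mul_right]
        exact le_mul_of_one_le_left' (one_le_tsum_chi hη _)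
    _ ≤ ∑' j, sn (fun n => ∫⁻ τ, ‖(chi η j (τ - mu c₁ c₂ n) : ℂ) * g τ n‖ₑ) := sn_tsum_le _
    _ ≤ ∑' j, 2 * (rt ^ j * ln fun τ n => ‖(chi η j (τ - mu c₁ c₂ n) : ℂ) * g τ n‖ₑ) := by
        apply ENNReal.tsum_le_tsum; intro j
        have h1 : ∀ n, ∫⁻ τ, ‖(chi η j (τ - mu c₁ c₂ n) : ℂ) * g τ n‖ₑ ≤
            rt ^ (j + 2) * nrm volume (fun τ => ‖(chi η j (τ - mu c₁ c₂ n) : ℂ) * g τ n‖ₑ) := by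
          intro n
          rw [← nrm_indicator_modulation (mu c₁ c₂ n) j]
          refine le_trans (lintegral_mono fun τ => ?_)
            (lintegral_mul_le_nrm (measurable_indicator_modulation _ _) (hm j n))
          split_ifs with h
          · simp
          · rw [chi_eq_zero_of_gt hη (not_le.mp h)]; simp
        refine (sn_mono h1).trans ?_
        rw [sn_const_mul]
        have : sn (fun n => nrm volume (fun τ => ‖(chi η j (τ - mu c₁ c₂ n) : ℂ) * g τ n‖ₑ))
            = ln fun τ n => ‖(chi η j (τ - mu c₁ c₂ n) : ℂ) * g τ n‖ₑ := by
          unfold sn ln; simp_rw [nrm_sq]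
        rw [this, pow_add, rt_sq]
        apply le_of_eq; ring
    _ = _ := by rw [ENNReal.tsum_mul_left, xNorm_eq]

/-- The symbol `(τ - μ(n) + i 2^{2k})⁻¹` applied to `Φ`. -/
def modInv (c₁ c₂ : ℝ) (k : ℕ) (Φ : ℝ → ℤ → ℂ) (τ : ℝ) (n : ℤ) : ℂ :=
  (((τ - mu c₁ c₂ n : ℝ) : ℂ) + Complex.I * 2 ^ (2 * k))⁻¹ * Φ τ n

theorem enorm_inv_le (x : ℝ) {y r : ℝ} (hr : 0 < r) (h : r ≤ |x| ∨ r ≤ |y|) :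
    ‖((x : ℂ) + Complex.I * y)⁻¹‖ₑ ≤ ENNReal.ofReal r⁻¹ := by
  rw [← ofReal_norm, norm_inv]
  apply ENNReal.ofReal_le_ofReal
  apply inv_anti₀ hr
  rcases h with h | h
  · refine h.trans ?_
    simpa using Complex.abs_re_le_norm ((x : ℂ) + Complex.I * y)
  · refine h.trans ?_
    simpa using Complex.abs_im_le_norm ((x : ℂ) + Complex.I * y)

theorem ofReal_inv_two_pow (k : ℕ) : ENNReal.ofReal ((2 : ℝ) ^ k)⁻¹ = rt⁻¹ ^ (2 * k) := by
  rw [rt_inv_pow_two_mul, ENNReal.ofReal_inv_of_pos (by positivity),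
    ENNReal.ofReal_pow (by norm_num)]
  simp

theorem enorm_modInv_le (x : ℝ) (k : ℕ) :
    ‖((x : ℂ) + Complex.I * 2 ^ (2 * k))⁻¹‖ₑ ≤ rt⁻¹ ^ (4 * k) := by
  have := enorm_inv_le x (y := 2 ^ (2 * k)) (r := 2 ^ (2 * k)) (by positivity)
    (Or.inr (le_abs_self _))
  rw [ofReal_inv_two_pow] at this
  push_cast at this
  convert this using 2; ring

/-- On the support of `χ_j`, `j ≥ 1`, one has `|x| > 2^{j-1}`, whence the factor `2`. For `j = 0`
the imaginary part, which is at least `1`, suffices. -/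
theorem enorm_chi_mul_modInv_le (hη : IsBump η) (x : ℝ) (j k : ℕ) :
    ‖(chi η j x : ℂ)‖ₑ * ‖((x : ℂ) + Complex.I * 2 ^ (2 * k))⁻¹‖ₑ ≤ 2 * rt⁻¹ ^ (2 * j) := by
  have hr : rt⁻¹ ≤ 1 := rt_inv_lt_one.le
  rcases j with _ | j
  · calc _ ≤ 1 * rt⁻¹ ^ (4 * k) := mul_le_mul' (enorm_chi_le hη _ _) (enorm_modInv_le x k)
      _ ≤ 1 * 1 := by gcongr; exact pow_le_one₀ zero_le hr
      _ ≤ _ := by simp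
  · by_cases h : chi η (j + 1) x = 0
    · simp [h]
    have h1 := lt_abs_of_chi_ne hη h
    have := enorm_inv_le x (y := 2 ^ (2 * k)) (r := 2 ^ j) (by positivity) (Or.inl h1.le)
    push_cast at this
    calc _ ≤ 1 * ENNReal.ofReal ((2 : ℝ) ^ j)⁻¹ := mul_le_mul' (enorm_chi_le hη _ _) this
      _ = _ := by
        have e2 : rt⁻¹ ^ 2 = 2⁻¹ := by rw [← ENNReal.inv_pow, rt_sq]
        rw [ofReal_inv_two_pow, one_mul, mul_add, pow_add, mul_one, e2, mul_left_comm,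
          ENNReal.mul_inv_cancel (by norm_num) (by norm_num), mul_one]

/-- In the shell `j`, weight times symbol is at most `2^{j/2-2k}` for `j ≤ 2k` and `2·2^{-j/2}` for
`j ≥ 2k`: a two-sided geometric sequence with peak of order `2^{-k}` at `j = 2k`. -/
theorem xNorm_modInv_le (hη : IsBump η) (k : ℕ) {Φ : ℝ → ℤ → ℂ}
    (hΦ : ∀ n, Measurable fun τ => Φ τ n) :
    xNorm η c₁ c₂ (modInv c₁ c₂ k Φ) ≤ 4 * geomQ * (rt⁻¹ ^ (2 * k) * ln fun τ n => ‖Φ τ n‖ₑ) := by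
  rw [xNorm_eq]
  have key : ∀ j, rt ^ j * (ln fun τ n => ‖(chi η j (τ - mu c₁ c₂ n) : ℂ) * modInv c₁ c₂ k Φ τ n‖ₑ)
      ≤ (2 * (rt⁻¹ ^ (2 * k) * ln fun τ n => ‖Φ τ n‖ₑ)) * rt⁻¹ ^ nd j (2 * k) := by
    intro j
    obtain ⟨c, hc, hc2⟩ : ∃ c : ℝ≥0∞, (∀ x : ℝ, ‖(chi η j x : ℂ)‖ₑ *
        ‖((x : ℂ) + Complex.I * 2 ^ (2 * k))⁻¹‖ₑ ≤ c) ∧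
        rt ^ j * c ≤ 2 * rt⁻¹ ^ (2 * k) * rt⁻¹ ^ nd j (2 * k) := by
      rcases le_total j (2 * k) with h | h
      · refine ⟨rt⁻¹ ^ (4 * k), fun x => ?_, ?_⟩
        · calc _ ≤ 1 * rt⁻¹ ^ (4 * k) := mul_le_mul' (enorm_chi_le hη _ _) (enorm_modInv_le x k)
            _ = _ := one_mul _
        · have : 4 * k = j + (2 * k + nd j (2 * k)) := by unfold nd; omega
          rw [this, pow_add rt⁻¹ j, ← mul_assoc, rt_pow_mul_inv, one_mul, pow_add, mul_assoc]
          exact le_mul_of_one_le_left' (by norm_num)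
      · refine ⟨2 * rt⁻¹ ^ (2 * j), fun x => enorm_chi_mul_modInv_le hη x j k, ?_⟩
        have : 2 * j = j + (2 * k + nd j (2 * k)) := by unfold nd; omega
        rw [this, pow_add rt⁻¹ j, mul_left_comm, ← mul_assoc (rt ^ j), rt_pow_mul_inv, one_mul, pow_add, mul_assoc]
    calc _ ≤ rt ^ j * ln fun τ n => c * ‖Φ τ n‖ₑ := by
          gcongr
          apply ln_mono; intro τ n
          rw [modInv, ← mul_assoc, enorm_mul, enorm_mul]
          gcongr
          exact hc _
      _ = (rt ^ j * c) * ln fun τ n => ‖Φ τ n‖ₑ := by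
          rw [ln_const_mul _ fun n => (hΦ n).enorm, mul_assoc]
      _ ≤ (2 * rt⁻¹ ^ (2 * k) * rt⁻¹ ^ nd j (2 * k)) * ln fun τ n => ‖Φ τ n‖ₑ := by gcongr
      _ = _ := by ring
  refine (ENNReal.tsum_le_tsum key).trans ?_
  rw [ENNReal.tsum_mul_left]
  calc _ ≤ (2 * (rt⁻¹ ^ (2 * k) * ln fun τ n => ‖Φ τ n‖ₑ)) * (2 * geomQ) := by
        gcongr; exact tsum_pow_nd_le _ _
    _ = _ := by ring

theorem ln_indicator_modulation (b : ℤ → ℝ≥0∞) (j : ℕ) :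
    ln (fun τ n => b n * if |τ - mu c₁ c₂ n| ≤ 2 ^ (j + 1) then 1 else 0) = rt ^ (j + 2) * sn b := by
  rw [← sn_const_mul]
  unfold ln sn
  congr 2; ext n
  rw [← nrm_indicator_modulation (mu c₁ c₂ n) j, mul_pow, nrm_sq, mul_comm,
    ← lintegral_const_mul _ ((measurable_indicator_modulation _ _).pow_const 2)]
  simp_rw [mul_pow]

/-- The norm of `N_k` when `Φ` is small at low modulations. -/
theorem xNorm_modInv_le_of_low (hη : IsBump η) (k j₀ : ℕ) {Φ : ℝ → ℤ → ℂ}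
    (hΦ : ∀ n, Measurable fun τ => Φ τ n) (b : ℤ → ℝ≥0∞)
    (hb : ∀ τ n, |τ - mu c₁ c₂ n| ≤ 2 ^ j₀ → ‖Φ τ n‖ₑ ≤ b n) :
    xNorm η c₁ c₂ (modInv c₁ c₂ k Φ) ≤
      4 * j₀ * sn b + 4 * geomQ * (rt⁻¹ ^ j₀ * ln fun τ n => ‖Φ τ n‖ₑ) := by
  rw [xNorm_eq]
  have key : ∀ j, rt ^ j * (ln fun τ n => ‖(chi η j (τ - mu c₁ c₂ n) : ℂ) * modInv c₁ c₂ k Φ τ n‖ₑ)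
      ≤ (if j ∈ Finset.range j₀ then 4 * sn b else 0) +
        (2 * (rt⁻¹ ^ j₀ * ln fun τ n => ‖Φ τ n‖ₑ)) * rt⁻¹ ^ nd j j₀ := by
    intro j
    by_cases h : j < j₀
    · refine le_trans ?_ le_self_add
      -- For `j < j₀` the support `|τ - μ(n)| ≤ 2^{j+1}` lies in the range of `hb`. The weight
      -- `2^{j/2}`, the symbol `2·2^{-j}` and the `L²_τ` norm `2·2^{j/2}` of the shell multiply to
      -- `4`, so the number `j₀` of such shells is the only loss.
      rw [if_pos (Finset.mem_range.mpr h)]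
      calc _ ≤ rt ^ j * ln (fun τ n => (2 * rt⁻¹ ^ (2 * j) * b n) *
              if |τ - mu c₁ c₂ n| ≤ 2 ^ (j + 1) then 1 else 0) := by
            gcongr
            apply ln_mono; intro τ n
            split_ifs with h2
            · rw [modInv, ← mul_assoc, enorm_mul, enorm_mul, mul_one]
              exact mul_le_mul' (enorm_chi_mul_modInv_le hη _ j k)
                (hb τ n (h2.trans (pow_le_pow_right₀ (by norm_num) (by omega))))
            · rw [chi_eq_zero_of_gt hη (not_le.mp h2)]; simp
        _ = 2 * rt ^ j * rt⁻¹ ^ (2 * j) * rt ^ (j + 2) * sn b := by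
            rw [ln_indicator_modulation (fun n => 2 * rt⁻¹ ^ (2 * j) * b n), sn_const_mul]; ring
        _ = 4 * ((rt ^ j * rt⁻¹ ^ j) * (rt ^ j * rt⁻¹ ^ j)) * sn b := by
            rw [pow_add, rt_sq, two_mul j, pow_add]; ring
        _ = 4 * sn b := by rw [rt_pow_mul_inv]; ring
        _ ≤ _ := le_rfl
    · refine le_trans ?_ le_add_self
      push Not at h
      calc _ ≤ rt ^ j * ln fun τ n => (2 * rt⁻¹ ^ (2 * j)) * ‖Φ τ n‖ₑ := by
            gcongr
            apply ln_mono; intro τ n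
            rw [modInv, ← mul_assoc, enorm_mul, enorm_mul]
            exact mul_le_mul_left (enorm_chi_mul_modInv_le hη _ j k) _
        _ = 2 * ((rt ^ j * rt⁻¹ ^ j) * (rt⁻¹ ^ j)) * ln fun τ n => ‖Φ τ n‖ₑ := by
            rw [ln_const_mul _ fun n => (hΦ n).enorm, two_mul j, pow_add]; ring
        _ = _ := by
            have : j = j₀ + nd j j₀ := by unfold nd; omega
            rw [rt_pow_mul_inv, one_mul]
            conv_lhs => rw [this, pow_add]
            ring
  refine (ENNReal.tsum_le_tsum key).trans ?_
  rw [ENNReal.tsum_add, ENNReal.tsum_mul_left]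
  refine add_le_add ?_ ?_
  · rw [tsum_eq_sum (s := Finset.range j₀) fun j hj => if_neg hj, Finset.sum_ite_mem,
      Finset.inter_self, Finset.sum_const, Finset.card_range, nsmul_eq_mul]
    apply le_of_eq; ring
  · calc _ ≤ (2 * (rt⁻¹ ^ j₀ * ln fun τ n => ‖Φ τ n‖ₑ)) * (2 * geomQ) := by
          gcongr; exact tsum_pow_nd_le _ _
      _ = _ := by ring

end xNorm

/-! ### Fourier coefficients on the torus. -/

theorem hat_eq_inner (f : L2T) (n : ℤ) :
    hat f n = (Real.sqrt (2 * Real.pi) : ℂ) * inner ℂ (fourierLp 2 n : L2T) f := by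
  rw [hat, ← fourierBasis_repr, HilbertBasis.repr_apply_apply, coe_fourierBasis]

/-- The `n`-th Fourier coefficient as a continuous linear functional. -/
def hatL (n : ℤ) : L2T →L[ℂ] ℂ :=
  (Real.sqrt (2 * Real.pi) : ℂ) • innerSL ℂ (fourierLp 2 n : L2T)

theorem hatL_apply (n : ℤ) (f : L2T) : hatL n f = hat f n := by
  rw [hat_eq_inner]; simp [hatL]

theorem hat_sub (f g : L2T) (n : ℤ) : hat (f - g) n = hat f n - hat g n := by
  simp_rw [← hatL_apply, map_sub]

theorem hat_smul (c : ℂ) (f : L2T) (n : ℤ) : hat (c • f) n = c * hat f n := by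
  simp_rw [← hatL_apply, map_smul, smul_eq_mul]

theorem hat_zero (n : ℤ) : hat 0 n = 0 := by
  simp_rw [← hatL_apply, map_zero]

theorem hat_sum {ι : Type*} (s : Finset ι) (f : ι → L2T) (n : ℤ) :
    hat (∑ i ∈ s, f i) n = ∑ i ∈ s, hat (f i) n := by
  simp_rw [← hatL_apply, map_sum]

theorem sqrt_two_pi_ne : (Real.sqrt (2 * Real.pi) : ℂ) ≠ 0 := by
  rw [Complex.ofReal_ne_zero]; exact (Real.sqrt_pos.mpr Real.two_pi_pos).ne'

theorem hat_fourierLp (m n : ℤ) :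
    hat (fourierLp 2 m) n = if n = m then (Real.sqrt (2 * Real.pi) : ℂ) else 0 := by
  rw [hat_eq_inner]
  have := orthonormal_iff_ite.mp (orthonormal_fourier (T := 2 * Real.pi)) n m
  rw [this]; simp

theorem hat_proj {η : ℝ → ℝ} (hη : IsBump η) (k : ℕ) (a : ℤ → ℂ) (n : ℤ) :
    hat (proj η k a) n = (chi η k n : ℂ) * a n := by
  rw [proj, hat_sum]
  simp_rw [hat_smul, hat_fourierLp, mul_ite, mul_zero]
  rw [Finset.sum_ite_eq]
  split_ifs with h
  · rw [div_mul_cancel₀ _ sqrt_two_pi_ne]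
  · have : chi η k n = 0 := by
      by_contra h0
      have := abs_int_le_of_chi_ne hη h0
      rw [abs_le] at this
      exact h (Finset.mem_Icc.mpr this)
    simp [this]

theorem hat_projLE {η : ℝ → ℝ} (hη : IsBump η) (K : ℕ) (f : L2T) (n : ℤ) :
    hat (projLE η K f) n = (η ((n : ℝ) / 2 ^ K) : ℂ) * hat f n := by
  rw [projLE, hat_sum]
  simp_rw [hat_proj hη]
  rw [← Finset.sum_mul, ← Complex.ofReal_sum, sum_chi]

/-! ### Local representation of `F_k(T)` functions by exponentials. -/

/-- On `(-T,T)`, close to `t₀`, the functions `v(·,n)` are superpositions of the exponentials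
`e^{itτ}` with densities `g(τ,n)` of `X_k` norm at most `A`. -/
structure LocalRep (η : ℝ → ℝ) (c₁ c₂ : ℝ) (T : ℝ) (k : ℕ) (A : ℝ≥0∞) (v : ℝ → ℤ → ℂ) (t₀ : ℝ)
    (g : ℝ → ℤ → ℂ) : Prop where
  meas : ∀ n, Measurable fun τ => g τ n
  int : ∀ n, Integrable fun τ => g τ n
  memLp : ∀ n, MemLp (fun τ => g τ n) 2
  xNorm_le : xNorm η c₁ c₂ g ≤ A
  repr : ∀ t ∈ Ioo (-T) T, |t - t₀| ≤ (2 ^ (2 * k))⁻¹ → ∀ n,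
    v t n = (2 * Real.pi : ℂ)⁻¹ * ift (fun τ => g τ n) t

theorem spaceTimeFourier_eq_ft (f : ℝ → L2T) (τ : ℝ) (n : ℤ) :
    spaceTimeFourier f τ n = ft (fun t => hat (f t) n) τ := rfl

theorem memLp_bump_comp {η : ℝ → ℝ} (hη : IsBump η) (a t₀ : ℝ) (ha : 0 < a) (p : ℝ≥0∞) :
    MemLp (fun t => (η (a * (t - t₀)) : ℂ)) p := by
  have hc : Continuous fun t => (η (a * (t - t₀)) : ℂ) := by
    have := hη.smooth.continuous; fun_prop
  refine hc.memLp_of_hasCompactSupport ?_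
  refine HasCompactSupport.of_support_subset_isCompact
    (isCompact_Icc (a := t₀ - 2 / a) (b := t₀ + 2 / a)) fun t ht => ?_
  have h0 : η (a * (t - t₀)) ≠ 0 := fun h => ht (by simp [h])
  have := hη.support_subset h0
  rw [mem_Icc] at this ⊢
  constructor
  · rw [sub_le_iff_le_add, ← sub_le_iff_le_add', div_eq_mul_inv]
    have := mul_le_mul_of_nonneg_left this.1 (inv_pos.mpr ha).le
    rw [inv_mul_cancel_left₀ ha.ne'] at this; linarith
  · rw [← sub_le_iff_le_add', div_eq_mul_inv]
    have := mul_le_mul_of_nonneg_left this.2 (inv_pos.mpr ha).le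
    rw [inv_mul_cancel_left₀ ha.ne'] at this; linarith

theorem norm_bump_le {η : ℝ → ℝ} (hη : IsBump η) (x : ℝ) : ‖(η x : ℂ)‖ ≤ 1 := by
  rw [Complex.norm_real, Real.norm_eq_abs, abs_le]
  have := hη.mem_Icc x; constructor <;> linarith [this.1, this.2]

theorem hat_window (η : ℝ → ℝ) (k : ℕ) (t₀ : ℝ) (f : ℝ → L2T) (t : ℝ) (n : ℤ) :
    hat (window η k t₀ f t) n = (η (2 ^ (2 * k) * (t - t₀)) : ℂ) * hat (f t) n := by
  rw [window, hat_smul]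

theorem memLp_hat {f : ℝ → L2T} {p : ℝ≥0∞} (hf : MemLp f p) (n : ℤ) :
    MemLp (fun t => hat (f t) n) p := by
  have := (hatL n).comp_memLp' hf
  exact this.congr_norm (by simpa [hatL_apply, Function.comp_def] using! this.1)
    (Eventually.of_forall fun t => by simp [hatL_apply])

theorem memLp_hat_window {η : ℝ → ℝ} (hη : IsBump η) (k : ℕ) (t₀ : ℝ) {f : ℝ → L2T}
    (hf : MemLp f 2) (n : ℤ) :
    MemLp (fun t => hat (window η k t₀ f t) n) 2 ∧
      Integrable (fun t => hat (window η k t₀ f t) n) := by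
  simp_rw [hat_window]
  have hb := memLp_bump_comp hη (2 ^ (2 * k)) t₀ (by positivity)
  constructor
  · refine ((memLp_hat hf n).norm).of_le ((hb 2).1.mul (memLp_hat hf n).1)
      (Eventually.of_forall fun t => ?_)
    rw [norm_mul, norm_norm]
    exact mul_le_of_le_one_left (norm_nonneg _) (norm_bump_le hη _)
  · exact (hb 2).integrable_mul (memLp_hat hf n)

/-- The density is the space-time transform of the windowed extension. It is integrable in `τ` by
`sn_lintegral_le_xNorm`, so Fourier inversion holds at every point of continuity, that is, at
interior times. Within `2^{-2k}` of `t₀` the window equals `1` and disappears from the formula. -/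
theorem exists_localRep {η : ℝ → ℝ} (hη : IsBump η) {c₁ c₂ T : ℝ} {k : ℕ} {u F : ℝ → L2T}
    (hF : MemFk η c₁ c₂ k F) (hext : IsExtension T (fun t => proj η k (hat (u t))) F)
    (hcont : ContinuousOn (fun t => proj η k (hat (u t))) (Icc (-T) T)) (t₀ : ℝ) :
    ∃ g, LocalRep η c₁ c₂ T k (normFk η c₁ c₂ k F) (fun t n => (chi η k n : ℂ) * hat (u t) n) t₀ g := by
  set g := spaceTimeFourier (window η k t₀ F) with hg
  have hφ := memLp_hat_window hη k t₀ hF.1.1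
  have hm : ∀ n, Measurable fun τ => g τ n := fun n => (continuous_ft (hφ n).2).measurable
  have hx : xNorm η c₁ c₂ g ≤ normFk η c₁ c₂ k F :=
    le_iSup (fun t₀ => xNorm η c₁ c₂ (spaceTimeFourier (window η k t₀ F))) t₀
  have hint : ∀ n, Integrable fun τ => g τ n := fun n => by
    refine ⟨(hm n).aestronglyMeasurable, ?_⟩
    refine lt_of_le_of_lt ((le_sn (fun n => ∫⁻ τ, ‖g τ n‖ₑ) n).trans
      (sn_lintegral_le_xNorm (c₁ := c₁) (c₂ := c₂) hη hm)) ?_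
    exact ENNReal.mul_lt_top (by simp) (hx.trans_lt hF.2)
  refine ⟨g, hm, hint, fun n => ?_, hx, fun t ht htt n => ?_⟩
  · refine ⟨(hm n).aestronglyMeasurable, ?_⟩
    rw [eLpNorm_lt_top_iff_lintegral_rpow_enorm_lt_top (by norm_num) (by norm_num)]
    have h1 := lintegral_ft_sq (hφ n).2 (hφ n).1
    have h2 := (eLpNorm_lt_top_iff_lintegral_rpow_enorm_lt_top (by norm_num) (by norm_num)).mp
      (hφ n).1.2
    simp only [ENNReal.toReal_ofNat, ENNReal.rpow_ofNat] at h2 ⊢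
    simp_rw [hg, spaceTimeFourier_eq_ft]
    rw [h1]
    exact ENNReal.mul_lt_top ENNReal.ofReal_lt_top h2
  · classical
    set φ : ℝ → ℂ := fun t => hat (window η k t₀ F t) n with hφd
    -- The extension agrees with `P_k u` only almost everywhere. `ψ` is the representative that is
    -- continuous at interior times; its transform is the same.
    set ψ : ℝ → ℂ := fun t => if t ∈ Icc (-T) T then
      (η (2 ^ (2 * k) * (t - t₀)) : ℂ) * hat (proj η k (hat (u t))) n else φ t with hψd
    have hae : φ =ᵐ[volume] ψ := by
      have := (ae_restrict_iff' measurableSet_Icc).mp hext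
      filter_upwards [this] with s hs
      rw [hψd]; dsimp only
      split_ifs with h
      · rw [hφd]; dsimp only; rw [hat_window, hs h]
      · rfl
    have hft : ft ψ = ft φ := by
      ext τ; unfold ft; apply integral_congr_ae
      filter_upwards [hae] with s hs; rw [hs]
    have hψi : Integrable ψ := (hφ n).2.congr hae
    have hIcc : Icc (-T) T ∈ 𝓝 t := Icc_mem_nhds ht.1 ht.2
    have hcψ : ContinuousAt ψ t := by
      have h1 : ContinuousAt (fun t => (η (2 ^ (2 * k) * (t - t₀)) : ℂ) * hat (proj η k (hat (u t))) n) t := by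
        have a1 : ContinuousAt (fun t => (η (2 ^ (2 * k) * (t - t₀)) : ℂ)) t := by
          have := hη.smooth.continuous
          have : Continuous (fun t => (η (2 ^ (2 * k) * (t - t₀)) : ℂ)) := by fun_prop
          exact this.continuousAt
        have a2 := (hatL n).continuous.continuousAt.comp (hcont.continuousAt hIcc)
        simp only [Function.comp_def, hatL_apply] at a2
        exact a1.mul a2
      refine h1.congr ?_
      filter_upwards [hIcc] with s hs
      rw [hψd]; dsimp only; rw [if_pos hs]
    have := ift_ft hψi (by rw [hft]; exact hint n) hcψ
    rw [hft] at this
    rw [hψd] at this; dsimp only at this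
    rw [if_pos (Ioo_subset_Icc_self ht), hat_proj hη, bump_eq_one hη] at this
    · simp only [Complex.ofReal_one, one_mul] at this
      exact this
    · rw [abs_mul, abs_of_pos (by positivity)]
      calc _ ≤ (2 : ℝ) ^ (2 * k) * (2 ^ (2 * k))⁻¹ := by gcongr
        _ = 1 := mul_inv_cancel₀ (by positivity)

/-! ### Discrete convolution estimates. -/

section conv

theorem prod_erase_eq_prod_succAbove {M : Type*} [CommMonoid M] {d : ℕ} (i : Fin (d + 1))
    (f : Fin (d + 1) → M) : ∏ j ∈ Finset.univ.erase i, f j = ∏ j, f (i.succAbove j) := by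
  have : Finset.univ.erase i = Finset.univ.image i.succAbove := by
    rw [Fin.image_succAbove_univ]; ext; simp
  rw [this, Finset.prod_image]
  intro a _ b _ h
  exact Fin.succAbove_right_injective h

theorem tsum_insertNth {α : Type*} {d : ℕ} (i : Fin (d + 1)) (f : (Fin (d + 1) → α) → ℝ≥0∞) :
    ∑' m, f m = ∑' m' : Fin d → α, ∑' x : α, f (i.insertNth (α := fun _ => α) x m') := by
  rw [← (Fin.insertNthEquiv (fun _ => α) i).tsum_eq, ENNReal.tsum_prod', ENNReal.tsum_comm]
  rfl

theorem tsum_prod_eq_prod_tsum {α : Type*} {d : ℕ} (a : Fin d → α → ℝ≥0∞) :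
    ∑' m : Fin d → α, ∏ j, a j (m j) = ∏ j, ∑' x, a j x := by
  induction d with
  | zero => simp
  | succ d ih =>
    rw [tsum_insertNth 0]
    simp_rw [Fin.prod_univ_succAbove _ 0, Fin.insertNth_apply_same, Fin.insertNth_apply_succAbove,
      ENNReal.tsum_mul_right]
    rw [ENNReal.tsum_mul_left, ih fun j => a (Fin.succAbove 0 j)]

/-- The convolution of `d` nonnegative sequences on `α`. -/
def conv {d : ℕ} (a : Fin d → ℤ → ℝ≥0∞) (n : ℤ) : ℝ≥0∞ :=
  ∑' m : Fin d → ℤ, if ∑ j, m j = n then ∏ j, a j (m j) else 0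

theorem conv_succAbove {d : ℕ} (i : Fin (d + 1)) (a : Fin (d + 1) → ℤ → ℝ≥0∞) (n : ℤ) :
    conv a n = ∑' m' : Fin d → ℤ, (∏ j, a (i.succAbove j) (m' j)) * a i (n - ∑ j, m' j) := by
  rw [conv, tsum_insertNth i]
  congr 1; ext m'
  rw [tsum_eq_single (n - ∑ j, m' j)]
  · simp [Fin.sum_univ_succAbove _ i, Fin.prod_univ_succAbove _ i, mul_comm]
  · intro x hx
    rw [if_neg]
    simp only [Fin.sum_univ_succAbove _ i, Fin.insertNth_apply_same, Fin.insertNth_apply_succAbove]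
    intro h; exact hx (by linarith)

/-- Young's inequality: the convolution is a superposition of translates of `a i`, with the total
mass of the other entries as weight. -/
theorem sn_conv_le {d : ℕ} (i : Fin (d + 1)) (a : Fin (d + 1) → ℤ → ℝ≥0∞) :
    sn (conv a) ≤ sn (a i) * ∏ j ∈ Finset.univ.erase i, ∑' x, a j x := by
  have e : conv a = fun n => ∑' m' : Fin d → ℤ,
      (∏ j, a (i.succAbove j) (m' j)) * a i (n - ∑ j, m' j) := funext (conv_succAbove i a)
  rw [e]
  refine (sn_tsum_le _).trans (le_of_eq ?_)
  have h : ∀ m' : Fin d → ℤ, sn (fun n => (∏ j, a (i.succAbove j) (m' j)) * a i (n - ∑ j, m' j))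
      = (∏ j, a (i.succAbove j) (m' j)) * sn (a i) := fun m' => by
    rw [sn_const_mul, ← sn_comp_equiv (Equiv.subRight (∑ j, m' j)) (a i)]
    rfl
  simp_rw [h]
  rw [ENNReal.tsum_mul_right, tsum_prod_eq_prod_tsum fun j => a (i.succAbove j),
    prod_erase_eq_prod_succAbove, mul_comm]

/-- Cauchy-Schwarz pairs the entries `i` and `l`; only the remaining ones are measured in `ℓ¹`. The
price is that the bound is pointwise in `n`. -/
theorem conv_le {d : ℕ} (i l : Fin (d + 2)) (hil : l ≠ i) (a : Fin (d + 2) → ℤ → ℝ≥0∞) (n : ℤ) :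
    conv a n ≤ sn (a i) * sn (a l) * ∏ j ∈ (Finset.univ.erase i).erase l, ∑' x, a j x := by
  obtain ⟨l', rfl⟩ := Fin.exists_succAbove_eq hil
  have hprod : ∏ j ∈ (Finset.univ.erase i).erase (i.succAbove l'), ∑' x, a j x =
      ∏ j, ∑' x, a (i.succAbove (l'.succAbove j)) x := by
    rw [← prod_erase_eq_prod_succAbove l' (fun j => ∑' x, a (i.succAbove j) x)]
    have : (Finset.univ.erase i).erase (i.succAbove l') =
        (Finset.univ.erase l').image i.succAbove := by
      rw [Finset.image_erase Fin.succAbove_right_injective, Fin.image_succAbove_univ]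
      congr 1; ext; simp
    rw [this, Finset.prod_image]
    intro a _ b _ h
    exact Fin.succAbove_right_injective h
  rw [conv_succAbove i, tsum_insertNth l', hprod,
    ← tsum_prod_eq_prod_tsum fun j => a (i.succAbove (l'.succAbove j)), ← ENNReal.tsum_mul_left]
  apply ENNReal.tsum_le_tsum; intro m
  simp only [Fin.prod_univ_succAbove _ l', Fin.sum_univ_succAbove _ l', Fin.insertNth_apply_same,
    Fin.insertNth_apply_succAbove]
  calc _ = ∑' x, (∏ j, a (i.succAbove (l'.succAbove j)) (m j)) *
        (a (i.succAbove l') x * a i (n - ∑ j, m j - x)) := by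
        congr 1; ext x; rw [← sub_sub, sub_right_comm]; ring
    _ = (∏ j, a (i.succAbove (l'.succAbove j)) (m j)) *
        ∑' x, (a (i.succAbove l') x * a i (n - ∑ j, m j - x)) := ENNReal.tsum_mul_left
    _ ≤ (∏ j, a (i.succAbove (l'.succAbove j)) (m j)) * (sn (a (i.succAbove l')) * sn (a i)) := by
        gcongr
        refine (tsum_mul_le_sn _ _).trans ?_
        rw [← sn_comp_equiv (Equiv.subLeft (n - ∑ j, m j)) (a i)]
        rfl
    _ = _ := by ring

/-- Cauchy-Schwarz on `2·2^{k+1} + 1 ≤ 2^{k+3}` points. -/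
theorem tsum_le_of_support {a : ℤ → ℝ≥0∞} {k : ℕ} (h : ∀ m, a m ≠ 0 → |m| ≤ 2 ^ (k + 1)) :
    ∑' m, a m ≤ rt ^ (k + 3) * sn a := by
  set s := Finset.Icc (-(2 ^ (k + 1)) : ℤ) (2 ^ (k + 1)) with hs
  have hcard : (s.card : ℝ≥0∞) ≤ (rt ^ (k + 3)) ^ 2 := by
    rw [← pow_mul, mul_comm, rt_pow_two_mul]
    have : s.card ≤ 2 ^ (k + 3) := by
      rw [hs, Int.card_Icc]
      have : (0 : ℤ) < 2 ^ (k + 1) := by positivity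
      have e : (2 : ℤ) ^ (k + 3) = 4 * 2 ^ (k + 1) := by ring
      have : (2 ^ (k + 1) + 1 - -2 ^ (k + 1) : ℤ) ≤ ((2 ^ (k + 3) : ℕ) : ℤ) := by
        push_cast; rw [e]; linarith
      omega
    exact_mod_cast this
  calc ∑' m, a m = ∑' m, (if m ∈ s then 1 else 0) * a m := by
        congr 1; ext m
        split_ifs with hm
        · simp
        · by_contra h0
          have := h m (by simpa using h0)
          rw [abs_le] at this
          exact hm (Finset.mem_Icc.mpr this)
    _ ≤ sn (fun m => if m ∈ s then (1 : ℝ≥0∞) else 0) * sn a := tsum_mul_le_sn _ _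
    _ ≤ _ := by
        gcongr
        rw [sn_le_iff]
        refine le_trans (le_of_eq ?_) hcard
        rw [tsum_eq_sum (s := s)]
        · rw [Finset.sum_congr rfl (g := fun _ => 1)]
          · simp
          · intro m hm; simp [hm]
        · intro m hm; simp [hm]

theorem sn_conv_le_of_support {d : ℕ} (i : Fin (d + 1)) (a : Fin (d + 1) → ℤ → ℝ≥0∞)
    (kk : Fin (d + 1) → ℕ) (h : ∀ j m, a j m ≠ 0 → |m| ≤ 2 ^ (kk j + 1)) :
    sn (conv a) ≤ (∏ j ∈ Finset.univ.erase i, rt ^ (kk j + 3)) * ∏ j, sn (a j) := by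
  refine (sn_conv_le i a).trans ?_
  rw [← Finset.mul_prod_erase Finset.univ (fun j => sn (a j)) (Finset.mem_univ i), mul_left_comm]
  gcongr
  rw [← Finset.prod_mul_distrib]
  exact Finset.prod_le_prod' fun j _ => tsum_le_of_support (h j)

theorem conv_le_of_support {d : ℕ} (i l : Fin (d + 2)) (hil : l ≠ i)
    (a : Fin (d + 2) → ℤ → ℝ≥0∞)
    (kk : Fin (d + 2) → ℕ) (h : ∀ j m, a j m ≠ 0 → |m| ≤ 2 ^ (kk j + 1)) (n : ℤ) :
    conv a n ≤ (∏ j ∈ (Finset.univ.erase i).erase l, rt ^ (kk j + 3)) * ∏ j, sn (a j) := by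
  refine (conv_le i l hil a n).trans ?_
  rw [← Finset.mul_prod_erase Finset.univ (fun j => sn (a j)) (Finset.mem_univ i),
    ← Finset.mul_prod_erase (Finset.univ.erase i) (fun j => sn (a j))
      (Finset.mem_erase.mpr ⟨hil, Finset.mem_univ l⟩)]
  calc _ ≤ sn (a i) * sn (a l) * ∏ j ∈ (Finset.univ.erase i).erase l, rt ^ (kk j + 3) * sn (a j) := by
        gcongr with j
        exact tsum_le_of_support (h j)
    _ = _ := by rw [Finset.prod_mul_distrib]; ring

theorem sn_indicator_conv_le_of_support {d : ℕ} (i l : Fin (d + 2)) (hil : l ≠ i)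
    (a : Fin (d + 2) → ℤ → ℝ≥0∞)
    (kk : Fin (d + 2) → ℕ) (h : ∀ j m, a j m ≠ 0 → |m| ≤ 2 ^ (kk j + 1)) (k : ℕ) :
    sn (fun n => if |n| ≤ 2 ^ (k + 1) then conv a n else 0) ≤
      rt ^ (k + 3) * (∏ j ∈ (Finset.univ.erase i).erase l, rt ^ (kk j + 3)) * ∏ j, sn (a j) := by
  set B := (∏ j ∈ (Finset.univ.erase i).erase l, rt ^ (kk j + 3)) * ∏ j, sn (a j)
  rw [mul_assoc, mul_comm (rt ^ _)]
  set χ : ℤ → ℝ≥0∞ := fun n => if |n| ≤ 2 ^ (k + 1) then 1 else 0 with hχ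
  -- Since `χ² = χ`, the squared norm equals the sum of `χ`, to which the count in
  -- `tsum_le_of_support` applies; dividing by the norm gives `h2`.
  have h1 : sn χ ^ 2 ≤ rt ^ (k + 3) * sn χ := by
    rw [sn_sq]
    have : ∀ n, χ n ^ 2 = χ n := fun n => by rw [hχ]; dsimp only; split_ifs <;> simp
    simp_rw [this]
    apply tsum_le_of_support
    intro m hm; by_contra h0; exact hm (if_neg h0)
  have hfin : sn χ ≠ ⊤ := by
    have : ∑' n, χ n ^ 2 ≠ ⊤ := by
      rw [tsum_eq_sum (s := Finset.Icc (-(2 ^ (k + 1)) : ℤ) (2 ^ (k + 1)))]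
      · rw [ENNReal.sum_ne_top]; intro n _; rw [hχ]; dsimp only; split_ifs <;> simp
      · intro n hn
        rw [hχ]; dsimp only; rw [if_neg]; · simp
        rwa [Finset.mem_Icc, ← abs_le] at hn
    exact ENNReal.rpow_ne_top_of_nonneg (by norm_num) this
  have h2 : sn χ ≤ rt ^ (k + 3) := by
    rcases eq_or_ne (sn χ) 0 with h0 | h0
    · rw [h0]; exact zero_le
    · rw [sq] at h1; exact (ENNReal.mul_le_mul_iff_left h0 hfin).mp h1
  calc _ ≤ sn (fun n => B * χ n) := by
        apply sn_mono; intro n; rw [hχ]; dsimp only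
        split_ifs
        · rw [mul_one]; exact conv_le_of_support i l hil a kk h n
        · simp
    _ = B * sn χ := sn_const_mul _ _
    _ ≤ _ := by gcongr

end conv

/-! ### Mixed norms, and sums of functions in the weighted space. -/

theorem ln_eq_nrm_sn {F : ℝ → ℤ → ℝ≥0∞} (hF : ∀ n, Measurable fun t => F t n) :
    ln F = nrm volume (fun t => sn (F t)) := by
  unfold ln nrm
  simp_rw [sn_sq]
  rw [lintegral_tsum fun n => ((hF n).pow_const 2).aemeasurable]

theorem ln_le_of_sn_le {F : ℝ → ℤ → ℝ≥0∞} (hF : ∀ n, Measurable fun t => F t n) {s : Set ℝ}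
    (hs : MeasurableSet s) {B : ℝ≥0∞} (h1 : ∀ t ∈ s, sn (F t) ≤ B) (h2 : ∀ t ∉ s, ∀ n, F t n = 0) :
    ln F ≤ volume s ^ (1 / 2 : ℝ) * B := by
  rw [ln_eq_nrm_sn hF, nrm_le_iff, mul_pow, rpow_half_sq]
  calc _ ≤ ∫⁻ t, s.indicator (fun _ => B ^ 2) t := by
        apply lintegral_mono; intro t
        by_cases ht : t ∈ s
        · rw [indicator_of_mem ht]; dsimp only; gcongr; exact h1 t ht
        · rw [indicator_of_notMem ht]; simp [sn, h2 t ht]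
    _ = _ := by rw [lintegral_indicator_const hs, mul_comm]

theorem two_pi_le_sq : ENNReal.ofReal (2 * Real.pi) ≤ 3 ^ 2 := by
  rw [show (3 : ℝ≥0∞) ^ 2 = ENNReal.ofReal 9 by norm_num]
  apply ENNReal.ofReal_le_ofReal; linarith [Real.pi_le_four]

theorem enorm_two_pi_inv_le : ‖(2 * Real.pi : ℂ)⁻¹‖ₑ ≤ 1 := by
  rw [← ofReal_norm, norm_inv]
  apply ENNReal.ofReal_le_one.mpr
  apply inv_le_one_of_one_le₀
  rw [show (2 * Real.pi : ℂ) = ((2 * Real.pi : ℝ) : ℂ) by push_cast; rfl, Complex.norm_real,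
    Real.norm_eq_abs, abs_of_pos Real.two_pi_pos]
  linarith [Real.pi_gt_three]

theorem ln_ft_le {f : ℝ → ℤ → ℂ} (h1 : ∀ n, Integrable fun t => f t n)
    (h2 : ∀ n, MemLp (fun t => f t n) 2) :
    (ln fun τ n => ‖ft (fun t => f t n) τ‖ₑ) ≤ 3 * ln fun t n => ‖f t n‖ₑ := by
  rw [ln_le_iff, mul_pow, ln_sq]
  simp_rw [lintegral_ft_sq (h1 _) (h2 _)]
  rw [ENNReal.tsum_mul_left]
  gcongr; exact two_pi_le_sq

theorem ln_ift_le {g : ℝ → ℤ → ℂ} (h1 : ∀ n, Integrable fun t => g t n)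
    (h2 : ∀ n, MemLp (fun t => g t n) 2) :
    (ln fun τ n => ‖ift (fun t => g t n) τ‖ₑ) ≤ 3 * ln fun t n => ‖g t n‖ₑ := by
  rw [ln_le_iff, mul_pow, ln_sq]
  simp_rw [lintegral_ift_sq (h1 _) (h2 _)]
  rw [ENNReal.tsum_mul_left]
  gcongr; exact two_pi_le_sq

theorem xNorm_le_tsum {η : ℝ → ℝ} (hη : IsBump η) {c₁ c₂ : ℝ} {ι : Type*} [Countable ι]
    {g : ℝ → ℤ → ℂ} {G : ι → ℝ → ℤ → ℂ} (hG : ∀ i n, Measurable fun τ => G i τ n)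
    (h : ∀ τ n, ‖g τ n‖ₑ ≤ ∑' i, ‖G i τ n‖ₑ) :
    xNorm η c₁ c₂ g ≤ ∑' i, xNorm η c₁ c₂ (G i) := by
  simp_rw [xNorm_eq]
  rw [ENNReal.tsum_comm]
  apply ENNReal.tsum_le_tsum; intro j
  rw [ENNReal.tsum_mul_left]
  gcongr
  refine le_trans (ln_mono fun τ n => ?_) (ln_tsum_le fun i n => measurable_chi_mul hη (hG i) j n)
  simp_rw [enorm_mul, ENNReal.tsum_mul_left]
  gcongr
  exact h τ n

theorem measurable_modInv {c₁ c₂ : ℝ} {k : ℕ} {Φ : ℝ → ℤ → ℂ}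
    (hΦ : ∀ n, Measurable fun τ => Φ τ n) (n : ℤ) :
    Measurable fun τ => modInv c₁ c₂ k Φ τ n := by
  unfold modInv
  exact (by fun_prop : Measurable fun τ : ℝ =>
    (((τ - mu c₁ c₂ n : ℝ) : ℂ) + Complex.I * 2 ^ (2 * k))⁻¹).mul (hΦ n)

theorem xNorm_modInv_le_tsum {η : ℝ → ℝ} (hη : IsBump η) {c₁ c₂ : ℝ} {k : ℕ} {ι : Type*}
    [Countable ι] {g : ℝ → ℤ → ℂ} {G : ι → ℝ → ℤ → ℂ} (hG : ∀ i n, Measurable fun τ => G i τ n)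
    (h : ∀ τ n, ‖g τ n‖ₑ ≤ ∑' i, ‖G i τ n‖ₑ) :
    xNorm η c₁ c₂ (modInv c₁ c₂ k g) ≤ ∑' i, xNorm η c₁ c₂ (modInv c₁ c₂ k (G i)) := by
  apply xNorm_le_tsum hη fun i n => measurable_modInv (hG i) n
  intro τ n
  simp_rw [modInv, enorm_mul, ENNReal.tsum_mul_left]
  gcongr
  exact h τ n

theorem xNorm_modInv_add_le {η : ℝ → ℝ} (hη : IsBump η) {c₁ c₂ : ℝ} {k : ℕ}
    {g G₁ G₂ : ℝ → ℤ → ℂ} (h₁ : ∀ n, Measurable fun τ => G₁ τ n)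
    (h₂ : ∀ n, Measurable fun τ => G₂ τ n) (h : ∀ τ n, g τ n = G₁ τ n + G₂ τ n) :
    xNorm η c₁ c₂ (modInv c₁ c₂ k g) ≤
      xNorm η c₁ c₂ (modInv c₁ c₂ k G₁) + xNorm η c₁ c₂ (modInv c₁ c₂ k G₂) := by
  have := xNorm_modInv_le_tsum hη (c₁ := c₁) (c₂ := c₂) (k := k) (g := g) (G := ![G₁, G₂])
    (by intro i n; fin_cases i; exacts [h₁ n, h₂ n])
    (by intro τ n; rw [tsum_fintype, h]; simpa using enorm_add_le _ _)
  simpa [tsum_fintype] using this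

/-- Near every time, `v` has a local representation of size `A`. -/
def HasRep (η : ℝ → ℝ) (c₁ c₂ : ℝ) (T : ℝ) (k : ℕ) (A : ℝ≥0∞) (v : ℝ → ℤ → ℂ) : Prop :=
  ∀ t₀, ∃ g, LocalRep η c₁ c₂ T k A v t₀ g

section rep
variable {η : ℝ → ℝ} {c₁ c₂ T : ℝ} {k : ℕ} {A : ℝ≥0∞} {v : ℝ → ℤ → ℂ}

theorem LocalRep.sn_le (hη : IsBump η) {t₀ : ℝ} {g : ℝ → ℤ → ℂ}
    (h : LocalRep η c₁ c₂ T k A v t₀ g) : sn (fun n => ∫⁻ τ, ‖g τ n‖ₑ) ≤ 2 * A :=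
  (sn_lintegral_le_xNorm hη h.meas).trans (by gcongr; exact h.xNorm_le)

theorem LocalRep.enorm_le {t₀ : ℝ} {g : ℝ → ℤ → ℂ} (h : LocalRep η c₁ c₂ T k A v t₀ g) {t : ℝ}
    (ht : t ∈ Ioo (-T) T) (ht' : |t - t₀| ≤ (2 ^ (2 * k))⁻¹) (n : ℤ) :
    ‖v t n‖ₑ ≤ ∫⁻ τ, ‖g τ n‖ₑ := by
  rw [h.repr t ht ht' n, enorm_mul]
  calc _ ≤ 1 * ∫⁻ τ, ‖g τ n‖ₑ := mul_le_mul' enorm_two_pi_inv_le (enorm_ift_le _ _)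
    _ = _ := one_mul _

/-- The window is centred at the time `t` itself, so no time is out of reach; this is the embedding
of `F_k(T)` into functions bounded in time with values in `L²(𝕋)`. -/
theorem HasRep.sn_le (hη : IsBump η) (h : HasRep η c₁ c₂ T k A v) {t : ℝ}
    (ht : t ∈ Ioo (-T) T) : sn (fun n => ‖v t n‖ₑ) ≤ 2 * A := by
  obtain ⟨g, hg⟩ := h t
  exact (sn_mono fun n => hg.enorm_le ht (by simp) n).trans (hg.sn_le hη)

theorem HasRep.continuousOn (h : HasRep η c₁ c₂ T k A v) (n : ℤ) :
    ContinuousOn (fun t => v t n) (Ioo (-T) T) := by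
  intro t ht
  obtain ⟨g, hg⟩ := h t
  apply ContinuousAt.continuousWithinAt
  have h1 : ContinuousAt (fun t => (2 * Real.pi : ℂ)⁻¹ * ift (fun τ => g τ n) t) t :=
    ((continuous_ift (hg.int n)).const_smul ((2 * Real.pi : ℂ)⁻¹)).continuousAt
  refine h1.congr ?_
  filter_upwards [Ioo_mem_nhds ht.1 ht.2,
    Metric.closedBall_mem_nhds t (by positivity : (0 : ℝ) < (2 ^ (2 * k))⁻¹)] with s hs hs2
  exact (hg.repr s hs (by simpa [Real.dist_eq] using hs2) n).symm

end rep

/-! ### Dyadic blocks, estimated without modulations. -/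

/-- The frequencies of a dyadic block. -/
def box {d : ℕ} (kk : Fin d → ℕ) : Finset (Fin d → ℤ) :=
  Fintype.piFinset fun j => Finset.Icc (-(2 ^ (kk j + 1)) : ℤ) (2 ^ (kk j + 1))

theorem mem_box {d : ℕ} {kk : Fin d → ℕ} {m : Fin d → ℤ} :
    m ∈ box kk ↔ ∀ j, |m j| ≤ 2 ^ (kk j + 1) := by
  simp [box, Fintype.mem_piFinset, abs_le]

/-- A multilinear operator with coefficients `b`, on frequencies in a dyadic block. -/
def blk {d : ℕ} (b : ℤ → (Fin d → ℤ) → ℂ) (kk : Fin d → ℕ) (v : Fin d → ℤ → ℂ) (n : ℤ) : ℂ :=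
  ∑ m ∈ box kk, b n m * ∏ j, v j (m j)

/-- The bound `S` for the multilinear operator with coefficients `|b|` on `ℓ²`. -/
def SpatialBound {d : ℕ} (b : ℤ → (Fin d → ℤ) → ℂ) (kk : Fin d → ℕ) (S : ℝ≥0∞) : Prop :=
  ∀ a : Fin d → ℤ → ℝ≥0∞,
    sn (fun n => ∑ m ∈ box kk, ‖b n m‖ₑ * ∏ j, a j (m j)) ≤ S * ∏ j, sn (a j)

theorem enorm_finset_prod {ι : Type*} (s : Finset ι) (f : ι → ℂ) :
    ‖∏ i ∈ s, f i‖ₑ = ∏ i ∈ s, ‖f i‖ₑ := by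
  classical
  induction s using Finset.induction_on with
  | empty => simp
  | insert a s ha ih => rw [Finset.prod_insert ha, Finset.prod_insert ha, enorm_mul, ih]

theorem enorm_blk_le {d : ℕ} (b : ℤ → (Fin d → ℤ) → ℂ) (kk : Fin d → ℕ) (v : Fin d → ℤ → ℂ)
    (n : ℤ) : ‖blk b kk v n‖ₑ ≤ ∑ m ∈ box kk, ‖b n m‖ₑ * ∏ j, ‖v j (m j)‖ₑ := by
  refine (enorm_sum_le _ _).trans (le_of_eq ?_)
  simp_rw [enorm_mul, enorm_finset_prod]

theorem sum_box_le_conv {d : ℕ} {b : ℤ → (Fin d → ℤ) → ℂ} {kk : Fin d → ℕ} {B : ℝ≥0∞}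
    {n : ℤ} (hb : ∀ m ∈ box kk, ‖b n m‖ₑ ≤ B) (hs : ∀ m ∈ box kk, b n m ≠ 0 → ∑ j, m j = n)
    (a : Fin d → ℤ → ℝ≥0∞) :
    ∑ m ∈ box kk, ‖b n m‖ₑ * ∏ j, a j (m j) ≤
      B * conv (fun j m => if |m| ≤ 2 ^ (kk j + 1) then a j m else 0) n := by
  rw [conv, ← ENNReal.tsum_mul_left]
  refine le_trans (Finset.sum_le_sum fun m hm => ?_) (ENNReal.sum_le_tsum (box kk))
  by_cases h : b n m = 0
  · simp [h]
  · rw [if_pos (hs m hm h)]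
    apply mul_le_mul' (hb m hm)
    apply Finset.prod_le_prod'
    intro j _
    rw [if_pos (mem_box.mp hm j)]

theorem sn_cut_le (a : ℤ → ℝ≥0∞) (r : ℤ) : sn (fun m => if |m| ≤ r then a m else 0) ≤ sn a := by
  apply sn_mono; intro m; split_ifs <;> simp

/-- Entry `i` stays in `ℓ²`; every other entry passes to `ℓ¹` at the cost of the square root of the
size of its frequency support. -/
theorem spatialBound_young {d : ℕ} (i : Fin (d + 1)) {b : ℤ → (Fin (d + 1) → ℤ) → ℂ}
    {kk : Fin (d + 1) → ℕ} {B : ℝ≥0∞}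
    (hb : ∀ n, ∀ m ∈ box kk, ‖b n m‖ₑ ≤ B) (hs : ∀ n, ∀ m ∈ box kk, b n m ≠ 0 → ∑ j, m j = n) :
    SpatialBound b kk (B * ∏ j ∈ Finset.univ.erase i, rt ^ (kk j + 3)) := by
  intro a
  calc _ ≤ sn (fun n => B * conv (fun j m => if |m| ≤ 2 ^ (kk j + 1) then a j m else 0) n) :=
        sn_mono fun n => sum_box_le_conv (hb n) (hs n) a
    _ = B * sn (conv (fun j m => if |m| ≤ 2 ^ (kk j + 1) then a j m else 0)) := sn_const_mul _ _
    _ ≤ B * ((∏ j ∈ Finset.univ.erase i, rt ^ (kk j + 3)) *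
          ∏ j, sn (fun m => if |m| ≤ 2 ^ (kk j + 1) then a j m else 0)) := by
        gcongr
        apply sn_conv_le_of_support
        intro j m h; by_contra h0; exact h (if_neg h0)
    _ ≤ _ := by
        rw [mul_assoc]; gcongr with j
        exact sn_cut_le _ _

/-- The entries `i` and `l` stay in `ℓ²` and the square root is paid for the output frequency
instead of for `l`. This is the better choice when the output frequency is much smaller than that of
`l`. -/
theorem spatialBound_dual {d : ℕ} (i l : Fin (d + 2)) (hil : l ≠ i)
    {b : ℤ → (Fin (d + 2) → ℤ) → ℂ} {kk : Fin (d + 2) → ℕ} {B : ℝ≥0∞} (k : ℕ)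
    (hb : ∀ n, ∀ m ∈ box kk, ‖b n m‖ₑ ≤ B) (hs : ∀ n, ∀ m ∈ box kk, b n m ≠ 0 → ∑ j, m j = n)
    (hk : ∀ n, ∀ m ∈ box kk, b n m ≠ 0 → |n| ≤ 2 ^ (k + 1)) :
    SpatialBound b kk (B * (rt ^ (k + 3) * ∏ j ∈ (Finset.univ.erase i).erase l, rt ^ (kk j + 3))) := by
  intro a
  calc _ ≤ sn (fun n => B * if |n| ≤ 2 ^ (k + 1) then
            conv (fun j m => if |m| ≤ 2 ^ (kk j + 1) then a j m else 0) n else 0) := by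
        apply sn_mono; intro n
        split_ifs with h
        · exact sum_box_le_conv (hb n) (hs n) a
        · rw [mul_zero, nonpos_iff_eq_zero]
          apply Finset.sum_eq_zero
          intro m hm
          have : b n m = 0 := by by_contra h0; exact h (hk n m hm h0)
          simp [this]
    _ = B * sn (fun n => if |n| ≤ 2 ^ (k + 1) then
            conv (fun j m => if |m| ≤ 2 ^ (kk j + 1) then a j m else 0) n else 0) :=
        sn_const_mul _ _
    _ ≤ B * (rt ^ (k + 3) * (∏ j ∈ (Finset.univ.erase i).erase l, rt ^ (kk j + 3)) *
          ∏ j, sn (fun m => if |m| ≤ 2 ^ (kk j + 1) then a j m else 0)) := by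
        gcongr
        apply sn_indicator_conv_le_of_support i l hil
        intro j m h; by_contra h0; exact h (if_neg h0)
    _ ≤ _ := by
        rw [mul_assoc B]; gcongr with j
        exact sn_cut_le _ _

theorem SpatialBound.sn_blk_le {d : ℕ} {b : ℤ → (Fin d → ℤ) → ℂ} {kk : Fin d → ℕ} {S : ℝ≥0∞}
    (h : SpatialBound b kk S) (v : Fin d → ℤ → ℂ) :
    sn (fun n => ‖blk b kk v n‖ₑ) ≤ S * ∏ j, sn (fun m => ‖v j m‖ₑ) :=
  (sn_mono fun n => enorm_blk_le b kk v n).trans (h fun j m => ‖v j m‖ₑ)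

/-- A bounded function on a bounded measurable set, extended by zero. -/
theorem memLp_of_bound_on {f : ℝ → ℂ} (hf : Measurable f) {s : Set ℝ}
    (hs : MeasurableSet s) (hv : volume s ≠ ⊤) {B : ℝ≥0∞} (hB : B ≠ ⊤) (h1 : ∀ t, ‖f t‖ₑ ≤ B)
    (h2 : ∀ t ∉ s, f t = 0) (p : ℝ≥0∞) : MemLp f p := by
  have hc : MemLp (s.indicator fun _ => B.toReal) p := memLp_indicator_const p hs _ (Or.inr hv)
  refine MemLp.of_le hc hf.aestronglyMeasurable (Eventually.of_forall fun t => ?_)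
  by_cases ht : t ∈ s
  · have e1 : ‖f t‖ ≤ B.toReal := by
      have h3 := ENNReal.toReal_mono hB (h1 t)
      rwa [toReal_enorm] at h3
    have e2 : s.indicator (fun _ => B.toReal) t = B.toReal := indicator_of_mem ht _
    rw [e2]
    exact e1.trans (le_abs_self _)
  · have e1 : ‖f t‖ = 0 := by rw [h2 t ht, norm_zero]
    rw [e1]; exact norm_nonneg _

theorem measurable_indicator_of_continuousOn {f : ℝ → ℂ} {s : Set ℝ} (hs : MeasurableSet s)
    (hf : ContinuousOn f s) : Measurable (s.indicator f) := by
  classical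
  have := hf.measurable_piecewise (g := fun _ => (0 : ℂ)) continuousOn_const hs
  rwa [show s.piecewise f (fun _ => 0) = s.indicator f from piecewise_eq_indicator] at this

/-- The time-localized block `1_{(-T,T)}(t) η(2^{2k}(t - t₀)) b(v(t))`. -/
def blkT {d : ℕ} (η : ℝ → ℝ) (T : ℝ) (k : ℕ) (t₀ : ℝ) (b : ℤ → (Fin d → ℤ) → ℂ) (kk : Fin d → ℕ)
    (v : Fin d → ℝ → ℤ → ℂ) (t : ℝ) (n : ℤ) : ℂ :=
  (Ioo (-T) T).indicator
    (fun t => (η (2 ^ (2 * k) * (t - t₀)) : ℂ) * blk b kk (fun j => v j t) n) t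

theorem sq_ofReal_rpow_half {x : ℝ} (hx : 0 ≤ x) :
    ENNReal.ofReal (x ^ 2) ^ (1 / 2 : ℝ) = ENNReal.ofReal x := by
  rw [ENNReal.ofReal_pow hx, sq_rpow_half]

theorem abs_le_of_bump_ne {η : ℝ → ℝ} (hη : IsBump η) {w x : ℝ} (hw : 0 < w)
    (h : η (w * x) ≠ 0) : |x| ≤ 2 * w⁻¹ := by
  by_contra! h'
  apply h
  apply bump_eq_zero hη
  rw [abs_mul, abs_of_pos hw]
  calc (2 : ℝ) = w * (2 * w⁻¹) := by field_simp
    _ < _ := by gcongr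

theorem volume_window (t₀ : ℝ) (k : ℕ) :
    volume (Icc (t₀ - 2 * (2 ^ (2 * k))⁻¹) (t₀ + 2 * (2 ^ (2 * k))⁻¹)) ^ (1 / 2 : ℝ) =
      2 * rt⁻¹ ^ (2 * k) := by
  rw [Real.volume_Icc]
  have : t₀ + 2 * (2 ^ (2 * k))⁻¹ - (t₀ - 2 * (2 ^ (2 * k))⁻¹) = (2 * ((2 : ℝ) ^ k)⁻¹) ^ 2 := by
    rw [mul_pow, inv_pow, ← pow_mul, mul_comm k 2]; ring
  rw [this, sq_ofReal_rpow_half (by positivity), ENNReal.ofReal_mul (by norm_num),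
    ofReal_inv_two_pow]
  norm_num

section blkT
variable {η : ℝ → ℝ} {c₁ c₂ T : ℝ} {k : ℕ} {t₀ : ℝ} {d : ℕ} {b : ℤ → (Fin d → ℤ) → ℂ}
  {kk : Fin d → ℕ} {v : Fin d → ℝ → ℤ → ℂ} {A : Fin d → ℝ≥0∞} {S : ℝ≥0∞}

theorem blkT_eq_zero (hη : IsBump η) {t : ℝ}
    (ht : t ∉ Icc (t₀ - 2 * (2 ^ (2 * k))⁻¹) (t₀ + 2 * (2 ^ (2 * k))⁻¹)) (n : ℤ) :
    blkT η T k t₀ b kk v t n = 0 := by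
  unfold blkT
  by_cases h : t ∈ Ioo (-T) T
  · rw [indicator_of_mem h]
    have : η (2 ^ (2 * k) * (t - t₀)) = 0 := by
      by_contra h0
      have := abs_le_of_bump_ne hη (by positivity) h0
      rw [abs_le] at this
      exact ht ⟨by linarith [this.1], by linarith [this.2]⟩
    simp [this]
  · rw [indicator_of_notMem h]

theorem sn_blkT_le (hη : IsBump η) (hv : ∀ j, HasRep η c₁ c₂ T (kk j) (A j) (v j))
    (hS : SpatialBound b kk S) (t : ℝ) :
    sn (fun n => ‖blkT η T k t₀ b kk v t n‖ₑ) ≤ S * ∏ j, (2 * A j) := by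
  by_cases h : t ∈ Ioo (-T) T
  · calc _ ≤ sn (fun n => ‖blk b kk (fun j => v j t) n‖ₑ) := by
          apply sn_mono; intro n
          rw [blkT, indicator_of_mem h, enorm_mul]
          refine mul_le_of_le_one_left' ?_
          rw [← ofReal_norm]; exact ENNReal.ofReal_le_one.mpr (norm_bump_le hη _)
      _ ≤ _ := (hS.sn_blk_le _)
      _ ≤ _ := by
          gcongr with j
          exact (hv j).sn_le hη h
  · refine le_trans (le_of_eq ?_) zero_le
    simp [blkT, indicator_of_notMem h, sn]

theorem measurable_blkT (hη : IsBump η) (hv : ∀ j, HasRep η c₁ c₂ T (kk j) (A j) (v j)) (n : ℤ) :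
    Measurable fun t => blkT η T k t₀ b kk v t n := by
  unfold blkT
  apply measurable_indicator_of_continuousOn measurableSet_Ioo
  have h1 : Continuous fun t => (η (2 ^ (2 * k) * (t - t₀)) : ℂ) := by
    have := hη.smooth.continuous; fun_prop
  refine h1.continuousOn.mul ?_
  unfold blk
  refine continuousOn_finsetSum _ fun m _ => continuousOn_const.mul ?_
  exact continuousOn_finsetProd _ fun j _ => (hv j).continuousOn (m j)

theorem memLp_blkT (hη : IsBump η) (hv : ∀ j, HasRep η c₁ c₂ T (kk j) (A j) (v j))
    (hA : ∀ j, A j ≠ ⊤) (hS : SpatialBound b kk S) (hS' : S ≠ ⊤) (n : ℤ) (p : ℝ≥0∞) :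
    MemLp (fun t => blkT η T k t₀ b kk v t n) p := by
  refine memLp_of_bound_on (measurable_blkT hη hv n) measurableSet_Icc
    (measure_Icc_lt_top (a := t₀ - 2 * (2 ^ (2 * k))⁻¹) (b := t₀ + 2 * (2 ^ (2 * k))⁻¹)).ne
    (B := S * ∏ j, (2 * A j)) ?_ (fun t => ?_) (fun t ht => blkT_eq_zero hη ht n) p
  · exact ENNReal.mul_ne_top hS' (ENNReal.prod_ne_top fun j _ => ENNReal.mul_ne_top (by simp) (hA j))
  · exact (le_sn (fun n => ‖blkT η T k t₀ b kk v t n‖ₑ) n).trans (sn_blkT_le hη hv hS t)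

theorem xNorm_modInv_ft_le (hη : IsBump η) {f : ℝ → ℤ → ℂ}
    (hf : ∀ n p, MemLp (fun t => f t n) p) :
    xNorm η c₁ c₂ (modInv c₁ c₂ k fun τ n => ft (fun t => f t n) τ) ≤
      12 * geomQ * rt⁻¹ ^ (2 * k) * ln fun t n => ‖f t n‖ₑ := by
  have h1 : ∀ n, Integrable fun t => f t n := fun n => memLp_one_iff_integrable.mp (hf n 1)
  refine (xNorm_modInv_le hη k fun n => (continuous_ft (h1 n)).measurable).trans ?_
  calc _ ≤ 4 * geomQ * (rt⁻¹ ^ (2 * k) * (3 * ln fun t n => ‖f t n‖ₑ)) := by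
        gcongr; exact ln_ft_le h1 fun n => hf n 2
    _ = _ := by ring

/-- The estimate of a block in `N_k` that ignores the modulations. -/
theorem xNorm_blkT_le (hη : IsBump η) (hv : ∀ j, HasRep η c₁ c₂ T (kk j) (A j) (v j))
    (hA : ∀ j, A j ≠ ⊤) (hS : SpatialBound b kk S) (hS' : S ≠ ⊤) :
    xNorm η c₁ c₂ (modInv c₁ c₂ k fun τ n => ft (fun t => blkT η T k t₀ b kk v t n) τ) ≤
      24 * geomQ * 2 ^ d * (rt⁻¹ ^ (4 * k) * S * ∏ j, A j) := by
  refine (xNorm_modInv_ft_le hη fun n p => memLp_blkT hη hv hA hS hS' n p).trans ?_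
  -- One factor `2^{-k}` comes from the symbol, the other from the square root of the window length
  -- `4·2^{-2k}`.
  calc _ ≤ 12 * geomQ * rt⁻¹ ^ (2 * k) * (2 * rt⁻¹ ^ (2 * k) * (S * ∏ j, (2 * A j))) := by
        gcongr
        rw [← volume_window t₀ k]
        refine ln_le_of_sn_le (fun n => (measurable_blkT hη hv n).enorm) measurableSet_Icc
          (fun t _ => sn_blkT_le hη hv hS t) (fun t ht n => ?_)
        rw [blkT_eq_zero hη ht]; simp
    _ = _ := by
        rw [Finset.prod_mul_distrib]
        have : 4 * k = 2 * k + 2 * k := by ring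
        rw [this, pow_add]
        simp; ring

end blkT

/-! ### Oscillatory integrals and the splitting by modulation. -/

theorem ft_eq_ift (f : ℝ → ℂ) (τ : ℝ) : ft f τ = ift f (-τ) := by
  rw [ift_eq_ft, neg_neg]

/-- Multiplication by a superposition of exponentials preserves bounds of the transform. -/
theorem enorm_ift_mul_ift_le {ψ g : ℝ → ℂ} (hψ : Integrable ψ) (hg : Integrable g) {B : ℝ≥0∞}
    (θ : ℝ) (hB : ∀ τ, g τ ≠ 0 → ‖ift ψ (θ + τ)‖ₑ ≤ B) :
    ‖ift (fun t => ψ t * ift g t) θ‖ₑ ≤ B * ∫⁻ τ, ‖g τ‖ₑ := by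
  -- By Fubini the transform of the product is a superposition of translates of the transform of
  -- `ψ`, and only shifts by points where `g` is nonzero occur.
  have e : ift (fun t => ψ t * ift g t) θ = ∫ τ, g τ * ift ψ (θ + τ) := by
    calc _ = ∫ t : ℝ, ∫ τ : ℝ, (Complex.exp (Complex.I * (θ : ℂ) * (t : ℂ)) * ψ t) *
          (Complex.exp (Complex.I * (t : ℂ) * (τ : ℂ)) * g τ) := by
          unfold ift
          congr 1; ext t
          rw [← mul_assoc, ← integral_const_mul]
      _ = ∫ τ : ℝ, ∫ t : ℝ, (Complex.exp (Complex.I * (θ : ℂ) * (t : ℂ)) * ψ t) *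
          (Complex.exp (Complex.I * (t : ℂ) * (τ : ℂ)) * g τ) := by
          apply integral_integral_swap
          have h1 : Integrable (fun p : ℝ × ℝ => ψ p.1 * g p.2) (volume.prod volume) :=
            hψ.mul_prod hg
          have h2 : Continuous fun p : ℝ × ℝ => Complex.exp (Complex.I * (θ : ℂ) * (p.1 : ℂ)) *
              Complex.exp (Complex.I * (p.1 : ℂ) * (p.2 : ℂ)) := by fun_prop
          have h3 := h1.bdd_mul (c := 1) h2.aestronglyMeasurable
            (Eventually.of_forall fun p => by
              rw [norm_mul, norm_exp_I_mul, norm_exp_I_mul]; norm_num)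
          refine h3.congr (Eventually.of_forall fun p => ?_)
          simp only [Function.uncurry]; ring
      _ = _ := by
          congr 1; ext τ
          unfold ift
          rw [← integral_const_mul]
          congr 1; ext t
          rw [show Complex.I * ((θ + τ : ℝ) : ℂ) * (t : ℂ) = Complex.I * (θ : ℂ) * (t : ℂ) +
            Complex.I * (t : ℂ) * (τ : ℂ) by push_cast; ring, Complex.exp_add]
          ring
  rw [e, ← lintegral_const_mul'' _ hg.aestronglyMeasurable.enorm]
  refine (enorm_integral_le_lintegral_enorm _).trans (lintegral_mono fun τ => ?_)
  rw [enorm_mul, mul_comm]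
  by_cases h : g τ = 0
  · simp [h]
  · gcongr; exact hB τ h

/-- The oscillatory integrals over the windows decay like the inverse of the frequency. -/
theorem exists_oscillation_bound {η : ℝ → ℝ} (hη : IsBump η) : ∃ C : ℝ≥0∞, C ≠ ⊤ ∧
    ∀ (w t₀ T α β θ r : ℝ), 0 < w → 0 < r → r ≤ |θ| →
      ‖ift ((Ioo (-T) T ∩ Ioc α β).indicator fun t => (η (w * (t - t₀)) : ℂ)) θ‖ₑ ≤
        C * ENNReal.ofReal r⁻¹ := by
  have hd : Continuous (deriv η) := hη.smooth.continuous_deriv (by norm_num)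
  have hsupp : HasCompactSupport η := HasCompactSupport.of_support_subset_isCompact
    isCompact_Icc hη.support_subset
  have hdi : Integrable (deriv η) := hd.integrable_of_hasCompactSupport hsupp.deriv
  -- One integration by parts: `2` accounts for the two boundary terms, and the total variation of
  -- the window is at most `∫ |η'|` whatever the scale `w`. The sharp end points allow no better
  -- decay than `1/|θ|`.
  refine ⟨ENNReal.ofReal (2 + ∫ x, ‖deriv η x‖), ENNReal.ofReal_ne_top, ?_⟩
  intro w t₀ T α β θ r hw hr hrθ
  have hθ : θ ≠ 0 := fun h => by rw [h, abs_zero] at hrθ; linarith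
  rw [← ENNReal.ofReal_mul (by positivity), ← ofReal_norm]
  apply ENNReal.ofReal_le_ofReal
  -- Up to a null set the piece is a single, possibly empty, interval `(p, q]`.
  have hset : (Ioo (-T) T ∩ Ioc α β : Set ℝ) =ᵐ[volume] Ioc (max (-T) α) (min T β) := by
    rw [← Ioc_inter_Ioc]; exact Ioo_ae_eq_Ioc.inter (ae_eq_refl _)
  set p := max (-T) α
  set q := min T β
  have e1 : ift ((Ioo (-T) T ∩ Ioc α β).indicator fun t => (η (w * (t - t₀)) : ℂ)) θ =
      ∫ t in Ioc p q, Complex.exp (Complex.I * (θ : ℂ) * (t : ℂ)) * (η (w * (t - t₀)) : ℂ) := by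
    rw [← setIntegral_congr_set hset, ← integral_indicator (measurableSet_Ioo.inter measurableSet_Ioc)]
    unfold ift
    congr 1; ext t
    simp only [indicator]
    split_ifs <;> simp
  rw [e1]
  rcases lt_or_ge q p with hpq | hpq
  · rw [Ioc_eq_empty (not_lt.mpr hpq.le)]; simp; positivity
  rw [← intervalIntegral.integral_of_le hpq]
  have hIθ : Complex.I * (θ : ℂ) ≠ 0 := mul_ne_zero Complex.I_ne_zero (Complex.ofReal_ne_zero.mpr hθ)
  have hu : ∀ t, HasDerivAt (fun t : ℝ => (η (w * (t - t₀)) : ℂ))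
      ((w * deriv η (w * (t - t₀)) : ℝ) : ℂ) t := by
    intro t
    have h0 : HasDerivAt η (deriv η (w * (t - t₀))) (w * (t - t₀)) :=
      ((hη.smooth.differentiable (by norm_num)) _).hasDerivAt
    have h1 : HasDerivAt (fun t : ℝ => w * (t - t₀)) w t := by
      simpa using ((hasDerivAt_id t).sub_const t₀).const_mul w
    have h2 := h0.comp t h1
    rw [mul_comm] at h2
    exact h2.ofReal_comp
  have hv : ∀ t : ℝ, HasDerivAt (fun t : ℝ => Complex.exp (Complex.I * (θ : ℂ) * (t : ℂ)) /
      (Complex.I * θ)) (Complex.exp (Complex.I * (θ : ℂ) * (t : ℂ))) t := by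
    intro t
    have h1 : HasDerivAt (fun t : ℝ => Complex.I * (θ : ℂ) * (t : ℂ)) (Complex.I * θ) t := by
      simpa using (Complex.ofRealCLM.hasDerivAt (x := t)).const_mul (Complex.I * (θ : ℂ))
    have h2 := (h1.cexp).div_const (Complex.I * (θ : ℂ))
    rwa [mul_div_assoc, div_self hIθ, mul_one] at h2
  have hcd : Continuous fun t : ℝ => ((w * deriv η (w * (t - t₀)) : ℝ) : ℂ) := by fun_prop
  have ibp := intervalIntegral.integral_mul_deriv_eq_deriv_mul (a := p) (b := q)
    (fun t _ => hu t) (fun t _ => hv t)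
    (hcd.intervalIntegrable _ _) ((by fun_prop : Continuous fun t : ℝ =>
      Complex.exp (Complex.I * (θ : ℂ) * (t : ℂ))).intervalIntegrable _ _)
  simp_rw [mul_comm (Complex.exp (Complex.I * (θ : ℂ) * (_ : ℂ)))]
  rw [ibp]
  have hb : ∀ t : ℝ, ‖Complex.exp (Complex.I * (θ : ℂ) * (t : ℂ)) / (Complex.I * θ)‖ = |θ|⁻¹ := by
    intro t; rw [norm_div, norm_exp_I_mul]; simp
  have hle : |θ|⁻¹ ≤ r⁻¹ := inv_anti₀ hr hrθ
  have hb1 : ∀ t : ℝ, ‖(η (w * (t - t₀)) : ℂ) * (Complex.exp (Complex.I * (θ : ℂ) * (t : ℂ)) /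
      (Complex.I * θ))‖ ≤ |θ|⁻¹ := by
    intro t; rw [norm_mul, hb]
    exact mul_le_of_le_one_left (by positivity) (norm_bump_le hη _)
  have hint : ‖∫ t in p..q, ((w * deriv η (w * (t - t₀)) : ℝ) : ℂ) *
      (Complex.exp (Complex.I * (θ : ℂ) * (t : ℂ)) / (Complex.I * θ))‖ ≤
      |θ|⁻¹ * ∫ x, ‖deriv η x‖ := by
    have hI : Integrable fun t => w * ‖deriv η (w * (t - t₀))‖ :=
      (((hdi.norm).comp_mul_left' hw.ne').comp_sub_right t₀).const_mul w
    calc _ ≤ ∫ t in p..q, |θ|⁻¹ * (w * ‖deriv η (w * (t - t₀))‖) := by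
          apply intervalIntegral.norm_integral_le_of_norm_le hpq
          · refine Eventually.of_forall fun t _ => ?_
            rw [norm_mul, hb, Complex.norm_real, norm_mul, Real.norm_of_nonneg hw.le, mul_comm]
          · exact (hI.const_mul _).intervalIntegrable
      _ ≤ ∫ t, |θ|⁻¹ * (w * ‖deriv η (w * (t - t₀))‖) := by
          rw [intervalIntegral.integral_of_le hpq]
          exact setIntegral_le_integral (hI.const_mul _)
            (Eventually.of_forall fun t => by dsimp only; positivity)
      _ = _ := by
          rw [integral_const_mul, integral_const_mul,
            integral_sub_right_eq_self (fun t => ‖deriv η (w * t)‖) t₀,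
            Measure.integral_comp_mul_left (fun t => ‖deriv η t‖), abs_of_pos (inv_pos.mpr hw),
            smul_eq_mul, mul_inv_cancel_left₀ hw.ne']
  have hpos : 0 ≤ ∫ x, ‖deriv η x‖ := integral_nonneg fun _ => norm_nonneg _
  calc _ ≤ |θ|⁻¹ + |θ|⁻¹ + |θ|⁻¹ * ∫ x, ‖deriv η x‖ :=
        (norm_sub_le _ _).trans (add_le_add ((norm_sub_le _ _).trans (add_le_add (hb1 _) (hb1 _))) hint)
    _ = (2 + ∫ x, ‖deriv η x‖) * |θ|⁻¹ := by ring
    _ ≤ _ := by gcongr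

/-- The frequencies of modulation larger than `2^J`. -/
def highSet (c₁ c₂ : ℝ) (J : ℕ) (n : ℤ) : Set ℝ := {τ | 2 ^ J < |τ - mu c₁ c₂ n|}

theorem measurableSet_highSet (c₁ c₂ : ℝ) (J : ℕ) (n : ℤ) : MeasurableSet (highSet c₁ c₂ J n) :=
  measurableSet_lt measurable_const (by fun_prop)

/-- The part of modulation larger than `2^J` of the function with density `g`. -/
def highF (c₁ c₂ : ℝ) (J : ℕ) (g : ℝ → ℤ → ℂ) (t : ℝ) (n : ℤ) : ℂ :=
  (2 * Real.pi : ℂ)⁻¹ * ift ((highSet c₁ c₂ J n).indicator fun τ => g τ n) t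

/-- The part of modulation at most `2^J` of the function with density `g`. -/
def lowF (c₁ c₂ : ℝ) (J : ℕ) (g : ℝ → ℤ → ℂ) (t : ℝ) (n : ℤ) : ℂ :=
  (2 * Real.pi : ℂ)⁻¹ * ift ((highSet c₁ c₂ J n)ᶜ.indicator fun τ => g τ n) t

theorem integrable_exp_mul {g : ℝ → ℂ} (hg : Integrable g) (t : ℝ) :
    Integrable fun τ : ℝ => Complex.exp (Complex.I * (t : ℂ) * (τ : ℂ)) * g τ := by
  have h2 : Continuous fun τ : ℝ => Complex.exp (Complex.I * (t : ℂ) * (τ : ℂ)) := by fun_prop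
  exact hg.bdd_mul (c := 1) h2.aestronglyMeasurable
    (Eventually.of_forall fun p => by rw [norm_exp_I_mul])

theorem ift_add {f g : ℝ → ℂ} (hf : Integrable f) (hg : Integrable g) (t : ℝ) :
    ift (fun τ => f τ + g τ) t = ift f t + ift g t := by
  unfold ift
  rw [← integral_add (integrable_exp_mul hf t) (integrable_exp_mul hg t)]
  congr 1; ext τ; ring

section pieces
variable {η : ℝ → ℝ} {c₁ c₂ T : ℝ} {k : ℕ} {A : ℝ≥0∞} {v : ℝ → ℤ → ℂ} {t₀ : ℝ}
  {g : ℝ → ℤ → ℂ}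

theorem LocalRep.low_add_high (h : LocalRep η c₁ c₂ T k A v t₀ g) (J : ℕ) {t : ℝ}
    (ht : t ∈ Ioo (-T) T) (ht' : |t - t₀| ≤ (2 ^ (2 * k))⁻¹) (n : ℤ) :
    v t n - lowF c₁ c₂ J g t n = highF c₁ c₂ J g t n := by
  have hm := measurableSet_highSet c₁ c₂ J n
  rw [h.repr t ht ht' n, sub_eq_iff_eq_add, lowF, highF, ← mul_add,
    ← ift_add ((h.int n).indicator hm) ((h.int n).indicator hm.compl)]
  congr 2; ext τ
  exact (congrFun (indicator_self_add_compl (highSet c₁ c₂ J n) fun τ => g τ n) τ).symm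

theorem enorm_lowF_le (c₁ c₂ : ℝ) (J : ℕ) (g : ℝ → ℤ → ℂ) (t : ℝ) (n : ℤ) :
    ‖lowF c₁ c₂ J g t n‖ₑ ≤ ∫⁻ τ, ‖g τ n‖ₑ := by
  rw [lowF, enorm_mul]
  refine (mul_le_of_le_one_left' enorm_two_pi_inv_le).trans ((enorm_ift_le _ _).trans ?_)
  exact lintegral_mono fun τ => enorm_indicator_le_enorm_self _ _

theorem LocalRep.continuous_lowF (h : LocalRep η c₁ c₂ T k A v t₀ g) (J : ℕ) (n : ℤ) :
    Continuous fun t => lowF c₁ c₂ J g t n :=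
  (continuous_ift ((h.int n).indicator (measurableSet_highSet c₁ c₂ J n).compl)).const_smul
    ((2 * Real.pi : ℂ)⁻¹)

theorem LocalRep.continuous_highF (h : LocalRep η c₁ c₂ T k A v t₀ g) (J : ℕ) (n : ℤ) :
    Continuous fun t => highF c₁ c₂ J g t n :=
  (continuous_ift ((h.int n).indicator (measurableSet_highSet c₁ c₂ J n))).const_smul
    ((2 * Real.pi : ℂ)⁻¹)

/-- Plancherel in time followed by `xNorm_high`; the factor `3` bounds `√(2π)`. -/
theorem LocalRep.ln_highF_le (hη : IsBump η) (h : LocalRep η c₁ c₂ T k A v t₀ g) (J : ℕ) :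
    (ln fun t n => ‖highF c₁ c₂ J g t n‖ₑ) ≤ 3 * (rt⁻¹ ^ J * A) := by
  have hm := measurableSet_highSet c₁ c₂ J
  calc _ ≤ ln fun t n => ‖ift ((highSet c₁ c₂ J n).indicator fun τ => g τ n) t‖ₑ := by
        apply ln_mono; intro t n
        rw [highF, enorm_mul]; exact mul_le_of_le_one_left' enorm_two_pi_inv_le
    _ ≤ 3 * ln fun τ n => ‖(highSet c₁ c₂ J n).indicator (fun τ => g τ n) τ‖ₑ :=
        ln_ift_le (g := fun τ n => (highSet c₁ c₂ J n).indicator (fun τ => g τ n) τ)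
          (fun n => (h.int n).indicator (hm n)) fun n => (h.memLp n).indicator (hm n)
    _ ≤ _ := by
        gcongr
        refine le_trans (ln_mono fun τ n => ?_) ((xNorm_high hη h.meas J).trans
          (mul_le_mul_right h.xNorm_le _))
        by_cases hτ : τ ∈ highSet c₁ c₂ J n
        · rw [indicator_of_mem hτ, if_pos (show 2 ^ J < |τ - mu c₁ c₂ n| from hτ)]
        · rw [indicator_of_notMem hτ, enorm_zero]; exact zero_le

end pieces

/-- Telescoping: each term contains exactly one difference `x i - y i`. -/
theorem enorm_prod_three_sub_le (x y : Fin 3 → ℂ) (G H : Fin 3 → ℝ≥0∞) (hx : ∀ j, ‖x j‖ₑ ≤ G j)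
    (hy : ∀ j, ‖y j‖ₑ ≤ G j) (hxy : ∀ j, ‖x j - y j‖ₑ ≤ H j) :
    ‖∏ j, x j - ∏ j, y j‖ₑ ≤ ∑ i, ∏ j, Function.update G i (H i) j := by
  simp only [Fin.prod_univ_three, Fin.sum_univ_three]
  have e : x 0 * x 1 * x 2 - y 0 * y 1 * y 2 = (x 0 - y 0) * x 1 * x 2 + y 0 * (x 1 - y 1) * x 2
      + y 0 * y 1 * (x 2 - y 2) := by ring
  rw [e]
  refine (enorm_add_le _ _).trans (add_le_add ((enorm_add_le _ _).trans (add_le_add ?_ ?_)) ?_)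
  all_goals
    rw [enorm_mul, enorm_mul]
    simp only [Function.update_self, Function.update_of_ne, ne_eq, Fin.reduceEq, not_false_eq_true,
      one_ne_zero, zero_ne_one]
    gcongr
    all_goals first | exact hx _ | exact hy _ | exact hxy _

/-- A subinterval of a window. -/
def piece (T α β : ℝ) : Set ℝ := Ioo (-T) T ∩ Ioc α β

theorem measurableSet_piece (T α β : ℝ) : MeasurableSet (piece T α β) :=
  measurableSet_Ioo.inter measurableSet_Ioc

section piece
variable {η : ℝ → ℝ} {c₁ c₂ T : ℝ} {k : ℕ} {t₀ α β : ℝ} {b : ℤ → (Fin 3 → ℤ) → ℂ}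
  {kk : Fin 3 → ℕ} {v : Fin 3 → ℝ → ℤ → ℂ} {A : Fin 3 → ℝ≥0∞} {S : ℝ≥0∞} {J K : ℕ}
  {g : Fin 3 → ℝ → ℤ → ℂ}

/-- The part of low modulation of a block on a piece of the window. -/
def lowPiece (η : ℝ → ℝ) (c₁ c₂ T : ℝ) (k : ℕ) (t₀ α β : ℝ) (b : ℤ → (Fin 3 → ℤ) → ℂ)
    (kk : Fin 3 → ℕ) (J : ℕ) (g : Fin 3 → ℝ → ℤ → ℂ) (t : ℝ) (n : ℤ) : ℂ :=
  (piece T α β).indicator (fun t => (η (2 ^ (2 * k) * (t - t₀)) : ℂ) *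
    blk b kk (fun j => lowF c₁ c₂ J (g j) t) n) t

/-- The remaining part of a block on a piece of the window. -/
def highPiece (η : ℝ → ℝ) (c₁ c₂ T : ℝ) (k : ℕ) (t₀ α β : ℝ) (b : ℤ → (Fin 3 → ℤ) → ℂ)
    (kk : Fin 3 → ℕ) (J : ℕ) (v : Fin 3 → ℝ → ℤ → ℂ) (g : Fin 3 → ℝ → ℤ → ℂ) (t : ℝ) (n : ℤ) : ℂ :=
  (piece T α β).indicator (fun t => (η (2 ^ (2 * k) * (t - t₀)) : ℂ) *
    (blk b kk (fun j => v j t) n - blk b kk (fun j => lowF c₁ c₂ J (g j) t) n)) t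

theorem enorm_bump_le (hη : IsBump η) (x : ℝ) : ‖(η x : ℂ)‖ₑ ≤ 1 := by
  rw [← ofReal_norm]; exact ENNReal.ofReal_le_one.mpr (norm_bump_le hη _)

theorem sn_lowPiece_le (hη : IsBump η) (hg : ∀ j, LocalRep η c₁ c₂ T (kk j) (A j) (v j) β (g j))
    (hS : SpatialBound b kk S) (t : ℝ) :
    sn (fun n => ‖lowPiece η c₁ c₂ T k t₀ α β b kk J g t n‖ₑ) ≤ S * ∏ j, (2 * A j) := by
  calc _ ≤ sn (fun n => ‖blk b kk (fun j => lowF c₁ c₂ J (g j) t) n‖ₑ) := by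
        apply sn_mono; intro n
        refine (enorm_indicator_le_enorm_self _ _).trans ?_
        rw [enorm_mul]
        exact mul_le_of_le_one_left' (enorm_bump_le hη _)
    _ ≤ _ := hS.sn_blk_le _
    _ ≤ _ := by
        gcongr with j
        exact (sn_mono fun n => enorm_lowF_le _ _ _ _ _ _).trans ((hg j).sn_le hη)

theorem measurable_lowPiece (hη : IsBump η)
    (hg : ∀ j, LocalRep η c₁ c₂ T (kk j) (A j) (v j) β (g j)) (n : ℤ) :
    Measurable fun t => lowPiece η c₁ c₂ T k t₀ α β b kk J g t n := by
  unfold lowPiece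
  apply measurable_indicator_of_continuousOn (measurableSet_piece _ _ _)
  have h1 : Continuous fun t => (η (2 ^ (2 * k) * (t - t₀)) : ℂ) := by
    have := hη.smooth.continuous; fun_prop
  refine (h1.mul ?_).continuousOn
  unfold blk
  refine continuous_finsetSum _ fun m _ => continuous_const.mul ?_
  exact continuous_finsetProd _ fun j _ => (hg j).continuous_lowF J (m j)

theorem measurable_highPiece (hη : IsBump η) (hv : ∀ j, HasRep η c₁ c₂ T (kk j) (A j) (v j))
    (hg : ∀ j, LocalRep η c₁ c₂ T (kk j) (A j) (v j) β (g j)) (n : ℤ) :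
    Measurable fun t => highPiece η c₁ c₂ T k t₀ α β b kk J v g t n := by
  unfold highPiece
  apply measurable_indicator_of_continuousOn (measurableSet_piece _ _ _)
  have h1 : Continuous fun t => (η (2 ^ (2 * k) * (t - t₀)) : ℂ) := by
    have := hη.smooth.continuous; fun_prop
  refine h1.continuousOn.mul (ContinuousOn.sub ?_ (Continuous.continuousOn ?_))
  · unfold blk
    refine continuousOn_finsetSum _ fun m _ => continuousOn_const.mul ?_
    exact continuousOn_finsetProd _ fun j _ =>
      ((hv j).continuousOn (m j)).mono inter_subset_left
  · unfold blk
    refine continuous_finsetSum _ fun m _ => continuous_const.mul ?_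
    exact continuous_finsetProd _ fun j _ => (hg j).continuous_lowF J (m j)

theorem volume_piece_le (hαβ : β - α ≤ (2 ^ (2 * K))⁻¹) :
    volume (piece T α β) ^ (1 / 2 : ℝ) ≤ rt⁻¹ ^ (2 * K) := by
  rw [rpow_half_le_iff]
  calc _ ≤ volume (Ioc α β) := measure_mono inter_subset_right
    _ ≤ ENNReal.ofReal (2 ^ (2 * K))⁻¹ := by
        rw [Real.volume_Ioc]; exact ENNReal.ofReal_le_ofReal hαβ
    _ = _ := by rw [ofReal_inv_two_pow, ← pow_mul]; congr 1; ring

theorem ln_lowPiece_le (hη : IsBump η) (hg : ∀ j, LocalRep η c₁ c₂ T (kk j) (A j) (v j) β (g j))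
    (hS : SpatialBound b kk S) (hαβ : β - α ≤ (2 ^ (2 * K))⁻¹) :
    (ln fun t n => ‖lowPiece η c₁ c₂ T k t₀ α β b kk J g t n‖ₑ) ≤
      rt⁻¹ ^ (2 * K) * (S * ∏ j, (2 * A j)) := by
  refine (ln_le_of_sn_le (fun n => (measurable_lowPiece hη hg n).enorm) (measurableSet_piece T α β)
    (fun t _ => sn_lowPiece_le hη hg hS t) fun t ht n => ?_).trans ?_
  · rw [lowPiece, indicator_of_notMem ht, enorm_zero]
  · gcongr; exact volume_piece_le hαβ

theorem prod_update_sn (a : Fin 3 → ℤ → ℝ≥0∞) (i : Fin 3) (h : ℤ → ℝ≥0∞) :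
    ∏ j, sn (Function.update a i h j) = (∏ j ∈ Finset.univ.erase i, sn (a j)) * sn h := by
  rw [← Finset.mul_prod_erase Finset.univ _ (Finset.mem_univ i), Function.update_self, mul_comm]
  congr 1
  apply Finset.prod_congr rfl
  intro j hj
  rw [Function.update_of_ne (Finset.ne_of_mem_erase hj)]

/-- The difference of the two products telescopes. In each term one factor has modulation above
`2^J` and is measured in `L²_t`, with gain `2^{-J/2}`; the two others are bounded uniformly in time
by the integrals of their densities. The constant is three terms times `3·2·2`. -/
theorem ln_highPiece_le (hη : IsBump η)
    (hg : ∀ j, LocalRep η c₁ c₂ T (kk j) (A j) (v j) β (g j))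
    (hS : SpatialBound b kk S) (hαβ : ∀ j, β - α ≤ (2 ^ (2 * kk j))⁻¹) :
    (ln fun t n => ‖highPiece η c₁ c₂ T k t₀ α β b kk J v g t n‖ₑ) ≤
      36 * (rt⁻¹ ^ J * S * ∏ j, A j) := by
  set G : Fin 3 → ℤ → ℝ≥0∞ := fun j x => ∫⁻ τ, ‖g j τ x‖ₑ with hG
  set F : Fin 3 → ℝ → ℤ → ℝ≥0∞ := fun i t n => ∑ m ∈ box kk, ‖b n m‖ₑ *
    ∏ j, Function.update G i (fun x => ‖highF c₁ c₂ J (g i) t x‖ₑ) j (m j) with hF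
  have hFm : ∀ i n, Measurable fun t => F i t n := by
    intro i n
    refine Finset.measurable_sum _ fun m _ => measurable_const.mul ?_
    refine Finset.measurable_prod _ fun j _ => ?_
    by_cases hj : j = i
    · subst hj; simp only [Function.update_self]
      exact ((hg j).continuous_highF J (m j)).measurable.enorm
    · simp only [Function.update_of_ne hj]; exact measurable_const
  have h1 : ∀ t n, ‖highPiece η c₁ c₂ T k t₀ α β b kk J v g t n‖ₑ ≤ ∑' i, F i t n := by
    intro t n
    by_cases ht : t ∈ piece T α β
    · rw [highPiece, indicator_of_mem ht, enorm_mul, tsum_fintype]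
      refine (mul_le_of_le_one_left' (enorm_bump_le hη _)).trans ?_
      rw [blk, blk, ← Finset.sum_sub_distrib, hF, Finset.sum_comm]
      refine (enorm_sum_le _ _).trans (Finset.sum_le_sum fun m _ => ?_)
      rw [← mul_sub, enorm_mul, ← Finset.mul_sum]
      gcongr
      -- The representations are centred at the right end point `β`, so they hold on the whole piece
      -- once it is no longer than `2^{-2 kk j}` for every `j`.
      have hta : ∀ j, |t - β| ≤ (2 ^ (2 * kk j))⁻¹ := fun j => by
        refine le_trans ?_ (hαβ j)
        rw [abs_le]; constructor <;> linarith [ht.2.1, ht.2.2]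
      refine (enorm_prod_three_sub_le _ _ (fun j => G j (m j))
        (fun i => ‖highF c₁ c₂ J (g i) t (m i)‖ₑ)
        (fun j => (hg j).enorm_le ht.1 (hta j) _) (fun j => enorm_lowF_le _ _ _ _ _ _)
        (fun j => by rw [(hg j).low_add_high J ht.1 (hta j)])).trans (le_of_eq ?_)
      refine Finset.sum_congr rfl fun i _ => Finset.prod_congr rfl fun j _ => ?_
      by_cases hj : j = i
      · subst hj; simp
      · simp [Function.update_of_ne hj]
    · rw [highPiece, indicator_of_notMem ht, enorm_zero]; exact zero_le
  have h2 : ∀ i, ln (F i) ≤ 12 * (rt⁻¹ ^ J * S * ∏ j, A j) := by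
    intro i
    have hmeas : ∀ n, Measurable fun t => ‖highF c₁ c₂ J (g i) t n‖ₑ :=
      fun n => ((hg i).continuous_highF J n).measurable.enorm
    have hsm : Measurable fun t => sn fun n => ‖highF c₁ c₂ J (g i) t n‖ₑ := by
      unfold sn
      exact (Measurable.tsum fun n => (hmeas n).pow_const 2).pow_const _
    calc ln (F i) = nrm volume fun t => sn (F i t) := ln_eq_nrm_sn (hFm i)
      _ ≤ nrm volume fun t => (S * ∏ j ∈ Finset.univ.erase i, (2 * A j)) *
            sn fun n => ‖highF c₁ c₂ J (g i) t n‖ₑ := by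
          apply nrm_mono; intro t
          refine (hS (Function.update G i fun x => ‖highF c₁ c₂ J (g i) t x‖ₑ)).trans ?_
          rw [prod_update_sn, mul_assoc]
          gcongr with j
          exact (hg j).sn_le hη
      _ = (S * ∏ j ∈ Finset.univ.erase i, (2 * A j)) * ln fun t n => ‖highF c₁ c₂ J (g i) t n‖ₑ := by
          rw [nrm_const_mul _ hsm, ln_eq_nrm_sn hmeas]
      _ ≤ (S * ∏ j ∈ Finset.univ.erase i, (2 * A j)) * (3 * (rt⁻¹ ^ J * A i)) := by
          gcongr; exact (hg i).ln_highF_le hη J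
      _ = _ := by
          rw [Finset.prod_mul_distrib, ← Finset.mul_prod_erase Finset.univ A (Finset.mem_univ i)]
          simp only [Finset.prod_const, Finset.card_erase_of_mem (Finset.mem_univ i),
            Finset.card_univ, Fintype.card_fin]
          ring
  calc _ ≤ ln (fun t n => ∑' i, F i t n) := ln_mono h1
    _ ≤ ∑' i, ln (F i) := ln_tsum_le hFm
    _ ≤ ∑' i : Fin 3, 12 * (rt⁻¹ ^ J * S * ∏ j, A j) := ENNReal.tsum_le_tsum h2
    _ = _ := by rw [tsum_fintype, Finset.sum_const]; simp; ring

end piece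

theorem integrable_mul_ift {ψ g : ℝ → ℂ} (hψ : Integrable ψ) (hg : Integrable g) :
    Integrable fun t => ψ t * ift g t := by
  have h := hψ.bdd_mul (c := (∫⁻ τ, ‖g τ‖ₑ).toReal) (continuous_ift hg).aestronglyMeasurable
    (Eventually.of_forall fun t => by
      rw [← toReal_enorm]
      exact ENNReal.toReal_mono hg.2.ne (enorm_ift_le g t))
  exact h.congr (Eventually.of_forall fun t => mul_comm _ _)

theorem enorm_ift_mul_prod_three_le {ψ : ℝ → ℂ} {g : Fin 3 → ℝ → ℂ} (hψ : Integrable ψ)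
    (hg : ∀ j, Integrable (g j)) {B : ℝ≥0∞} (θ : ℝ)
    (hB : ∀ τ : Fin 3 → ℝ, (∀ j, g j (τ j) ≠ 0) → ‖ift ψ (θ + ∑ j, τ j)‖ₑ ≤ B) :
    ‖ift (fun t => ψ t * ∏ j, ift (g j) t) θ‖ₑ ≤ B * ∏ j, ∫⁻ τ, ‖g j τ‖ₑ := by
  have e : (fun t => ψ t * ∏ j, ift (g j) t) =
      fun t => (fun t => (fun t => ψ t * ift (g 0) t) t * ift (g 1) t) t * ift (g 2) t := by
    ext t; rw [Fin.prod_univ_three]; ring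
  rw [e, Fin.prod_univ_three, ← mul_assoc, ← mul_assoc]
  have h0 := integrable_mul_ift hψ (hg 0)
  have h1 := integrable_mul_ift h0 (hg 1)
  refine enorm_ift_mul_ift_le h1 (hg 2) θ fun τ₂ h₂ => ?_
  refine enorm_ift_mul_ift_le h0 (hg 1) _ fun τ₁ h₁ => ?_
  refine enorm_ift_mul_ift_le hψ (hg 0) _ fun τ₀ h₀ => ?_
  have := hB ![τ₀, τ₁, τ₂] (by intro j; fin_cases j; exacts [h₀, h₁, h₂])
  rw [Fin.sum_univ_three] at this
  convert this using 3
  simp; ring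

theorem ft_finset_sum {ι : Type*} (s : Finset ι) {f : ι → ℝ → ℂ} (hf : ∀ i ∈ s, Integrable (f i))
    (τ : ℝ) : ft (fun t => ∑ i ∈ s, f i t) τ = ∑ i ∈ s, ft (f i) τ := by
  unfold ft
  simp_rw [Finset.mul_sum]
  rw [integral_finsetSum]
  intro i hi
  have h2 : Continuous fun t : ℝ => Complex.exp (-(Complex.I * (t : ℂ) * (τ : ℂ))) := by fun_prop
  exact (hf i hi).bdd_mul (c := 1) h2.aestronglyMeasurable
    (Eventually.of_forall fun p => by rw [norm_exp_neg_I_mul])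

theorem ft_const_mul (c : ℂ) (f : ℝ → ℂ) (τ : ℝ) : ft (fun t => c * f t) τ = c * ft f τ := by
  unfold ft
  rw [← integral_const_mul]
  congr 1; ext t; ring

/-- The bound of the oscillatory integrals over pieces of the windows. -/
def OscBound (η : ℝ → ℝ) (C : ℝ≥0∞) : Prop :=
  ∀ (w t₀ T α β θ r : ℝ), 0 < w → 0 < r → r ≤ |θ| →
    ‖ift ((piece T α β).indicator fun t => (η (w * (t - t₀)) : ℂ)) θ‖ₑ ≤ C * ENNReal.ofReal r⁻¹

theorem integrable_piece_bump {η : ℝ → ℝ} (hη : IsBump η) (k : ℕ) (t₀ T α β : ℝ) :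
    Integrable ((piece T α β).indicator fun t => (η (2 ^ (2 * k) * (t - t₀)) : ℂ)) :=
  (memLp_one_iff_integrable.mp (memLp_bump_comp hη (2 ^ (2 * k)) t₀ (by positivity) 1)).indicator
    (measurableSet_piece T α β)

section piece
variable {η : ℝ → ℝ} {c₁ c₂ T : ℝ} {k : ℕ} {t₀ α β : ℝ} {b : ℤ → (Fin 3 → ℤ) → ℂ}
  {kk : Fin 3 → ℕ} {v : Fin 3 → ℝ → ℤ → ℂ} {A : Fin 3 → ℝ≥0∞} {S : ℝ≥0∞} {J K : ℕ}
  {g : Fin 3 → ℝ → ℤ → ℂ}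

/-- The three entries and the output have modulation at most `2^J`. Together they displace the phase
by at most `4·2^J`, and the resonance function is at least `5·2^J`; a phase of size `2^J` remains,
and the oscillation bound gains `2^{-J}`. -/
theorem enorm_ft_lowPiece_le (hη : IsBump η) {C : ℝ≥0∞} (hC : OscBound η C)
    (hg : ∀ j, LocalRep η c₁ c₂ T (kk j) (A j) (v j) β (g j))
    (hR : ∀ n, ∀ m ∈ box kk, b n m ≠ 0 → 5 * 2 ^ J ≤ |mu c₁ c₂ n - ∑ j, mu c₁ c₂ (m j)|)
    (τ : ℝ) (n : ℤ) (hτ : |τ - mu c₁ c₂ n| ≤ 2 ^ J) :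
    ‖ft (fun t => lowPiece η c₁ c₂ T k t₀ α β b kk J g t n) τ‖ₑ ≤
      C * rt⁻¹ ^ (2 * J) * ∑ m ∈ box kk, ‖b n m‖ₑ * ∏ j, ∫⁻ τ, ‖g j τ (m j)‖ₑ := by
  set ψ : ℝ → ℂ := (piece T α β).indicator fun t => (η (2 ^ (2 * k) * (t - t₀)) : ℂ) with hψd
  have hψ : Integrable ψ := integrable_piece_bump hη k t₀ T α β
  set γ : (Fin 3 → ℤ) → Fin 3 → ℝ → ℂ :=
    fun m j => (highSet c₁ c₂ J (m j))ᶜ.indicator fun τ => g j τ (m j) with hγ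
  have hγi : ∀ m j, Integrable (γ m j) := fun m j =>
    ((hg j).int (m j)).indicator (measurableSet_highSet c₁ c₂ J (m j)).compl
  have e : (fun t => lowPiece η c₁ c₂ T k t₀ α β b kk J g t n) = fun t => ∑ m ∈ box kk,
      (b n m * ((2 * Real.pi : ℂ)⁻¹) ^ 3) * (ψ t * ∏ j, ift (γ m j) t) := by
    ext t
    by_cases ht : t ∈ piece T α β
    · rw [lowPiece, indicator_of_mem ht, hψd, indicator_of_mem ht, blk, Finset.mul_sum]
      refine Finset.sum_congr rfl fun m _ => ?_
      simp only [lowF, Finset.prod_mul_distrib, Finset.prod_const, Finset.card_univ,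
        Fintype.card_fin]
      ring
    · rw [lowPiece, indicator_of_notMem ht, hψd, indicator_of_notMem ht]; simp
  have hint : ∀ m, Integrable fun t => ψ t * ∏ j, ift (γ m j) t := fun m => by
    refine (integrable_mul_ift (integrable_mul_ift (integrable_mul_ift hψ (hγi m 0))
      (hγi m 1)) (hγi m 2)).congr (Eventually.of_forall fun t => ?_)
    simp only [Fin.prod_univ_three]; ring
  rw [e, ft_finset_sum _ fun m _ => (hint m).const_mul _, Finset.mul_sum]
  refine (enorm_sum_le _ _).trans (Finset.sum_le_sum fun m hm => ?_)
  rw [ft_const_mul, enorm_mul, enorm_mul, enorm_pow]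
  by_cases hb : b n m = 0
  · simp [hb]
  have key : ‖ft (fun t => ψ t * ∏ j, ift (γ m j) t) τ‖ₑ ≤
      C * rt⁻¹ ^ (2 * J) * ∏ j, ∫⁻ τ, ‖γ m j τ‖ₑ := by
    rw [ft_eq_ift]
    refine enorm_ift_mul_prod_three_le hψ (hγi m) _ fun σ hσ => ?_
    rw [← ofReal_inv_two_pow]
    refine hC _ _ _ _ _ _ _ (by positivity) (by positivity) ?_
    have hσ' : ∀ j, |σ j - mu c₁ c₂ (m j)| ≤ 2 ^ J := fun j => by
      by_contra h0
      apply hσ j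
      rw [hγ]; dsimp only
      rw [indicator_of_notMem]
      intro h; exact h (not_le.mp h0)
    have h5 := hR n m hm hb
    rw [Fin.sum_univ_three] at h5 ⊢
    have a0 := abs_le.mp (hσ' 0); have a1 := abs_le.mp (hσ' 1); have a2 := abs_le.mp (hσ' 2)
    have a3 := abs_le.mp hτ
    rcases le_abs.mp h5 with h6 | h6
    · refine le_abs.mpr (Or.inr ?_); linarith [a0.1, a0.2, a1.1, a1.2, a2.1, a2.2, a3.1, a3.2]
    · refine le_abs.mpr (Or.inl ?_); linarith [a0.1, a0.2, a1.1, a1.2, a2.1, a2.2, a3.1, a3.2]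
  calc _ ≤ ‖b n m‖ₑ * 1 ^ 3 * (C * rt⁻¹ ^ (2 * J) * ∏ j, ∫⁻ τ, ‖g j τ (m j)‖ₑ) := by
        gcongr
        · exact enorm_two_pi_inv_le
        · refine key.trans ?_
          gcongr with j _ τ
          exact enorm_indicator_le_enorm_self _ _
    _ = _ := by ring

end piece

/-- Disjoint supports in time make the summands orthogonal, so `N` of them cost `√N` and not `N`;
`q` is any bound for `√N`. -/
theorem ln_sum_disjoint_le {f : ℕ → ℝ → ℤ → ℂ} {I : ℕ → Set ℝ} {N : ℕ}
    (hf : ∀ p t, t ∉ I p → ∀ n, f p t n = 0)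
    (hm : ∀ p n, Measurable fun t => f p t n)
    (hd : Pairwise (Function.onFun Disjoint I)) {q B : ℝ≥0∞} (hq : (N : ℝ≥0∞) ≤ q ^ 2)
    (hB : ∀ p < N, (ln fun t n => ‖f p t n‖ₑ) ≤ B) :
    (ln fun t n => ‖∑ p ∈ Finset.range N, f p t n‖ₑ) ≤ q * B := by
  rw [ln_le_iff]
  have h1 : ∀ t n, ‖∑ p ∈ Finset.range N, f p t n‖ₑ ^ 2 ≤
      ∑ p ∈ Finset.range N, ‖f p t n‖ₑ ^ 2 := by
    intro t n
    by_cases h : ∃ p ∈ Finset.range N, t ∈ I p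
    · obtain ⟨p, hp, htp⟩ := h
      rw [Finset.sum_eq_single_of_mem p hp]
      · exact Finset.single_le_sum (f := fun p => ‖f p t n‖ₑ ^ 2) (fun _ _ => zero_le) hp
      · intro p' _ hne
        apply hf
        intro h'
        exact (Set.disjoint_left.mp (hd hne)) h' htp
    · rw [Finset.sum_eq_zero]
      · simp
      · intro p hp; apply hf; intro h'; exact h ⟨p, hp, h'⟩
  calc _ ≤ ∑' n, ∫⁻ t, ∑ p ∈ Finset.range N, ‖f p t n‖ₑ ^ 2 := by
        gcongr with n t; exact h1 t n
    _ = ∑ p ∈ Finset.range N, (ln fun t n => ‖f p t n‖ₑ) ^ 2 := by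
        simp_rw [lintegral_finsetSum _ fun p _ => ((hm p _).enorm.pow_const 2), ln_sq]
        rw [Summable.tsum_finsetSum fun i _ => ENNReal.summable]
    _ ≤ ∑ p ∈ Finset.range N, B ^ 2 := by
        gcongr with p hp; exact hB p (Finset.mem_range.mp hp)
    _ = N * B ^ 2 := by simp
    _ ≤ _ := by rw [mul_pow]; gcongr

/-! ### The resonant block estimate. -/

/-- The estimate of a resonant block in `N_k`. -/
theorem xNorm_blkT_le_of_resonance {η : ℝ → ℝ} (hη : IsBump η) : ∃ C : ℝ≥0∞, C ≠ ⊤ ∧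
    ∀ (c₁ c₂ T : ℝ) (k : ℕ) (t₀ : ℝ) (b : ℤ → (Fin 3 → ℤ) → ℂ) (kk : Fin 3 → ℕ)
      (v : Fin 3 → ℝ → ℤ → ℂ) (A : Fin 3 → ℝ≥0∞) (S : ℝ≥0∞) (K : ℕ),
      (∀ j, HasRep η c₁ c₂ T (kk j) (A j) (v j)) → (∀ j, A j ≠ ⊤) → SpatialBound b kk S → S ≠ ⊤ →
      (∀ j, kk j ≤ K) → k ≤ K → 2 ≤ K →
      (∀ n, ∀ m ∈ box kk, b n m ≠ 0 →
        5 * 2 ^ (4 * K - 8) ≤ |mu c₁ c₂ n - ∑ j, mu c₁ c₂ (m j)|) →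
      xNorm η c₁ c₂ (modInv c₁ c₂ k fun τ n => ft (fun t => blkT η T k t₀ b kk v t n) τ) ≤
        C * (rt⁻¹ ^ (4 * k + 2 * K) * S * ∏ j, A j) := by
  obtain ⟨C, hCt, hC⟩ := exists_oscillation_bound hη
  refine ⟨4 * 4 * 8 * 6 * 256 * C + 4 * geomQ * 16 * 3 * 4 * 8 + 12 * geomQ * 4 * 36 * 16, ?_, ?_⟩
  · have := geomQ_ne_top
    finiteness
  intro c₁ c₂ T k t₀ b kk v A S K hv hA hS hSt hkk hk hK hR
  -- `2^J` is a fifth of the assumed lower bound for the resonance function; `2 ≤ K` makes the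
  -- subtraction exact.
  set J := 4 * K - 8 with hJ
  set δ : ℝ := (2 ^ (2 * K))⁻¹ with hδ
  have hδ0 : 0 < δ := by positivity
  -- A grid of step `2^{-2K}`, short enough for the representations of all entries. It runs over `t₀
  -- ± 3·2^{-2k}`, so that its half-open cells cover the support `t₀ ± 2·2^{-2k}` of the window
  -- including the left end point.
  set a : ℕ → ℝ := fun p => t₀ - 3 * (2 ^ (2 * k))⁻¹ + p * δ with ha
  have ha1 : ∀ p, a (p + 1) - a p = δ := fun p => by rw [ha]; push_cast; ring
  have hmono : Monotone a := monotone_nat_of_le_succ fun p => by linarith [ha1 p]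
  set N := 6 * 2 ^ (2 * (K - k)) with hN
  have haN : a N = t₀ + 3 * (2 ^ (2 * k))⁻¹ := by
    have e : (2 : ℝ) ^ (2 * K) = 2 ^ (2 * (K - k)) * 2 ^ (2 * k) := by
      rw [← pow_add]; congr 1; omega
    simp only [ha, hN, hδ]
    rw [e]; push_cast; field_simp; ring
  choose g hg using fun p j => hv j (a (p + 1))
  set I : ℕ → Set ℝ := fun p => piece T (a p) (a (p + 1)) with hI
  have hdisj : Pairwise (Function.onFun Disjoint I) := by
    intro p p' hne
    have := hmono.pairwise_disjoint_on_Ioc_succ hne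
    exact this.mono inter_subset_right inter_subset_right
  have hlen : ∀ p j, a (p + 1) - a p ≤ (2 ^ (2 * kk j))⁻¹ := fun p j => by
    rw [ha1, hδ]; gcongr; · norm_num
    · exact hkk j
  set fR : ℕ → ℝ → ℤ → ℂ := fun p => lowPiece η c₁ c₂ T k t₀ (a p) (a (p + 1)) b kk J (g p) with hfR
  set fE : ℕ → ℝ → ℤ → ℂ :=
    fun p => highPiece η c₁ c₂ T k t₀ (a p) (a (p + 1)) b kk J v (g p) with hfE
  have hmR : ∀ p n, Measurable fun t => fR p t n := fun p n => measurable_lowPiece hη (hg p) n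
  have hmE : ∀ p n, Measurable fun t => fE p t n := fun p n => measurable_highPiece hη hv (hg p) n
  have hsplit : ∀ t n, blkT η T k t₀ b kk v t n =
      (∑ p ∈ Finset.range N, fR p t n) + ∑ p ∈ Finset.range N, fE p t n := by
    intro t n
    rw [← Finset.sum_add_distrib]
    have h1 : ∀ p, fR p t n + fE p t n = (I p).indicator (fun t => blkT η T k t₀ b kk v t n) t := by
      intro p
      by_cases ht : t ∈ I p
      · simp only [hfR, hfE, lowPiece, highPiece]
        rw [indicator_of_mem ht, indicator_of_mem ht, indicator_of_mem ht, blkT,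
          indicator_of_mem ht.1]
        ring
      · simp only [hfR, hfE, lowPiece, highPiece]
        rw [indicator_of_notMem ht, indicator_of_notMem ht, indicator_of_notMem ht, add_zero]
    simp_rw [h1]
    by_cases h : ∃ p ∈ Finset.range N, t ∈ I p
    · obtain ⟨p, hp, htp⟩ := h
      rw [Finset.sum_eq_single_of_mem p hp, indicator_of_mem htp]
      intro p' _ hne
      apply indicator_of_notMem
      intro h'
      exact (Set.disjoint_left.mp (hdisj hne)) h' htp
    · rw [Finset.sum_eq_zero fun p hp => indicator_of_notMem (fun h' => h ⟨p, hp, h'⟩) _]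
      by_contra h0
      apply h
      have hT : t ∈ Ioo (-T) T := by
        by_contra hT; exact h0 (by rw [blkT, indicator_of_notMem hT])
      have hW : t ∈ Icc (t₀ - 2 * (2 ^ (2 * k))⁻¹) (t₀ + 2 * (2 ^ (2 * k))⁻¹) := by
        by_contra hW; exact h0 (blkT_eq_zero hη hW n)
      have hpos : (0 : ℝ) < (2 ^ (2 * k))⁻¹ := by positivity
      have hmem : t ∈ Ioc (a 0) (a N) := by
        rw [haN]; simp only [ha]
        push_cast
        exact ⟨by linarith [hW.1], by linarith [hW.2]⟩
      rw [← hmono.biUnion_Ico_Ioc_map_succ 0 N] at hmem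
      simp only [mem_iUnion, exists_prop] at hmem
      obtain ⟨p, hp, htp⟩ := hmem
      exact ⟨p, Finset.mem_range.mpr hp.2, hT, htp⟩
  -- The square root of the number of pieces, using `6 ≤ 4²`.
  have hq : (N : ℝ≥0∞) ≤ (4 * 2 ^ (K - k)) ^ 2 := by
    rw [hN]; push_cast
    rw [mul_pow, ← pow_mul, mul_comm (K - k)]
    gcongr; norm_num
  have hvanR : ∀ p t, t ∉ I p → ∀ n, fR p t n = 0 := fun p t ht n => indicator_of_notMem ht _
  have hvanE : ∀ p t, t ∉ I p → ∀ n, fE p t n = 0 := fun p t ht n => indicator_of_notMem ht _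
  have hlnR : (ln fun t n => ‖∑ p ∈ Finset.range N, fR p t n‖ₑ) ≤
      4 * 2 ^ (K - k) * (rt⁻¹ ^ (2 * K) * (S * ∏ j, (2 * A j))) :=
    ln_sum_disjoint_le hvanR hmR hdisj hq fun p _ => ln_lowPiece_le hη (hg p) hS (ha1 p).le
  have hlnE : (ln fun t n => ‖∑ p ∈ Finset.range N, fE p t n‖ₑ) ≤
      4 * 2 ^ (K - k) * (36 * (rt⁻¹ ^ J * S * ∏ j, A j)) :=
    ln_sum_disjoint_le hvanE hmE hdisj hq fun p _ => ln_highPiece_le hη (hg p) hS (hlen p)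
  have hPA : S * ∏ j, (2 * A j) ≠ ⊤ :=
    ENNReal.mul_ne_top hSt (ENNReal.prod_ne_top fun j _ => ENNReal.mul_ne_top (by simp) (hA j))
  have hLR : ∀ p n q, MemLp (fun t => fR p t n) q := fun p n q =>
    memLp_of_bound_on (hmR p n) (measurableSet_piece T (a p) (a (p + 1)))
      ((measure_mono inter_subset_right).trans_lt measure_Ioc_lt_top).ne hPA
      (fun t => (le_sn (fun n => ‖fR p t n‖ₑ) n).trans (sn_lowPiece_le hη (hg p) hS t))
      (fun t ht => hvanR p t ht n) q
  have hLRs : ∀ n q, MemLp (fun t => ∑ p ∈ Finset.range N, fR p t n) q := fun n q =>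
    memLp_finsetSum _ fun p _ => hLR p n q
  have hLB : ∀ n q, MemLp (fun t => blkT η T k t₀ b kk v t n) q := fun n q =>
    memLp_blkT hη hv hA hS hSt n q
  have hLEs : ∀ n q, MemLp (fun t => ∑ p ∈ Finset.range N, fE p t n) q := fun n q => by
    have := (hLB n q).sub (hLRs n q)
    refine this.congr_norm ?_ (Eventually.of_forall fun t => ?_)
    · exact (Finset.measurable_sum _ fun p _ => hmE p n).aestronglyMeasurable
    · simp [hsplit]
  have hiR := fun n => memLp_one_iff_integrable.mp (hLRs n 1)
  have hiE := fun n => memLp_one_iff_integrable.mp (hLEs n 1)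
  -- At low output modulation the bound is pointwise in `τ`, so orthogonality in time is lost and
  -- the full number `N` of pieces enters.
  set b' : ℤ → ℝ≥0∞ := fun n => ∑' p : Finset.range N, C * rt⁻¹ ^ (2 * J) *
    ∑ m ∈ box kk, ‖b n m‖ₑ * ∏ j, ∫⁻ τ, ‖g p j τ (m j)‖ₑ with hb'
  have hlow : ∀ τ n, |τ - mu c₁ c₂ n| ≤ 2 ^ J →
      ‖ft (fun t => ∑ p ∈ Finset.range N, fR p t n) τ‖ₑ ≤ b' n := by
    intro τ n hτ
    rw [ft_finset_sum _ fun p _ => memLp_one_iff_integrable.mp (hLR p n 1)]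
    refine (enorm_sum_le _ _).trans ?_
    rw [hb']; dsimp only
    rw [Finset.tsum_subtype (Finset.range N) fun p => C * rt⁻¹ ^ (2 * J) *
      ∑ m ∈ box kk, ‖b n m‖ₑ * ∏ j, ∫⁻ τ, ‖g p j τ (m j)‖ₑ]
    exact Finset.sum_le_sum fun p _ => enorm_ft_lowPiece_le hη hC (hg p) hR τ n hτ
  have hsb : sn b' ≤ N * (C * rt⁻¹ ^ (2 * J) * (S * ∏ j, (2 * A j))) := by
    refine (sn_tsum_le _).trans ?_
    have : ∀ p : Finset.range N, sn (fun n => C * rt⁻¹ ^ (2 * J) *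
        ∑ m ∈ box kk, ‖b n m‖ₑ * ∏ j, ∫⁻ τ, ‖g p j τ (m j)‖ₑ) ≤
        C * rt⁻¹ ^ (2 * J) * (S * ∏ j, (2 * A j)) := fun p => by
      rw [sn_const_mul]
      gcongr
      refine (hS fun j x => ∫⁻ τ, ‖g p j τ x‖ₑ).trans ?_
      gcongr with j
      exact (hg p j).sn_le hη
    refine (ENNReal.tsum_le_tsum this).trans ?_
    rw [tsum_fintype, Finset.sum_const]; simp
  have hadd := xNorm_modInv_add_le hη (c₁ := c₁) (c₂ := c₂) (k := k)
    (g := fun τ n => ft (fun t => blkT η T k t₀ b kk v t n) τ)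
    (G₁ := fun τ n => ft (fun t => ∑ p ∈ Finset.range N, fR p t n) τ)
    (G₂ := fun τ n => ft (fun t => ∑ p ∈ Finset.range N, fE p t n) τ)
    (fun n => (continuous_ft (hiR n)).measurable) (fun n => (continuous_ft (hiE n)).measurable)
    (fun τ n => by simp_rw [hsplit, ft_eq_ift]; exact ift_add (hiR n) (hiE n) _)
  have hxR := xNorm_modInv_le_of_low hη k J (c₁ := c₁) (c₂ := c₂)
    (Φ := fun τ n => ft (fun t => ∑ p ∈ Finset.range N, fR p t n) τ)
    (fun n => (continuous_ft (hiR n)).measurable) b' hlow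
  have hxE := xNorm_modInv_ft_le (k := k) (c₁ := c₁) (c₂ := c₂) hη
    (f := fun t n => ∑ p ∈ Finset.range N, fE p t n) hLEs
  have hfR2 : (ln fun τ n => ‖ft (fun t => ∑ p ∈ Finset.range N, fR p t n) τ‖ₑ) ≤
      3 * ln fun t n => ‖∑ p ∈ Finset.range N, fR p t n‖ₑ := ln_ft_le hiR fun n => hLRs n 2
  set s := rt⁻¹ with hs
  have hs1 : s ≤ 1 := rt_inv_lt_one.le
  -- That is, `2^{-J/2} = 16·2^{-2K}`.
  have h16 : s ^ J = 16 * s ^ (4 * K) := by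
    have e : s ^ (4 * K) = s ^ J * s ^ 8 := by rw [← pow_add]; congr 1; omega
    have e8 : rt ^ 8 = 16 := by rw [show 8 = 2 * 4 by rfl, rt_pow_two_mul]; norm_num
    have e9 : (16 : ℝ≥0∞) * s ^ 8 = 1 := by rw [← e8]; exact rt_pow_mul_inv 8
    rw [e, mul_left_comm, e9, mul_one]
  have h2s : (2 : ℝ≥0∞) ^ (K - k) * s ^ (2 * K) = s ^ (2 * k) := by
    have e : 2 * K = 2 * (K - k) + 2 * k := by omega
    rw [← rt_pow_two_mul, e, pow_add, ← mul_assoc, rt_pow_mul_inv, one_mul]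
  -- This absorbs the loss `J ≤ 4K` from counting the low modulation shells.
  have hKs : (K : ℝ≥0∞) * s ^ (2 * K) ≤ 1 := by
    calc (K : ℝ≥0∞) * s ^ (2 * K) ≤ rt ^ (2 * K) * s ^ (2 * K) := by
          gcongr
          rw [rt_pow_two_mul]
          exact_mod_cast (Nat.lt_two_pow_self (n := K)).le
      _ = 1 := rt_pow_mul_inv _
  set Pr := ∏ j, A j with hPr
  have h8 : ∏ j : Fin 3, (2 * A j) = 8 * Pr := by
    rw [Finset.prod_mul_distrib, hPr]; simp; norm_num
  rw [h8] at hsb hlnR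
  -- All modulations low: shells times pieces times oscillation gain is of order
  -- `K·2^{2(K-k)}·2^{-4K}`, and `K ≤ 2^K`.
  have r1 : 4 * (J : ℝ≥0∞) * sn b' ≤ 4 * 4 * 8 * 6 * 256 * C * (s ^ (4 * k + 2 * K) * S * Pr) := by
    calc _ ≤ 4 * (4 * K) * (N * (C * s ^ (2 * J) * (S * (8 * Pr)))) := by
          gcongr
          rw [hJ]; exact_mod_cast Nat.sub_le (4 * K) 8
      _ = 4 * 4 * 8 * 6 * C * S * Pr * (K * s ^ J * s ^ J * (2 ^ (K - k) * 2 ^ (K - k))) := by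
          rw [hN]; push_cast
          rw [two_mul J, pow_add, two_mul (K - k), pow_add]; ring
      _ = 4 * 4 * 8 * 6 * 256 * C * S * Pr * ((2 ^ (K - k) * s ^ (2 * K)) *
            (2 ^ (K - k) * s ^ (2 * K)) * s ^ (2 * K) * (K * s ^ (2 * K))) := by
          rw [h16, show 4 * K = 2 * K + 2 * K by ring, pow_add]; ring
      _ ≤ 4 * 4 * 8 * 6 * 256 * C * S * Pr * ((2 ^ (K - k) * s ^ (2 * K)) *
            (2 ^ (K - k) * s ^ (2 * K)) * s ^ (2 * K) * 1) := by gcongr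
      _ = _ := by
          rw [h2s, show 4 * k + 2 * K = 2 * k + 2 * k + 2 * K by ring, pow_add, pow_add]; ring
  -- Low entries, high output: `2^{-J/2}` from the symbol and `2^{K-k}·2^{-K}` from the `L²` norm
  -- give the order `2^{-2K-k}`, which is enough because `k ≤ K`.
  have r2 : 4 * geomQ * (s ^ J * ln fun τ n => ‖ft (fun t => ∑ p ∈ Finset.range N, fR p t n) τ‖ₑ) ≤
      4 * geomQ * 16 * 3 * 4 * 8 * (s ^ (4 * k + 2 * K) * S * Pr) := by
    calc _ ≤ 4 * geomQ * (16 * s ^ (4 * K) *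
            (3 * (4 * 2 ^ (K - k) * (s ^ (2 * K) * (S * (8 * Pr)))))) := by
          rw [h16]; gcongr; exact hfR2.trans (by gcongr)
      _ = 4 * geomQ * 16 * 3 * 4 * 8 * S * Pr * (s ^ (4 * K) * (2 ^ (K - k) * s ^ (2 * K))) := by ring
      _ ≤ 4 * geomQ * 16 * 3 * 4 * 8 * S * Pr * s ^ (4 * k + 2 * K) := by
          rw [h2s, ← pow_add]
          gcongr 4 * geomQ * 16 * 3 * 4 * 8 * S * Pr * ?_
          exact pow_le_pow_of_le_one zero_le hs1 (by omega)
      _ = _ := by ring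
  -- One entry of high modulation: `2^{-k}` from the symbol, `2^{K-k}` from the pieces and
  -- `2^{-J/2}` from that entry give the order `2^{-2k-K}`.
  have r3 : 12 * geomQ * s ^ (2 * k) * (ln fun t n => ‖∑ p ∈ Finset.range N, fE p t n‖ₑ) ≤
      12 * geomQ * 4 * 36 * 16 * (s ^ (4 * k + 2 * K) * S * Pr) := by
    calc _ ≤ 12 * geomQ * s ^ (2 * k) * (4 * 2 ^ (K - k) * (36 * (16 * s ^ (4 * K) * S * Pr))) := by
          rw [← h16]; gcongr
      _ = 12 * geomQ * 4 * 36 * 16 * S * Pr * (s ^ (2 * k) * ((2 ^ (K - k) * s ^ (2 * K)) *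
            s ^ (2 * K))) := by
          rw [show 4 * K = 2 * K + 2 * K by ring, pow_add]; ring
      _ = _ := by
          rw [h2s, show 4 * k + 2 * K = 2 * k + 2 * k + 2 * K by ring, pow_add, pow_add]; ring
  calc _ ≤ _ := hadd
    _ ≤ _ := add_le_add (hxR.trans (add_le_add r1 r2)) (hxE.trans r3)
    _ = _ := by ring

/-! ### Block coefficients and the relations between their frequencies. -/

open Classical in
/-- The coefficients of the block `(k; kk)` of the multilinear form with index sets `S` and
coefficients `c`. -/
def bcoef {d : ℕ} (η : ℝ → ℝ) (S : ℤ → Set (Fin d → ℤ)) (c : ℤ → (Fin d → ℤ) → ℂ) (k : ℕ)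
    (kk : Fin d → ℕ) (n : ℤ) (m : Fin d → ℤ) : ℂ :=
  -- The cut-offs of the entries enter only through their supports, their values being part of the
  -- entries. A nonzero coefficient thus records the dyadic size of every frequency, including the
  -- lower bounds that resonance needs.
  if m ∈ S n ∧ ∀ j, chi η (kk j) (m j) ≠ 0 then (chi η k n : ℂ) * c n m else 0

/-- The estimate of all blocks of a multilinear form in `N_k` with constant `C` and with no loss in
any one of the entries. -/
def BlockBoundWith {d : ℕ} (η : ℝ → ℝ) (c₁ c₂ : ℝ) (S : ℤ → Set (Fin d → ℤ))
    (c : ℤ → (Fin d → ℤ) → ℂ) (C : ℝ≥0∞) : Prop :=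
  ∀ (T : ℝ) (k : ℕ) (t₀ : ℝ) (kk : Fin d → ℕ) (v : Fin d → ℝ → ℤ → ℂ)
    (A : Fin d → ℝ≥0∞), (∀ j, HasRep η c₁ c₂ T (kk j) (A j) (v j)) → (∀ j, A j ≠ ⊤) → ∀ i,
    xNorm η c₁ c₂ (modInv c₁ c₂ k fun τ n => ft (fun t => blkT η T k t₀ (bcoef η S c k kk) kk v t n) τ)
      ≤ C * (∏ j ∈ Finset.univ.erase i, 2 ^ kk j) * ∏ j, A j

/-- The estimate of all blocks of a multilinear form with some finite constant. -/
def BlockBound {d : ℕ} (η : ℝ → ℝ) (c₁ c₂ : ℝ) (S : ℤ → Set (Fin d → ℤ))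
    (c : ℤ → (Fin d → ℤ) → ℂ) : Prop :=
  ∃ C : ℝ≥0∞, C ≠ ⊤ ∧ BlockBoundWith η c₁ c₂ S c C

section shells
variable {η : ℝ → ℝ} {d : ℕ} {S : ℤ → Set (Fin d → ℤ)} {c : ℤ → (Fin d → ℤ) → ℂ} {k : ℕ}
  {kk : Fin d → ℕ} {n : ℤ} {m : Fin d → ℤ}

theorem bcoef_ne_zero (h : bcoef η S c k kk n m ≠ 0) :
    m ∈ S n ∧ (∀ j, chi η (kk j) (m j) ≠ 0) ∧ chi η k n ≠ 0 := by
  unfold bcoef at h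
  split_ifs at h with h1
  · refine ⟨h1.1, h1.2, fun h0 => h ?_⟩
    simp [h0]
  · exact absurd rfl h

theorem enorm_bcoef_le (hη : IsBump η) {B : ℝ≥0∞}
    (hB : bcoef η S c k kk n m ≠ 0 → ‖c n m‖ₑ ≤ B) : ‖bcoef η S c k kk n m‖ₑ ≤ B := by
  by_cases h : bcoef η S c k kk n m = 0
  · rw [h]; simp
  · have h2 := hB h
    unfold bcoef
    split_ifs
    · rw [enorm_mul]
      exact (mul_le_of_le_one_left' (enorm_chi_le hη _ _)).trans h2
    · simp

/-- The `+ 1` is for `k = 0`, where `n` may vanish. -/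
theorem two_pow_le_of_chi_ne (hη : IsBump η) {k : ℕ} {n : ℤ} (h : chi η k n ≠ 0) :
    (2 : ℤ) ^ k ≤ 2 * |n| + 1 := by
  cases k with
  | zero => have := abs_nonneg n; simp
  | succ k =>
    have := lt_abs_int_of_chi_ne hη h
    rw [pow_succ]; linarith

theorem abs_le_of_chi_ne' (hη : IsBump η) {k : ℕ} {n : ℤ} (h : chi η k n ≠ 0) :
    |n| ≤ 2 * 2 ^ k := by
  have := abs_int_le_of_chi_ne hη h
  rw [pow_succ] at this; linarith

/-- The shift `5` comes from `4·7 + 1 = 29 < 2^5`. The factor `4` is the product of the `2` in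
`two_pow_le_of_chi_ne` and the `2` in `abs_le_of_chi_ne'`. -/
theorem le_add_of_two_pow_le {k : ℕ} {ι : Type*} (s : Finset ι) (f : ι → ℕ) (E : ℕ)
    (hs : s.card ≤ 7) (hf : ∀ i ∈ s, f i ≤ E) (h : (2 : ℤ) ^ k ≤ 4 * ∑ i ∈ s, 2 ^ f i + 1) :
    k ≤ E + 5 := by
  have h1 : ∑ i ∈ s, (2 : ℤ) ^ f i ≤ 7 * 2 ^ E := by
    calc _ ≤ ∑ i ∈ s, (2 : ℤ) ^ E :=
          Finset.sum_le_sum fun i hi => pow_le_pow_right₀ (by norm_num) (hf i hi)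
      _ = s.card * 2 ^ E := by simp
      _ ≤ 7 * 2 ^ E := by gcongr; exact_mod_cast hs
  have h2 : (1 : ℤ) ≤ 2 ^ E := one_le_pow₀ (by norm_num)
  have h3 : (2 : ℤ) ^ k < 2 ^ (E + 5) := by
    rw [pow_add]; norm_num; linarith
  exact ((pow_lt_pow_iff_right₀ (by norm_num)).mp h3).le

/-- If `n` is the sum of the `m j`, then the dyadic size of each `m i` is dominated by those of `n` and
of the other `m j`. -/
theorem le_add_of_sum_eq (hη : IsBump η) (hd : d ≤ 6) {E : ℕ} (hn : |n| ≤ 2 * 2 ^ k)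
    (hsum : ∑ j, m j = n) (h2 : ∀ j, chi η (kk j) (m j) ≠ 0) (i : Fin d) (hk : k ≤ E)
    (hE : ∀ j ∈ Finset.univ.erase i, kk j ≤ E) : kk i ≤ E + 5 := by
  -- `none` stands for the output frequency, which is treated on a par with those of the other
  -- entries.
  refine le_add_of_two_pow_le (Finset.univ : Finset (Option {j // j ∈ Finset.univ.erase i}))
    (fun o => o.elim k fun j => kk j) _ ?_ (fun j _ => ?_) ?_
  · simp; omega
  · cases j with
    | none => simpa using hk
    | some j => simpa using hE j j.2
  · have h5 := two_pow_le_of_chi_ne hη (h2 i)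
    have h4 : |m i| ≤ 2 * 2 ^ k + ∑ j ∈ Finset.univ.erase i, 2 * 2 ^ kk j := by
      have e : m i = n - ∑ j ∈ Finset.univ.erase i, m j := by
        rw [← hsum, ← Finset.add_sum_erase Finset.univ m (Finset.mem_univ i)]; ring
      rw [e]
      refine (abs_sub _ _).trans (add_le_add hn ?_)
      exact (Finset.abs_sum_le_sum_abs _ _).trans
        (Finset.sum_le_sum fun j _ => abs_le_of_chi_ne' hη (h2 j))
    rw [← Finset.mul_sum] at h4
    rw [Fintype.sum_option]
    simp only [Option.elim]
    rw [Finset.sum_coe_sort (Finset.univ.erase i) fun j => (2 : ℤ) ^ kk j]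
    linarith

/-- The frequencies of a nonzero block: the two largest are comparable. -/
theorem nd_le_of_bcoef_ne (hη : IsBump η) (hd : d ≤ 6) (hS : ∀ n, ∀ m ∈ S n, ∑ j, m j = n)
    (h : bcoef η S c k kk n m ≠ 0) (i : Fin d) :
    nd k (kk i) ≤ ∑ j ∈ Finset.univ.erase i, kk j + 5 := by
  obtain ⟨h1, h2, h3⟩ := bcoef_ne_zero h
  have hn := hS n m h1
  have hle : ∀ j ∈ Finset.univ.erase i, kk j ≤ ∑ j ∈ Finset.univ.erase i, kk j :=
    fun j hj => Finset.single_le_sum (f := kk) (fun _ _ => Nat.zero_le _) hj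
  have a1 : k ≤ (kk i + ∑ j ∈ Finset.univ.erase i, kk j) + 5 := by
    refine le_add_of_two_pow_le Finset.univ kk _ (by simp; omega) (fun j _ => ?_) ?_
    · by_cases hj : j = i
      · subst hj; omega
      · have := hle j (Finset.mem_erase.mpr ⟨hj, Finset.mem_univ j⟩); omega
    · have := two_pow_le_of_chi_ne hη h3
      have h4 : |n| ≤ ∑ j, 2 * 2 ^ kk j := by
        rw [← hn]
        exact (Finset.abs_sum_le_sum_abs _ _).trans
          (Finset.sum_le_sum fun j _ => abs_le_of_chi_ne' hη (h2 j))
      rw [← Finset.mul_sum] at h4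
      linarith
  have a2 : kk i ≤ (k + ∑ j ∈ Finset.univ.erase i, kk j) + 5 :=
    le_add_of_sum_eq hη hd (abs_le_of_chi_ne' hη h3) hn h2 i (by omega) fun j hj => by
      have := hle j hj; omega
  unfold nd; omega

end shells

theorem rt_pow_mul_inv_pow_le {a b c : ℕ} (h : a ≤ b + c) : rt ^ a * rt⁻¹ ^ b ≤ rt ^ c := by
  calc _ ≤ rt ^ (b + c) * rt⁻¹ ^ b := by
        gcongr
        exact one_lt_rt.le
    _ = rt ^ c * (rt ^ b * rt⁻¹ ^ b) := by rw [pow_add]; ring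
    _ = _ := by rw [rt_pow_mul_inv, mul_one]

theorem prod_rt_pow {ι : Type*} (s : Finset ι) (kk : ι → ℕ) :
    ∏ j ∈ s, rt ^ (kk j + 3) = rt ^ (∑ j ∈ s, kk j + 3 * s.card) := by
  rw [Finset.prod_pow_eq_pow_sum, Finset.sum_add_distrib]; simp [mul_comm]

theorem prod_two_pow {ι : Type*} (s : Finset ι) (kk : ι → ℕ) :
    ∏ j ∈ s, (2 : ℝ≥0∞) ^ kk j = rt ^ (2 * ∑ j ∈ s, kk j) := by
  rw [rt_pow_two_mul, Finset.prod_pow_eq_pow_sum]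

theorem enorm_intCast_le {n : ℤ} {a : ℕ} (h : |n| ≤ 2 ^ a) : ‖(n : ℂ)‖ₑ ≤ rt ^ (2 * a) := by
  rw [rt_pow_two_mul, ← ofReal_norm, Complex.norm_intCast]
  calc ENNReal.ofReal |(n : ℝ)| ≤ ENNReal.ofReal (2 ^ a) := by
        apply ENNReal.ofReal_le_ofReal; exact_mod_cast h
    _ = _ := by rw [ENNReal.ofReal_pow (by norm_num)]; simp

theorem enorm_natCast' (a : ℕ) : ‖(a : ℂ)‖ₑ = a := by
  rw [← ofReal_norm, Complex.norm_natCast, ENNReal.ofReal_natCast]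

theorem enorm_I : ‖Complex.I‖ₑ = 1 := by rw [← ofReal_norm, Complex.norm_I]; simp

theorem spatialBound_zero {d : ℕ} {b : ℤ → (Fin d → ℤ) → ℂ} {kk : Fin d → ℕ}
    (h : ∀ n, ∀ m ∈ box kk, b n m = 0) : SpatialBound b kk 0 := by
  intro a
  have : ∀ n, ∑ m ∈ box kk, ‖b n m‖ₑ * ∏ j, a j (m j) = 0 := fun n =>
    Finset.sum_eq_zero fun m hm => by simp [h n m hm]
  simp [this, sn]

/-! ### Block bounds for the four nonlinearities. -/

/-- The index sets of the resonant term `N₁`. -/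
def resSet (n : ℤ) : Set (Fin 3 → ℤ) := {![n, -n, n]}

/-- The coefficients of `N₁`. -/
def resCoef (n : ℤ) (_ : Fin 3 → ℤ) : ℂ := -20 * Complex.I * (n : ℂ) ^ 3

/-- The coefficients of `N₂`. -/
def quinticCoef (n : ℤ) (_ : Fin 5 → ℤ) : ℂ := 6 * Complex.I * (n : ℂ)

/-- The coefficients of `N₃` and `N₄`. -/
def cubicCoef (σ : (Fin 3 → ℤ) → ℤ) (n : ℤ) (m : Fin 3 → ℤ) : ℂ :=
  10 * Complex.I * (n : ℂ) * (σ m : ℂ)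

theorem sum_resSet (n : ℤ) (m : Fin 3 → ℤ) (h : m ∈ resSet n) : ∑ j, m j = n := by
  rw [resSet, mem_singleton_iff] at h
  subst h; simp [Fin.sum_univ_three]

theorem sum_nonres3 (n : ℤ) (m : Fin 3 → ℤ) (h : m ∈ nonres3 n) : ∑ j, m j = n := by
  rw [Fin.sum_univ_three]; exact h.1

theorem sum_nonres5 (n : ℤ) (m : Fin 5 → ℤ) (h : m ∈ nonres5 n) : ∑ j, m j = n := h.1

/-- The derivative costs `2^k`, less than the gain `2^{-2k}` of the windows. Young's inequality
costs `2^{kk j/2}` for `j ≠ i`, half of the permitted loss. -/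
theorem blockBound_quintic {η : ℝ → ℝ} (hη : IsBump η) (c₁ c₂ : ℝ) :
    BlockBound η c₁ c₂ nonres5 quinticCoef := by
  refine ⟨24 * geomQ * 2 ^ 5 * (6 * rt ^ 14), ?_, ?_⟩
  · have := geomQ_ne_top; have := rt_ne_top; finiteness
  intro T k t₀ kk v A hv hA i
  have hb : ∀ n, ∀ m ∈ box kk, ‖bcoef η nonres5 quinticCoef k kk n m‖ₑ ≤ 6 * rt ^ (2 * (k + 1)) := by
    intro n m _
    apply enorm_bcoef_le hη
    intro h
    have h3 := (bcoef_ne_zero h).2.2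
    rw [quinticCoef, enorm_mul, enorm_mul, enorm_I, mul_one]
    gcongr
    · exact (enorm_natCast' 6).le
    · exact enorm_intCast_le (abs_int_le_of_chi_ne hη h3)
  have hS := spatialBound_young i hb fun n m _ h => sum_nonres5 n m (bcoef_ne_zero h).1
  refine (xNorm_blkT_le (k := k) (t₀ := t₀) hη hv hA hS ?_).trans ?_
  · have := rt_ne_top; rw [prod_rt_pow]; finiteness
  rw [prod_rt_pow, prod_two_pow, Finset.card_erase_of_mem (Finset.mem_univ i)]
  set E := ∑ j ∈ Finset.univ.erase i, kk j
  simp only [Finset.card_univ, Fintype.card_fin]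
  calc _ = 24 * geomQ * 2 ^ 5 * 6 * (rt ^ (2 * (k + 1) + (E + 3 * (5 - 1))) * rt⁻¹ ^ (4 * k)) *
        ∏ j, A j := by rw [pow_add rt (2 * (k + 1))]; ring
    _ ≤ 24 * geomQ * 2 ^ 5 * 6 * (rt ^ (14 + 2 * E)) * ∏ j, A j := by
        gcongr; exact rt_pow_mul_inv_pow_le (by omega)
    _ = _ := by rw [pow_add]; ring

/-- All frequencies equal `±n`, so `k ≤ kk j + 5` for every entry of a nonzero block. The symbol
costs `2^{3k}` and the windows return `2^{2k}`; the remaining `2^k` is covered by the half of the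
permitted loss that Young's inequality leaves unused on the two other entries. -/
theorem blockBound_res {η : ℝ → ℝ} (hη : IsBump η) (c₁ c₂ : ℝ) :
    BlockBound η c₁ c₂ resSet resCoef := by
  refine ⟨24 * geomQ * 2 ^ 3 * (20 * rt ^ 22), ?_, ?_⟩
  · have := geomQ_ne_top; have := rt_ne_top; finiteness
  intro T k t₀ kk v A hv hA i
  by_cases h0 : ∀ n, ∀ m ∈ box kk, bcoef η resSet resCoef k kk n m = 0
  · refine (xNorm_blkT_le (k := k) (t₀ := t₀) hη hv hA (spatialBound_zero h0) (by simp)).trans ?_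
    simp
  push Not at h0
  obtain ⟨n₀, m₀, _, h0⟩ := h0
  obtain ⟨a1, a2, a3⟩ := bcoef_ne_zero h0
  have hk : ∀ j, k ≤ kk j + 5 := by
    intro j
    refine le_add_of_two_pow_le {j} kk _ (by simp) (by simp) ?_
    have e : |m₀ j| = |n₀| := by
      rw [resSet, mem_singleton_iff] at a1; subst a1
      fin_cases j <;> simp
    have b1 := two_pow_le_of_chi_ne hη a3
    have b2 := abs_le_of_chi_ne' hη (a2 j)
    rw [e] at b2
    simp; linarith
  have hb : ∀ n, ∀ m ∈ box kk, ‖bcoef η resSet resCoef k kk n m‖ₑ ≤ 20 * rt ^ (2 * (k + 1) * 3) := by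
    intro n m _
    apply enorm_bcoef_le hη
    intro h
    have h3 := (bcoef_ne_zero h).2.2
    rw [resCoef, enorm_mul, enorm_mul, enorm_I, mul_one, enorm_neg, enorm_pow, pow_mul]
    gcongr
    · exact (enorm_natCast' 20).le
    · exact enorm_intCast_le (abs_int_le_of_chi_ne hη h3)
  have hS := spatialBound_young i hb fun n m _ h => sum_resSet n m (bcoef_ne_zero h).1
  refine (xNorm_blkT_le (k := k) (t₀ := t₀) hη hv hA hS ?_).trans ?_
  · have := rt_ne_top; rw [prod_rt_pow]; finiteness
  have hE : 2 * k ≤ ∑ j ∈ Finset.univ.erase i, kk j + 10 := by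
    have := Finset.sum_le_sum (s := Finset.univ.erase i) fun j _ => hk j
    simpa [Finset.sum_add_distrib, Finset.card_erase_of_mem (Finset.mem_univ i)] using this
  rw [prod_rt_pow, prod_two_pow, Finset.card_erase_of_mem (Finset.mem_univ i)]
  set E := ∑ j ∈ Finset.univ.erase i, kk j
  simp only [Finset.card_univ, Fintype.card_fin]
  calc _ = 24 * geomQ * 2 ^ 3 * 20 * (rt ^ (2 * (k + 1) * 3 + (E + 3 * (3 - 1))) * rt⁻¹ ^ (4 * k)) *
        ∏ j, A j := by rw [pow_add rt (2 * (k + 1) * 3)]; ring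
    _ ≤ 24 * geomQ * 2 ^ 3 * 20 * (rt ^ (22 + 2 * E)) * ∏ j, A j := by
        gcongr; exact rt_pow_mul_inv_pow_le (by omega)
    _ ≤ _ := by rw [pow_add]; apply le_of_eq; ring

/-- Besides the entry of size at least `X`, the vanishing of the sum forces a second one of size at
least `15X/32`. The sums of `a` with these two are at least `15X/16` and `13X/32`, the third sum is
a nonzero integer, and `195/512 ≥ 1/4`. -/
theorem sq_le_of_quad_sum {a b c d X : ℤ} (h : a + b + c + d = 0) (hX : 0 ≤ X) (ha : 16 * |a| ≤ X)
    (hb : X ≤ |b| ∨ X ≤ |c| ∨ X ≤ |d|) (hne : (a + b) * (a + c) * (a + d) ≠ 0) :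
    X ^ 2 ≤ 4 * |(a + b) * (a + c) * (a + d)| := by
  have key : ∀ b c d : ℤ, a + b + c + d = 0 → X ≤ |b| → 15 * X ≤ 32 * |c| →
      (a + b) * (a + c) * (a + d) ≠ 0 → X ^ 2 ≤ 4 * |(a + b) * (a + c) * (a + d)| := by
    intro b c d _ hb hc hne
    have e1 : 15 * X ≤ 16 * |a + b| := by
      have := abs_sub_abs_le_abs_sub b (-a)
      rw [abs_neg, sub_neg_eq_add, add_comm b] at this; linarith
    have e2 : 13 * X ≤ 32 * |a + c| := by
      have := abs_sub_abs_le_abs_sub c (-a)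
      rw [abs_neg, sub_neg_eq_add, add_comm c] at this; linarith
    have e3 : 1 ≤ |a + d| := Int.one_le_abs (right_ne_zero_of_mul hne)
    rw [abs_mul, abs_mul]
    have e4 : (15 * X) * (13 * X) ≤ (16 * |a + b|) * (32 * |a + c|) :=
      mul_le_mul e1 e2 (by positivity) (by positivity)
    have e5 : |a + b| * |a + c| * 1 ≤ |a + b| * |a + c| * |a + d| := by gcongr
    nlinarith [sq_nonneg X]
  have key2 : ∀ b c d : ℤ, a + b + c + d = 0 → X ≤ |b| →
      (a + b) * (a + c) * (a + d) ≠ 0 → X ^ 2 ≤ 4 * |(a + b) * (a + c) * (a + d)| := by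
    intro b c d h hb hne
    have e1 : |b| ≤ |a| + |c| + |d| := by
      rw [show b = -(a + c + d) by linarith, abs_neg]
      exact abs_add_three a c d
    rcases le_total (|d|) (|c|) with hcd | hcd
    · exact key b c d h hb (by linarith) hne
    · have := key b d c (by linarith) hb (by linarith) (by rwa [mul_right_comm])
      rwa [mul_right_comm] at this
  rcases hb with hb | hb | hb
  · exact key2 b c d h hb hne
  · have := key2 c b d (by linarith) hb (by rwa [mul_comm (a + c)])
    rwa [mul_comm (a + c)] at this
  · have e : (a + d) * (a + b) * (a + c) = (a + b) * (a + c) * (a + d) := by ring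
    have := key2 d b c (by linarith) hb (by rwa [e])
    rwa [e] at this

/-- The resonance function of the dispersion relation is coercive on the non-resonant set as soon as
one frequency is much smaller than the largest one. -/
theorem resonance_lower {c₁ c₂ : ℝ} (hc₁ : 0 ≤ c₁) {n : ℤ} {m : Fin 3 → ℤ} (hm : m ∈ nonres3 n)
    {X : ℤ} (hX : 0 ≤ X) (hsmall : 16 * |n| ≤ X ∨ ∃ j, 16 * |m j| ≤ X)
    (hlarge : X ≤ |n| ∨ ∃ j, X ≤ |m j|) :
    5 * (X : ℝ) ^ 4 ≤ 8 * |mu c₁ c₂ n - ∑ j, mu c₁ c₂ (m j)| := by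
  obtain ⟨hn, hP⟩ := hm
  simp only [Fin.exists_fin_succ, Fin.isValue, Fin.succ_zero_eq_one, Fin.succ_one_eq_two,
    IsEmpty.exists_iff, or_false] at hsmall hlarge
  set P := (m 0 + m 1) * (m 0 + m 2) * (m 1 + m 2) with hPdef
  have hP2 : X ^ 2 ≤ 4 * |P| := by
    -- The four numbers `-n, m 0, m 1, m 2` have sum zero, so a sum of two of them is minus the sum
    -- of the other two. Whichever of the four is `a`, the product of its sums with the others is
    -- `-P`.
    have aux : ∀ a b c d : ℤ, a + b + c + d = 0 → 16 * |a| ≤ X → (X ≤ |b| ∨ X ≤ |c| ∨ X ≤ |d|) →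
        (a + b) * (a + c) * (a + d) = -P → X ^ 2 ≤ 4 * |P| := by
      intro a b c d h1 h2 h3 h4
      have := sq_le_of_quad_sum h1 hX h2 h3 (by rw [h4]; exact neg_ne_zero.mpr hP)
      rwa [h4, abs_neg] at this
    have hnn : |(-n)| = |n| := abs_neg n
    rcases eq_or_lt_of_le hX with h0 | h0
    · rw [← h0]; positivity
    rcases hsmall with h | h | h | h
    · refine aux (-n) (m 0) (m 1) (m 2) (by linarith) (by rwa [hnn]) ?_ (by rw [← hn]; ring)
      have : ¬ X ≤ |n| := by linarith [abs_nonneg n]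
      tauto
    · refine aux (m 0) (m 1) (m 2) (-n) (by linarith) h ?_ (by rw [← hn]; ring)
      have : ¬ X ≤ |m 0| := by linarith [abs_nonneg (m 0)]
      rw [hnn]; tauto
    · refine aux (m 1) (m 0) (m 2) (-n) (by linarith) h ?_ (by rw [← hn]; ring)
      have : ¬ X ≤ |m 1| := by linarith [abs_nonneg (m 1)]
      rw [hnn]; tauto
    · refine aux (m 2) (m 0) (m 1) (-n) (by linarith) h ?_ (by rw [← hn]; ring)
      have : ¬ X ≤ |m 2| := by linarith [abs_nonneg (m 2)]
      rw [hnn]; tauto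
  have hQ : X ^ 2 ≤ m 0 ^ 2 + m 1 ^ 2 + m 2 ^ 2 + n ^ 2 := by
    have aux : ∀ a : ℤ, X ≤ |a| → X ^ 2 ≤ a ^ 2 := fun a h => by
      rw [← sq_abs a]; exact pow_le_pow_left₀ hX h 2
    rcases hlarge with h | h | h | h <;> nlinarith [aux _ h, sq_nonneg (m 0), sq_nonneg (m 1),
      sq_nonneg (m 2), sq_nonneg n]
  have hnR : (n : ℝ) = m 0 + m 1 + m 2 := by rw [← hn]; push_cast; ring
  -- The quintic and the cubic part are both divisible by `P`, and the linear part cancels. As `c₁ ≥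
  -- 0`, the second factor is at least `5/2·X²`.
  have e : mu c₁ c₂ n - ∑ j, mu c₁ c₂ (m j) =
      (P : ℝ) * (5 / 2 * ((m 0 : ℝ) ^ 2 + (m 1 : ℝ) ^ 2 + (m 2 : ℝ) ^ 2 + (n : ℝ) ^ 2) + 3 * c₁) := by
    rw [Fin.sum_univ_three, hPdef]
    unfold mu
    push_cast
    rw [hnR]; ring
  have hP3 : (X : ℝ) ^ 2 ≤ 4 * |(P : ℝ)| := by exact_mod_cast hP2
  have hQ3 : (X : ℝ) ^ 2 ≤ (m 0 : ℝ) ^ 2 + (m 1 : ℝ) ^ 2 + (m 2 : ℝ) ^ 2 + (n : ℝ) ^ 2 := by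
    exact_mod_cast hQ
  rw [e, abs_mul, abs_of_nonneg (a := 5 / 2 * _ + _) (by positivity)]
  calc 5 * (X : ℝ) ^ 4 = 2 * (X : ℝ) ^ 2 * (5 / 2 * (X : ℝ) ^ 2 + 3 * 0) := by ring
    _ ≤ 2 * (4 * |(P : ℝ)|) * (5 / 2 * ((m 0 : ℝ) ^ 2 + (m 1 : ℝ) ^ 2 + (m 2 : ℝ) ^ 2 +
        (n : ℝ) ^ 2) + 3 * c₁) := by gcongr
    _ = _ := by ring

theorem enorm_cubicCoef_le {σ : (Fin 3 → ℤ) → ℤ} (hσ : σ = sigma₃ ∨ σ = sigma₄) {n : ℤ}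
    {m : Fin 3 → ℤ} {k K : ℕ} (hn : |n| ≤ 2 ^ (k + 1)) (hm : ∀ j, |m j| ≤ 2 ^ (K + 1)) :
    ‖cubicCoef σ n m‖ₑ ≤ 10 * rt ^ (2 * k + 4 * K + 6) := by
  have h1 : |σ m| ≤ 2 ^ (2 * (K + 1)) := by
    rcases hσ with rfl | rfl
    · rw [sigma₃, abs_pow, mul_comm, pow_mul]
      exact pow_le_pow_left₀ (abs_nonneg _) (hm 2) 2
    · rw [sigma₄, abs_mul, two_mul, pow_add]
      exact mul_le_mul (hm 1) (hm 2) (abs_nonneg _) (by positivity)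
  rw [cubicCoef, enorm_mul, enorm_mul, enorm_mul, enorm_I, mul_one]
  calc _ ≤ 10 * rt ^ (2 * (k + 1)) * rt ^ (2 * (2 * (K + 1))) := by
        gcongr
        · exact (enorm_natCast' 10).le
        · exact enorm_intCast_le hn
        · exact enorm_intCast_le h1
    _ = _ := by rw [mul_assoc, ← pow_add]; congr 2; ring

/-- Let `2^K` be the largest of the four frequencies; the symbol costs `2^{k+2K}`. If all four are
comparable, the gain `2^{-2k}` suffices, the two entries other than `i` being of size about `2^K`.
Otherwise the block is resonant and the gain is `2^{-2k-K}`. If then `k` is close to `K`, Young's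
inequality with entry `i` in `ℓ²` closes the estimate. If `k` is much smaller, some entry `q ≠ i` is
comparable to `2^K`; keeping both `i` and `q` in `ℓ²` replaces the cost `2^{kk q/2}` by `2^{k/2}`.
-/
theorem blockBound_cubic {η : ℝ → ℝ} (hη : IsBump η) {c₁ : ℝ} (hc₁ : 0 ≤ c₁) (c₂ : ℝ)
    {σ : (Fin 3 → ℤ) → ℤ} (hσ : σ = sigma₃ ∨ σ = sigma₄) :
    BlockBound η c₁ c₂ nonres3 (cubicCoef σ) := by
  obtain ⟨C, hCt, hC⟩ := xNorm_blkT_le_of_resonance hη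
  refine ⟨(24 * geomQ * 2 ^ 3 + C) * (10 * rt ^ 36), ?_, ?_⟩
  · have := geomQ_ne_top; have := rt_ne_top; finiteness
  intro T k t₀ kk v A hv hA i
  by_cases h0 : ∀ n, ∀ m ∈ box kk, bcoef η nonres3 (cubicCoef σ) k kk n m = 0
  · refine (xNorm_blkT_le (k := k) (t₀ := t₀) hη hv hA (spatialBound_zero h0) (by simp)).trans ?_
    simp
  push Not at h0
  obtain ⟨n₀, m₀, _, h0⟩ := h0
  -- Sum minus minimum is the maximum of `k` and all the `kk j`.
  set K := k + Finset.univ.sup kk - min k (Finset.univ.sup kk)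
  have hkK : k ≤ K := by omega
  have hkkK : ∀ j, kk j ≤ K := fun j => by
    have := Finset.le_sup (f := kk) (Finset.mem_univ j); omega
  have hKmem : K = k ∨ ∃ j, K = kk j := by
    obtain ⟨j, _, hj⟩ := Finset.exists_mem_eq_sup Finset.univ ⟨i, Finset.mem_univ i⟩ kk
    rcases le_total k (Finset.univ.sup kk) with h | h
    · right; exact ⟨j, by omega⟩
    · left; omega
  clear_value K
  have hsum : ∀ n, ∀ m ∈ box kk, bcoef η nonres3 (cubicCoef σ) k kk n m ≠ 0 → ∑ j, m j = n :=
    fun n m _ h => sum_nonres3 n m (bcoef_ne_zero h).1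
  have hb : ∀ n, ∀ m ∈ box kk, ‖bcoef η nonres3 (cubicCoef σ) k kk n m‖ₑ ≤
      10 * rt ^ (2 * k + 4 * K + 6) := by
    intro n m _
    apply enorm_bcoef_le hη
    intro h
    obtain ⟨-, h2, h3⟩ := bcoef_ne_zero h
    refine enorm_cubicCoef_le hσ (abs_int_le_of_chi_ne hη h3) fun j => ?_
    exact (abs_int_le_of_chi_ne hη (h2 j)).trans
      (pow_le_pow_right₀ (by norm_num) (by have := hkkK j; omega))
  have hSy := spatialBound_young i hb hsum
  rw [prod_rt_pow, Finset.card_erase_of_mem (Finset.mem_univ i)] at hSy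
  rw [prod_two_pow]
  set E := ∑ j ∈ Finset.univ.erase i, kk j with hE
  simp only [Finset.card_univ, Fintype.card_fin] at hSy
  have hrt := rt_ne_top
  have hEge : ∀ a, (∀ j, a ≤ kk j) → 2 * a ≤ E := fun a ha => by
    have := Finset.sum_le_sum (s := Finset.univ.erase i) fun j _ => ha j
    simpa [Finset.card_erase_of_mem (Finset.mem_univ i)] using this
  -- If this fails, some frequency is at most `2^{K-6}`, so that `resonance_lower` applies with `X =
  -- 2^{K-1}`, the lower end of the largest dyadic shell.
  by_cases hnr : K ≤ k + 6 ∧ ∀ j, K ≤ kk j + 6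
  · have hE2 : 2 * (K - 6) ≤ E := hEge _ fun j => by have := hnr.2 j; omega
    refine (xNorm_blkT_le (k := k) (t₀ := t₀) hη hv hA hSy (by finiteness)).trans ?_
    calc _ = 24 * geomQ * 2 ^ 3 * 10 * (rt ^ (2 * k + 4 * K + 6 + (E + 3 * (3 - 1))) *
          rt⁻¹ ^ (4 * k)) * ∏ j, A j := by rw [pow_add rt (2 * k + 4 * K + 6)]; ring
      _ ≤ 24 * geomQ * 2 ^ 3 * 10 * (rt ^ (36 + 2 * E)) * ∏ j, A j := by
          gcongr; exact rt_pow_mul_inv_pow_le (by omega)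
      _ = 24 * geomQ * 2 ^ 3 * (10 * rt ^ 36) * rt ^ (2 * E) * ∏ j, A j := by rw [pow_add]; ring
      _ ≤ _ := by gcongr; exact le_self_add
  have hK7 : 7 ≤ K := by
    by_contra hlt
    exact hnr ⟨by omega, fun j => by omega⟩
  have hres : ∀ n, ∀ m ∈ box kk, bcoef η nonres3 (cubicCoef σ) k kk n m ≠ 0 →
      5 * 2 ^ (4 * K - 8) ≤ |mu c₁ c₂ n - ∑ j, mu c₁ c₂ (m j)| := by
    intro n m _ h
    obtain ⟨h1, h2, h3⟩ := bcoef_ne_zero h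
    obtain ⟨K', rfl⟩ : ∃ K', K = K' + 7 := ⟨K - 7, by omega⟩
    have hsm : ∀ a : ℕ, ∀ x : ℤ, chi η a x ≠ 0 → ¬ K' + 7 ≤ a + 6 → 16 * |x| ≤ 2 ^ (K' + 6) := by
      intro a x hx ha
      have e1 := abs_int_le_of_chi_ne hη hx
      have e2 : (2 : ℤ) ^ (a + 1) ≤ 2 ^ (K' + 1) := pow_le_pow_right₀ (by norm_num) (by omega)
      have e3 : (2 : ℤ) ^ (K' + 6) = 32 * 2 ^ (K' + 1) := by rw [pow_add, pow_add]; ring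
      have e4 : (0 : ℤ) ≤ 2 ^ (K' + 1) := by positivity
      linarith
    have hla : ∀ a : ℕ, ∀ x : ℤ, chi η a x ≠ 0 → K' + 7 = a → 2 ^ (K' + 6) ≤ |x| := by
      intro a x hx ha
      subst ha
      exact (lt_abs_int_of_chi_ne hη hx).le
    have := resonance_lower (c₂ := c₂) hc₁ h1 (X := 2 ^ (K' + 6)) (by positivity) ?_ ?_
    · push_cast at this
      have e : ((2 : ℝ) ^ (K' + 6)) ^ 4 = 2 ^ (4 * (K' + 7) - 8) * 16 := by
        rw [show 4 * (K' + 7) - 8 = 4 * K' + 20 by omega]; ring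
      rw [e] at this
      have : (0 : ℝ) ≤ 2 ^ (4 * (K' + 7) - 8) := by positivity
      linarith
    · by_contra hcon
      push Not at hcon
      refine hnr ⟨?_, fun j => ?_⟩
      · by_contra hlt
        exact absurd (hsm k n h3 hlt) hcon.1.not_ge
      · by_contra hlt
        exact absurd (hsm _ _ (h2 j) hlt) (hcon.2 j).not_ge
    · rcases hKmem with h | ⟨j, h⟩
      · exact Or.inl (hla _ _ h3 h)
      · exact Or.inr ⟨j, hla _ _ (h2 j) h⟩
  by_cases hk6 : K ≤ k + 6
  · refine (hC c₁ c₂ T k t₀ _ kk v A _ K hv hA hSy (by finiteness) hkkK hkK (by omega)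
      hres).trans ?_
    calc _ = C * 10 * (rt ^ (2 * k + 4 * K + 6 + (E + 3 * (3 - 1))) *
          rt⁻¹ ^ (4 * k + 2 * K)) * ∏ j, A j := by rw [pow_add rt (2 * k + 4 * K + 6)]; ring
      _ ≤ C * 10 * (rt ^ (36 + 2 * E)) * ∏ j, A j := by
          gcongr; exact rt_pow_mul_inv_pow_le (by omega)
      _ = C * (10 * rt ^ 36) * rt ^ (2 * E) * ∏ j, A j := by rw [pow_add]; ring
      _ ≤ _ := by gcongr; exact le_add_self
  -- The largest frequency belongs to an entry, the output being small. If that entry is `i`, it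
  -- must be balanced by another entry within a factor `2^5`.
  obtain ⟨q, hqi, hq⟩ : ∃ q, q ≠ i ∧ K ≤ kk q + 5 := by
    obtain ⟨j, hj⟩ : ∃ j, K = kk j := hKmem.resolve_left (by omega)
    by_cases hji : j = i
    · subst hji
      by_contra hcon
      push Not at hcon
      obtain ⟨h1, h2, h3⟩ := bcoef_ne_zero h0
      have hs := sum_nonres3 _ _ h1
      rw [← Finset.add_sum_erase _ _ (Finset.mem_univ j)] at hs
      obtain ⟨K', hK'⟩ : ∃ K', K = K' + 7 := ⟨K - 7, by omega⟩
      have b1 : (2 : ℤ) ^ (K' + 6) < |m₀ j| := by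
        have := h2 j
        rw [← hj, hK'] at this
        exact lt_abs_int_of_chi_ne hη this
      have b2 : |n₀| ≤ 2 ^ (K' + 2) := (abs_int_le_of_chi_ne hη h3).trans
        (pow_le_pow_right₀ (by norm_num) (by omega))
      have b3 : |∑ l ∈ Finset.univ.erase j, m₀ l| ≤ 2 * 2 ^ (K' + 2) := by
        refine (Finset.abs_sum_le_sum_abs _ _).trans ?_
        calc _ ≤ ∑ l ∈ Finset.univ.erase j, (2 : ℤ) ^ (K' + 2) := by
              refine Finset.sum_le_sum fun l hl => ?_
              have := hcon l (Finset.ne_of_mem_erase hl)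
              exact (abs_int_le_of_chi_ne hη (h2 l)).trans
                (pow_le_pow_right₀ (by norm_num) (by omega))
          _ = _ := by simp [Finset.card_erase_of_mem (Finset.mem_univ j)]
      have b4 : |m₀ j| ≤ |n₀| + |∑ l ∈ Finset.univ.erase j, m₀ l| := by
        rw [show m₀ j = n₀ - ∑ l ∈ Finset.univ.erase j, m₀ l by linarith]
        exact abs_sub _ _
      have b5 : (2 : ℤ) ^ (K' + 6) = 16 * 2 ^ (K' + 2) := by rw [pow_add, pow_add]; ring
      have b6 : (0 : ℤ) ≤ 2 ^ (K' + 2) := by positivity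
      linarith
    · exact ⟨j, hji, by omega⟩
  have hSd := spatialBound_dual (d := 1) i q hqi k hb hsum
    fun n m _ h => abs_int_le_of_chi_ne hη (bcoef_ne_zero h).2.2
  have hqm : q ∈ Finset.univ.erase i := Finset.mem_erase.mpr ⟨hqi, Finset.mem_univ q⟩
  rw [prod_rt_pow, Finset.card_erase_of_mem hqm,
    Finset.card_erase_of_mem (Finset.mem_univ i)] at hSd
  have hEp : kk q + ∑ j ∈ (Finset.univ.erase i).erase q, kk j = E :=
    Finset.add_sum_erase _ _ hqm
  set p := ∑ j ∈ (Finset.univ.erase i).erase q, kk j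
  simp only [Finset.card_univ, Fintype.card_fin] at hSd
  refine (hC c₁ c₂ T k t₀ _ kk v A _ K hv hA hSd (by finiteness) hkkK hkK (by omega)
    hres).trans ?_
  calc _ = C * 10 * (rt ^ (2 * k + 4 * K + 6 + ((k + 3) + (p + 3 * (3 - 1 - 1)))) *
        rt⁻¹ ^ (4 * k + 2 * K)) * ∏ j, A j := by
          rw [pow_add rt (2 * k + 4 * K + 6), pow_add rt (k + 3)]; ring
    _ ≤ C * 10 * (rt ^ (36 + 2 * E)) * ∏ j, A j := by
        gcongr; exact rt_pow_mul_inv_pow_le (by omega)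
    _ = C * (10 * rt ^ 36) * rt ^ (2 * E) * ∏ j, A j := by rw [pow_add]; ring
    _ ≤ _ := by gcongr; exact le_add_self

/-! ### Summation over the dyadic blocks. -/

theorem sn_schur {K : ℕ → ℕ → ℝ≥0∞} {A : ℝ≥0∞} (hrow : ∀ k, ∑' l, K k l ≤ A)
    (hcol : ∀ l, ∑' k, K k l ≤ A) (a : ℕ → ℝ≥0∞) : sn (fun k => ∑' l, K k l * a l) ≤ A * sn a := by
  rw [sn_le_iff]
  -- Cauchy-Schwarz with the kernel split as `K^{1/2}·K^{1/2}`; the row sums are used here, the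
  -- column sums after exchanging the summations.
  have h : ∀ k, (∑' l, K k l * a l) ^ 2 ≤ A * ∑' l, K k l * a l ^ 2 := by
    intro k
    have h1 := tsum_mul_le_sn (fun l => K k l ^ (1 / 2 : ℝ)) fun l => K k l ^ (1 / 2 : ℝ) * a l
    have e : ∀ x : ℝ≥0∞, x ^ (1 / 2 : ℝ) * x ^ (1 / 2 : ℝ) = x := fun x => by
      rw [← sq, rpow_half_sq]
    simp_rw [← mul_assoc, e] at h1
    calc _ ≤ (sn (fun l => K k l ^ (1 / 2 : ℝ)) * sn fun l => K k l ^ (1 / 2 : ℝ) * a l) ^ 2 := by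
          gcongr
      _ = (∑' l, K k l) * ∑' l, K k l * a l ^ 2 := by
          rw [mul_pow, sn_sq, sn_sq]; simp_rw [mul_pow, rpow_half_sq]
      _ ≤ _ := by gcongr; exact hrow k
  calc _ ≤ ∑' k, A * ∑' l, K k l * a l ^ 2 := ENNReal.tsum_le_tsum h
    _ = A * ∑' l, (∑' k, K k l) * a l ^ 2 := by
        rw [ENNReal.tsum_mul_left, ENNReal.tsum_comm]; simp_rw [ENNReal.tsum_mul_right]
    _ ≤ A * ∑' l, A * a l ^ 2 := by gcongr with l; exact hcol l
    _ = _ := by rw [ENNReal.tsum_mul_left, mul_pow, sn_sq]; ring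

theorem tsum_mul_prod_erase {α : Type*} {d : ℕ} (i : Fin d) (h : α → ℝ≥0∞)
    (f : Fin d → α → ℝ≥0∞) :
    ∑' x : Fin d → α, h (x i) * ∏ j ∈ Finset.univ.erase i, f j (x j) =
      (∑' x, h x) * ∏ j ∈ Finset.univ.erase i, ∑' x, f j x := by
  have := tsum_prod_eq_prod_tsum fun j => if j = i then h else f j
  rw [← Finset.mul_prod_erase _ _ (Finset.mem_univ i)] at this
  simp_rw [← Finset.mul_prod_erase (Finset.univ : Finset (Fin d)) _ (Finset.mem_univ i)] at this
  simp only [if_true] at this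
  have e : ∀ g : Fin d → α → ℝ≥0∞, ∀ p : (α → ℝ≥0∞) → Fin d → ℝ≥0∞,
      ∏ j ∈ Finset.univ.erase i, p (if j = i then h else g j) j =
        ∏ j ∈ Finset.univ.erase i, p (g j) j := fun g p =>
    Finset.prod_congr rfl fun j hj => by rw [if_neg (Finset.ne_of_mem_erase hj)]
  rw [e f fun φ _ => ∑' x, φ x] at this
  rw [← this]
  congr 1; ext x
  rw [e f fun φ j => φ (x j)]

theorem tsum_geom_mul_le (ρ : ℝ≥0∞) (b : ℕ → ℝ≥0∞) : ∑' l, ρ ^ l * b l ≤ (1 - ρ)⁻¹ * sn b := by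
  rw [← ENNReal.tsum_geometric, ← ENNReal.tsum_mul_right]
  gcongr with l
  exact le_sn b l

/-- Summation of the dyadic blocks. -/
theorem sn_tsum_blocks_le {d : ℕ} (i : Fin d) {ρ : ℝ≥0∞} (hρ : ρ ≤ 1) (hρ0 : ρ ≠ 0)
    {a : ℕ → ℝ≥0∞} {b : Fin d → ℕ → ℝ≥0∞} {g : ℕ → (Fin d → ℕ) → ℝ≥0∞}
    (hg : ∀ k kk, g k kk ≠ 0 → nd k (kk i) ≤ ∑ j ∈ Finset.univ.erase i, kk j + 5)
    (hg' : ∀ k kk, g k kk ≤ a (kk i) * ∏ j ∈ Finset.univ.erase i, (ρ ^ (2 * kk j) * b j (kk j))) :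
    sn (fun k => ∑' kk, g k kk) ≤ ρ⁻¹ ^ 5 * (2 * (1 - ρ)⁻¹) * ((1 - ρ)⁻¹) ^ (d - 1) *
      (sn a * ∏ j ∈ Finset.univ.erase i, sn (b j)) := by
  have hρt : ρ ≠ ⊤ := ne_top_of_le_ne_top ENNReal.one_ne_top hρ
  -- Of each `ρ^{2 kk j}` one factor `ρ^{kk j}` is kept to sum over `kk j`. The others multiply to
  -- `ρ^E`, which the frequency relation `hg` turns into the off-diagonal decay `ρ^{|k - kk i|}`.
  have h1 : ∀ k kk, g k kk ≤ ρ⁻¹ ^ 5 * (ρ ^ nd k (kk i) * a (kk i) *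
      ∏ j ∈ Finset.univ.erase i, (ρ ^ kk j * b j (kk j))) := by
    intro k kk
    by_cases h0 : g k kk = 0
    · rw [h0]; exact zero_le
    have hnd := hg k kk h0
    set E := ∑ j ∈ Finset.univ.erase i, kk j with hE
    have hpow : ρ ^ E ≤ ρ⁻¹ ^ 5 * ρ ^ nd k (kk i) := by
      calc ρ ^ E = (ρ⁻¹ * ρ) ^ 5 * ρ ^ E := by rw [ENNReal.inv_mul_cancel hρ0 hρt]; simp
        _ = ρ⁻¹ ^ 5 * ρ ^ (E + 5) := by rw [mul_pow, pow_add]; ring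
        _ ≤ _ := mul_le_mul' le_rfl (pow_le_pow_right_of_le_one' hρ hnd)
    calc _ ≤ _ := hg' k kk
      _ = ρ ^ E * (a (kk i) * ∏ j ∈ Finset.univ.erase i, (ρ ^ kk j * b j (kk j))) := by
          rw [hE, ← Finset.prod_pow_eq_pow_sum, mul_left_comm, ← Finset.prod_mul_distrib]
          congr 2; ext j; rw [two_mul, pow_add, mul_assoc]
      _ ≤ (ρ⁻¹ ^ 5 * ρ ^ nd k (kk i)) *
          (a (kk i) * ∏ j ∈ Finset.univ.erase i, (ρ ^ kk j * b j (kk j))) := by gcongr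
      _ = _ := by ring
  have hrow : ∀ k, ∑' l, ρ ^ nd k l ≤ 2 * (1 - ρ)⁻¹ := fun k => by
    simp_rw [nd_comm k]; exact tsum_pow_nd_le ρ k
  calc _ ≤ sn (fun k => ρ⁻¹ ^ 5 * ((1 - ρ)⁻¹ ^ (d - 1) * ∏ j ∈ Finset.univ.erase i, sn (b j)) *
          ∑' l, ρ ^ nd k l * a l) := by
        apply sn_mono; intro k
        refine (ENNReal.tsum_le_tsum (h1 k)).trans ?_
        rw [ENNReal.tsum_mul_left, tsum_mul_prod_erase i (fun l => ρ ^ nd k l * a l)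
          fun j l => ρ ^ l * b j l, mul_assoc (ρ⁻¹ ^ 5), mul_comm (∑' l, _)]
        gcongr
        calc _ ≤ ∏ j ∈ Finset.univ.erase i, ((1 - ρ)⁻¹ * sn (b j)) :=
              Finset.prod_le_prod' fun j _ => tsum_geom_mul_le ρ (b j)
          _ = _ := by
              rw [Finset.prod_mul_distrib, Finset.prod_const,
                Finset.card_erase_of_mem (Finset.mem_univ i)]; simp
    _ ≤ _ := by
        rw [sn_const_mul]
        refine (mul_le_mul_right (sn_schur hrow (fun l => tsum_pow_nd_le ρ l) a) _).trans ?_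
        apply le_of_eq; ring

/-- The dyadic weights `2^{sk}`. -/
def wt (s : ℝ) (k : ℕ) : ℝ≥0∞ := ENNReal.ofReal ((2 : ℝ) ^ (s * k))

theorem wt_ne_top (s : ℝ) (k : ℕ) : wt s k ≠ ⊤ := ENNReal.ofReal_ne_top

theorem wt_ne_zero (s : ℝ) (k : ℕ) : wt s k ≠ 0 := by
  rw [wt, Ne, ENNReal.ofReal_eq_zero, not_le]; positivity

theorem wt_zero (k : ℕ) : wt 0 k = 1 := by simp [wt]

theorem wt_one (k : ℕ) : wt 1 k = 2 ^ k := by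
  rw [wt, one_mul, Real.rpow_natCast, ENNReal.ofReal_pow (by norm_num)]; simp

theorem wt_add (s t : ℝ) (k : ℕ) : wt (s + t) k = wt s k * wt t k := by
  rw [wt, wt, wt, ← ENNReal.ofReal_mul (by positivity), ← Real.rpow_add (by norm_num), add_mul]

theorem wt_sq (s : ℝ) (k : ℕ) : ENNReal.ofReal ((2 : ℝ) ^ (2 * s * (k : ℝ))) = wt s k ^ 2 := by
  rw [wt, ← ENNReal.ofReal_pow (by positivity), ← Real.rpow_natCast, ← Real.rpow_mul (by norm_num)]
  congr 2; push_cast; ring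

theorem wt_eq_pow (s : ℝ) (k : ℕ) : wt s k = ENNReal.ofReal ((2 : ℝ) ^ s) ^ k := by
  rw [wt, ← ENNReal.ofReal_pow (by positivity), ← Real.rpow_natCast, ← Real.rpow_mul (by norm_num)]

theorem wt_mono {s : ℝ} (hs : 0 ≤ s) {k l : ℕ} (h : k ≤ l) : wt s k ≤ wt s l := by
  apply ENNReal.ofReal_le_ofReal
  gcongr
  norm_num

theorem wt_add_right (s : ℝ) (k l : ℕ) : wt s (k + l) = wt s k * wt s l := by
  simp_rw [wt_eq_pow, pow_add]

theorem wt_le_wt {s t : ℝ} (h : s ≤ t) (k : ℕ) : wt s k ≤ wt t k := by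
  apply ENNReal.ofReal_le_ofReal
  gcongr
  norm_num

theorem ofReal_two_rpow_neg_lt {ε : ℝ} (hε : 0 < ε) : ENNReal.ofReal ((2 : ℝ) ^ (-ε)) < 1 := by
  rw [ENNReal.ofReal_lt_one]
  exact Real.rpow_lt_one_of_one_lt_of_neg (by norm_num) (by linarith)

/-! ### The norms on `[-T,T]` and Fourier multipliers. -/

theorem hat_injective {f g : L2T} (h : ∀ n, hat f n = hat g n) : f = g := by
  apply fourierBasis.repr.injective
  ext n
  have := h n
  rw [hat, hat, mul_right_inj' sqrt_two_pi_ne] at this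
  rw [fourierBasis_repr, fourierBasis_repr, this]

/-- The trigonometric polynomial with Fourier coefficients `a(n)`, `|n| ≤ 2^{k+1}`. -/
def trig (k : ℕ) (a : ℤ → ℂ) : L2T :=
  ∑ n ∈ Finset.Icc (-(2 ^ (k + 1)) : ℤ) (2 ^ (k + 1)),
    (a n / (Real.sqrt (2 * Real.pi) : ℂ)) • fourierLp 2 n

theorem hat_trig (k : ℕ) (a : ℤ → ℂ) (n : ℤ) :
    hat (trig k a) n = if |n| ≤ 2 ^ (k + 1) then a n else 0 := by
  rw [trig, hat_sum]
  simp_rw [hat_smul, hat_fourierLp, mul_ite, mul_zero]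
  rw [Finset.sum_ite_eq]
  simp_rw [div_mul_cancel₀ _ sqrt_two_pi_ne, Finset.mem_Icc, abs_le]

theorem proj_eq_trig (η : ℝ → ℝ) (k : ℕ) (a : ℤ → ℂ) :
    proj η k a = trig k fun n => (chi η k n : ℂ) * a n := rfl

theorem continuousOn_trig {k : ℕ} {a : ℝ → ℤ → ℂ} {s : Set ℝ}
    (h : ∀ n, ContinuousOn (fun t => a t n) s) : ContinuousOn (fun t => trig k (a t)) s :=
  continuousOn_finsetSum _ fun n _ => ((h n).div_const _).smul continuousOn_const

theorem continuousOn_hat {f : ℝ → L2T} {s : Set ℝ} (h : ContinuousOn f s) (n : ℤ) :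
    ContinuousOn (fun t => hat (f t) n) s := by
  simp_rw [← hatL_apply]
  exact (hatL n).continuous.comp_continuousOn h

theorem memLp_trig {k : ℕ} {a : ℝ → ℤ → ℂ} {p : ℝ≥0∞} {ν : Measure ℝ}
    (h : ∀ n, MemLp (fun t => a t n) p ν) : MemLp (fun t => trig k (a t)) p ν := by
  refine memLp_finsetSum _ fun n _ => ?_
  have h2 : MemLp (fun t => a t n / (Real.sqrt (2 * Real.pi) : ℂ)) p ν := by
    simp_rw [div_eq_mul_inv]; exact (h n).mul_const _
  exact ((ContinuousLinearMap.toSpanSingleton ℂ (fourierLp 2 n : L2T)).comp_memLp' h2)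

section norms
variable {η : ℝ → ℝ} {c₁ c₂ : ℝ} {k : ℕ} {T s : ℝ}

/-- A multiplier in the spatial frequency commutes with the time windows and with the modulation
cut-offs. -/
theorem normFk_mono {F G : ℝ → L2T} {w : ℤ → ℂ} (hw : ∀ n, ‖w n‖ ≤ 1)
    (h : ∀ t n, hat (G t) n = w n * hat (F t) n) : normFk η c₁ c₂ k G ≤ normFk η c₁ c₂ k F := by
  refine iSup_mono fun t₀ => ?_
  simp_rw [xNorm_eq]
  gcongr with j
  refine ln_mono fun τ n => ?_
  have e : spaceTimeFourier (window η k t₀ G) τ n =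
      w n * spaceTimeFourier (window η k t₀ F) τ n := by
    unfold spaceTimeFourier
    rw [← integral_const_mul]
    congr 1; ext t
    rw [hat_window, hat_window, h]; ring
  rw [e, mul_left_comm, enorm_mul]
  refine mul_le_of_le_one_left' ?_
  rw [← ofReal_norm]; exact ENNReal.ofReal_le_one.mpr (hw n)

theorem normFkT_mono (hη : IsBump η) {u U : ℝ → L2T} {w : ℤ → ℂ} (hw : ∀ n, ‖w n‖ ≤ 1)
    (h : ∀ t n, hat (U t) n = w n * hat (u t) n) :
    normFkT η c₁ c₂ k T (fun t => proj η k (hat (U t))) ≤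
      normFkT η c₁ c₂ k T fun t => proj η k (hat (u t)) := by
  refine le_iInf fun F => le_iInf fun hF => le_iInf fun hext => ?_
  -- Cutting `w` to `|n| ≤ 2^{k+1}` makes the new extension a trigonometric polynomial at each time;
  -- on the support of `χ_k` the cut is invisible.
  set w' : ℤ → ℂ := fun n => if |n| ≤ 2 ^ (k + 1) then w n else 0 with hw'
  set G : ℝ → L2T := fun t => trig k fun n => w n * hat (F t) n with hG
  have hGF : ∀ t n, hat (G t) n = w' n * hat (F t) n := by
    intro t n
    rw [hG, hat_trig, hw']
    dsimp only
    split_ifs <;> simp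
  have hle : normFk η c₁ c₂ k G ≤ normFk η c₁ c₂ k F := by
    refine normFk_mono (fun n => ?_) hGF
    rw [hw']; dsimp only
    split_ifs
    · exact hw n
    · simp
  refine (iInf_le_of_le G <| iInf_le_of_le ⟨⟨?_, fun n hn => ?_⟩, hle.trans_lt hF.2⟩ <|
    iInf_le_of_le ?_ hle)
  · exact memLp_trig fun n => (memLp_hat hF.1.1 n).const_mul _
  · filter_upwards [hF.1.2 n hn] with t ht
    rw [hGF, ht, mul_zero]
  · filter_upwards [hext] with t ht
    apply hat_injective
    intro n
    rw [hGF, ht, hat_proj hη, hat_proj hη, h, hw']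
    dsimp only
    split_ifs with h1
    · ring
    · have : chi η k n = 0 := by
        by_contra h0; exact h1 (abs_int_le_of_chi_ne hη h0)
      simp [this]

theorem normFk_zero : normFk η c₁ c₂ k (fun _ => (0 : L2T)) = 0 := by
  have : ∀ t₀, spaceTimeFourier (window η k t₀ fun _ => (0 : L2T)) = fun _ _ => 0 := by
    intro t₀; ext τ n
    simp [spaceTimeFourier, hat_window, hat_zero]
  simp [normFk, this, xNorm]

theorem normFkT_zero : normFkT η c₁ c₂ k T (fun _ => (0 : L2T)) = 0 := by
  rw [← nonpos_iff_eq_zero]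
  refine (iInf_le_of_le (fun _ => 0) <| iInf_le_of_le ⟨⟨MemLp.zero, fun n _ => ?_⟩, ?_⟩ <|
    iInf_le_of_le ?_ normFk_zero.le)
  · simp [hat_zero]
  · rw [normFk_zero]; simp
  · simp [IsExtension]

theorem normF_eq_sn (u : ℝ → L2T) : normF η c₁ c₂ s T u =
    sn fun k => wt s k * normFkT η c₁ c₂ k T fun t => proj η k (hat (u t)) := by
  simp_rw [normF, sn, mul_pow, wt_sq]

theorem normN_eq_sn (f : ℝ → ℤ → ℂ) : normN η c₁ c₂ s T f =
    sn fun k => wt s k * normNkT η c₁ c₂ k T fun t => proj η k (f t) := by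
  simp_rw [normN, sn, mul_pow, wt_sq]

theorem normFkT_lt_top {u : ℝ → L2T} (h : MemF η c₁ c₂ s T u) (k : ℕ) :
    normFkT η c₁ c₂ k T (fun t => proj η k (hat (u t))) < ⊤ := by
  have h1 := h.2
  rw [normF_eq_sn] at h1
  have h2 := (le_sn (fun k => wt s k * normFkT η c₁ c₂ k T fun t => proj η k (hat (u t))) k).trans_lt h1
  exact (ENNReal.lt_top_of_mul_ne_top_right h2.ne (wt_ne_zero s k))

theorem MemF.mono {s' : ℝ} (hs : s' ≤ s) {u : ℝ → L2T} (h : MemF η c₁ c₂ s T u) :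
    MemF η c₁ c₂ s' T u := by
  refine ⟨h.1, lt_of_le_of_lt ?_ h.2⟩
  rw [normF_eq_sn, normF_eq_sn]
  exact sn_mono fun k => by gcongr; exact wt_le_wt hs k

/-- A single Fourier coefficient is seen by finitely many pieces `P_k u` only. -/
theorem MemF.continuousOn_hat (hη : IsBump η) {u : ℝ → L2T} (h : MemF η c₁ c₂ s T u) (n : ℤ) :
    ContinuousOn (fun t => hat (u t) n) (Icc (-T) T) := by
  obtain ⟨K, hK⟩ : ∃ K : ℕ, |(n : ℝ)| ≤ 2 ^ K := exists_two_pow_ge _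
  have e : ∀ t, hat (u t) n = ∑ k ∈ Finset.range (K + 1), hat (proj η k (hat (u t))) n := by
    intro t
    have h1 := hat_projLE hη K (u t) n
    rw [bump_div_eq_one hη hK] at h1
    rw [projLE, hat_sum] at h1
    rw [h1]; simp
  simp_rw [e]
  exact continuousOn_finsetSum _ fun k _ => FifthMKdV.continuousOn_hat (h.1 k) n

theorem normN_congr {f g : ℝ → ℤ → ℂ} (h : ∀ t ∈ Icc (-T) T, f t = g t) :
    normN η c₁ c₂ s T f = normN η c₁ c₂ s T g := by
  have : ∀ k, normNkT η c₁ c₂ k T (fun t => proj η k (f t)) =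
      normNkT η c₁ c₂ k T (fun t => proj η k (g t)) := by
    intro k
    unfold normNkT
    congr 1; ext F
    congr 1; ext hF
    have e : IsExtension T (fun t => proj η k (f t)) F =
        IsExtension T (fun t => proj η k (g t)) F := by
      unfold IsExtension
      rw [eq_iff_iff, ae_restrict_iff' measurableSet_Icc, ae_restrict_iff' measurableSet_Icc]
      refine eventually_congr (Eventually.of_forall fun t => ?_)
      constructor <;> intro hh ht
      · simpa [h t ht] using hh ht
      · simpa [h t ht] using hh ht
    rw [e]
  simp_rw [normN, this]

end norms

/-! ### Uniformly convergent series of functions of time. -/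

section converges
variable {ι : Type*} {T : ℝ} {f : ι → ℝ → ℂ}

theorem ConvergesOn.summable (h : ConvergesOn T f) {t : ℝ} (ht : t ∈ Icc (-T) T) :
    Summable fun i => ‖f i t‖ := SummableUniformlyOn.summable h ht

theorem ConvergesOn.tendstoUniformlyOn_norm (h : ConvergesOn T f) :
    TendstoUniformlyOn (fun (I : Finset ι) t => ∑ i ∈ I, ‖f i t‖) (fun t => ∑' i, ‖f i t‖) atTop
      (Icc (-T) T) :=
  hasSumUniformlyOn_iff_tendstoUniformlyOn.mp (SummableUniformlyOn.hasSumUniformlyOn h)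

theorem ConvergesOn.tendstoUniformlyOn (h : ConvergesOn T f) :
    TendstoUniformlyOn (fun (I : Finset ι) t => ∑ i ∈ I, f i t) (fun t => ∑' i, f i t) atTop
      (Icc (-T) T) := by
  rw [Metric.tendstoUniformlyOn_iff]
  intro ε hε
  filter_upwards [Metric.tendstoUniformlyOn_iff.mp h.tendstoUniformlyOn_norm ε hε] with I hI t ht
  refine lt_of_le_of_lt ?_ (hI t ht)
  have h1 := h.summable ht
  rw [← h1.of_norm.sum_add_tsum_subtype_compl I, ← h1.sum_add_tsum_subtype_compl I, dist_eq_norm,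
    dist_eq_norm, add_sub_cancel_left, add_sub_cancel_left]
  refine (norm_tsum_le_tsum_norm (h1.subtype _)).trans ?_
  rw [Real.norm_eq_abs]
  exact le_abs_self _

theorem ConvergesOn.continuousOn (h : ConvergesOn T f)
    (hf : ∀ i, ContinuousOn (f i) (Icc (-T) T)) :
    ContinuousOn (fun t => ∑' i, f i t) (Icc (-T) T) :=
  h.tendstoUniformlyOn.continuousOn <| Frequently.of_forall fun I =>
    continuousOn_finsetSum I fun i _ => hf i

/-- The sum of the norms is a uniform limit of continuous functions on a compact interval. The bound
serves as dominating function in time. -/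
theorem ConvergesOn.exists_bound (h : ConvergesOn T f)
    (hf : ∀ i, ContinuousOn (f i) (Icc (-T) T)) :
    ∃ M : ℝ, ∀ t ∈ Icc (-T) T, ∑' i, ‖f i t‖ ≤ M := by
  have hc : ContinuousOn (fun t => ∑' i, ‖f i t‖) (Icc (-T) T) :=
    h.tendstoUniformlyOn_norm.continuousOn <| Frequently.of_forall fun I =>
      continuousOn_finsetSum I fun i _ => (hf i).norm
  obtain ⟨M, hM⟩ := isCompact_Icc.exists_bound_of_continuousOn hc
  exact ⟨M, fun t ht => (le_abs_self _).trans (hM t ht)⟩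

end converges

/-! ### Multilinear forms as sums of blocks. -/

/-- The terms of a multilinear form in the Fourier coefficients. -/
def multiTerm {d : ℕ} (c : ℤ → (Fin d → ℤ) → ℂ) (u : Fin d → ℝ → L2T) (n : ℤ) (m : Fin d → ℤ)
    (t : ℝ) : ℂ := c n m * ∏ j, hat (u j t) (m j)

/-- A multilinear form in the Fourier coefficients. -/
def multi {d : ℕ} (S : ℤ → Set (Fin d → ℤ)) (c : ℤ → (Fin d → ℤ) → ℂ) (u : Fin d → ℝ → L2T)
    (t : ℝ) (n : ℤ) : ℂ := ∑' m : S n, multiTerm c u n m t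

/-- The series of a multilinear form converge. -/
def MultiConverges {d : ℕ} (S : ℤ → Set (Fin d → ℤ)) (c : ℤ → (Fin d → ℤ) → ℂ) (T : ℝ)
    (u : Fin d → ℝ → L2T) : Prop :=
  ∀ n, ConvergesOn T fun (m : S n) t => multiTerm c u n m t

section blocks
variable {η : ℝ → ℝ} {d : ℕ} {S : ℤ → Set (Fin d → ℤ)} {c : ℤ → (Fin d → ℤ) → ℂ}
  {u : Fin d → ℝ → L2T} {T : ℝ}

theorem bump_ne_zero_imp (hη : IsBump η) {R : ℕ} {n : ℤ} (h : η ((n : ℝ) / 2 ^ R) ≠ 0) :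
    |n| ≤ 2 ^ (R + 1) := by
  by_contra! h0
  apply h
  apply bump_div_eq_zero hη
  exact_mod_cast h0

/-- The sum of the blocks with frequencies at most `2^R`. -/
theorem sum_blk_eq_multi (hη : IsBump η) (k R : ℕ) (t : ℝ) (n : ℤ) :
    ∑ kk ∈ Fintype.piFinset fun _ : Fin d => Finset.range (R + 1),
      blk (bcoef η S c k kk) kk (fun j m => (chi η (kk j) m : ℂ) * hat (u j t) m) n =
    (chi η k n : ℂ) * multi S c (fun j t => projLE η R (u j t)) t n := by
  classical
  set Λ : Finset (Fin d → ℤ) := box fun _ => R with hΛ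
  have h1 : ∀ kk ∈ Fintype.piFinset fun _ : Fin d => Finset.range (R + 1),
      blk (bcoef η S c k kk) kk (fun j m => (chi η (kk j) m : ℂ) * hat (u j t) m) n =
      ∑ m ∈ Λ, (if m ∈ S n then (chi η k n : ℂ) * c n m * ∏ j, hat (u j t) (m j) else 0) *
        ∏ j, (chi η (kk j) (m j) : ℂ) := by
    intro kk hkk
    rw [Fintype.mem_piFinset] at hkk
    have hsub : box kk ⊆ Λ := fun m hm => mem_box.mpr fun j => (mem_box.mp hm j).trans
      (pow_le_pow_right₀ (by norm_num) (by have := Finset.mem_range.mp (hkk j); omega))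
    rw [blk, Finset.sum_subset hsub]
    · refine Finset.sum_congr rfl fun m _ => ?_
      by_cases hz : ∀ j, chi η (kk j) (m j) ≠ 0
      · rw [bcoef]
        simp only [hz, and_true, Finset.prod_mul_distrib, ne_eq, not_false_eq_true, implies_true]
        split_ifs <;> ring
      · push Not at hz
        obtain ⟨j, hj⟩ := hz
        rw [Finset.prod_eq_zero (Finset.mem_univ j) (by simp [hj]),
          Finset.prod_eq_zero (f := fun j => (chi η (kk j) (m j) : ℂ)) (Finset.mem_univ j)
            (by simp [hj])]
        simp
    · intro m _ hm
      rw [mem_box] at hm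
      push Not at hm
      obtain ⟨j, hj⟩ := hm
      have : chi η (kk j) (m j) = 0 := by
        by_contra h0; exact hj.not_ge (abs_int_le_of_chi_ne hη h0)
      rw [Finset.prod_eq_zero (Finset.mem_univ j) (by simp [this]), mul_zero]
  rw [Finset.sum_congr rfl h1, Finset.sum_comm]
  simp_rw [← Finset.mul_sum]
  -- Expanding the product of the telescoping sums `Σ_{k≤R} χ_k = η(·/2^R)` yields the symbol of
  -- `P_{≤R}` in every entry.
  have h2 : ∀ m : Fin d → ℤ, ∑ kk ∈ Fintype.piFinset fun _ : Fin d => Finset.range (R + 1),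
      ∏ j, (chi η (kk j) (m j) : ℂ) = ∏ j, (η ((m j : ℝ) / 2 ^ R) : ℂ) := by
    intro m
    rw [← Finset.prod_univ_sum (fun _ => Finset.range (R + 1)) fun j k => (chi η k (m j) : ℂ)]
    refine Finset.prod_congr rfl fun j _ => ?_
    rw [← Complex.ofReal_sum, sum_chi]
  simp_rw [h2]
  rw [multi, tsum_subtype (S n) fun m => multiTerm c (fun j t => projLE η R (u j t)) n m t,
    tsum_eq_sum (s := Λ), Finset.mul_sum]
  · refine Finset.sum_congr rfl fun m _ => ?_
    unfold indicator multiTerm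
    simp_rw [hat_projLE hη, Finset.prod_mul_distrib]
    split_ifs <;> ring
  · intro m hm
    rw [hΛ, mem_box] at hm
    push Not at hm
    obtain ⟨j, hj⟩ := hm
    have : η ((m j : ℝ) / 2 ^ R) = 0 := by
      by_contra h0; exact hj.not_ge (bump_ne_zero_imp hη h0)
    unfold indicator multiTerm
    dsimp only
    rw [Finset.prod_eq_zero (Finset.mem_univ j) (by rw [hat_projLE hη, this]; simp)]
    simp

theorem norm_multiTerm_projLE_le (hη : IsBump η) (R : ℕ) (n : ℤ) (m : Fin d → ℤ) (t : ℝ) :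
    ‖multiTerm c (fun j t => projLE η R (u j t)) n m t‖ ≤ ‖multiTerm c u n m t‖ := by
  unfold multiTerm
  rw [norm_mul, norm_mul, norm_prod, norm_prod]
  gcongr with j
  rw [hat_projLE hη, norm_mul]
  exact mul_le_of_le_one_left (norm_nonneg _) (norm_bump_le hη _)

theorem tendsto_multi_projLE (hη : IsBump η) {n : ℤ} {t : ℝ}
    (h : Summable fun m : S n => ‖multiTerm c u n m t‖) :
    Tendsto (fun R => multi S c (fun j t => projLE η R (u j t)) t n) atTop
      (𝓝 (multi S c u t n)) := by
  refine tendsto_tsum_of_dominated_convergence h (fun m => ?_)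
    (Eventually.of_forall fun R m => norm_multiTerm_projLE_le (c := c) (u := u) hη R n m t)
  have : ∀ᶠ R : ℕ in atTop, ∀ j, hat (projLE η R (u j t)) (m.1 j) = hat (u j t) (m.1 j) := by
    rw [eventually_all]
    intro j
    obtain ⟨K, hK⟩ := exists_two_pow_ge ((m.1 j : ℤ) : ℝ)
    filter_upwards [eventually_ge_atTop K] with R hR
    rw [hat_projLE hη, bump_div_eq_one hη (hK.trans (pow_le_pow_right₀ (by norm_num) hR))]
    simp
  refine tendsto_const_nhds.congr' ?_
  filter_upwards [this] with R hR
  unfold multiTerm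
  simp_rw [hR]

theorem norm_multi_projLE_le (hη : IsBump η) {n : ℤ} {t : ℝ}
    (h : Summable fun m : S n => ‖multiTerm c u n m t‖) (R : ℕ) :
    ‖multi S c (fun j t => projLE η R (u j t)) t n‖ ≤ ∑' m : S n, ‖multiTerm c u n m t‖ := by
  have h1 : Summable fun m : S n => ‖multiTerm c (fun j t => projLE η R (u j t)) n m t‖ :=
    h.of_nonneg_of_le (fun _ => norm_nonneg _) fun m => norm_multiTerm_projLE_le (c := c) (u := u) hη R n m t
  exact (norm_tsum_le_tsum_norm h1).trans
    (h1.tsum_le_tsum (fun m => norm_multiTerm_projLE_le (c := c) (u := u) hη R n m t) h)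

theorem continuousOn_multiTerm (hu : ∀ j m, ContinuousOn (fun t => hat (u j t) m) (Icc (-T) T))
    (n : ℤ) (m : Fin d → ℤ) : ContinuousOn (multiTerm c u n m) (Icc (-T) T) :=
  continuousOn_const.mul (continuousOn_finsetProd _ fun j _ => hu j (m j))

theorem MultiConverges.continuousOn (h : MultiConverges S c T u)
    (hu : ∀ j m, ContinuousOn (fun t => hat (u j t) m) (Icc (-T) T)) (n : ℤ) :
    ContinuousOn (fun t => multi S c u t n) (Icc (-T) T) :=
  (h n).continuousOn fun m => continuousOn_multiTerm hu n m

end blocks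

/-- Used to pass from extensions optimal up to `δ` to the infimum that defines the norm of `F_k(T)`.
-/
theorem le_mul_prod_of_forall_pos {d : ℕ} {X D : ℝ≥0∞} {a : Fin d → ℝ≥0∞} (hD : D ≠ ⊤)
    (ha : ∀ j, a j ≠ ⊤) (h : ∀ δ : ℝ≥0, 0 < δ → X ≤ D * ∏ j, (a j + δ)) : X ≤ D * ∏ j, a j := by
  lift D to ℝ≥0 using hD
  lift a to Fin d → ℝ≥0 using ha
  have h1 : Tendsto (fun δ : ℝ≥0 => ((D * ∏ j, (a j + δ) : ℝ≥0) : ℝ≥0∞)) (𝓝[>] 0)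
      (𝓝 ((D * ∏ j, (a j + 0) : ℝ≥0) : ℝ≥0∞)) := by
    refine ENNReal.tendsto_coe.mpr (Continuous.tendsto ?_ _ |>.mono_left nhdsWithin_le_nhds)
    fun_prop
  have h2 := ge_of_tendsto h1 (b := X) (by
    filter_upwards [self_mem_nhdsWithin] with δ hδ
    simpa using h δ hδ)
  simpa using h2

section blocks
variable {η : ℝ → ℝ} {c₁ c₂ : ℝ} {d : ℕ} {S : ℤ → Set (Fin d → ℤ)} {c : ℤ → (Fin d → ℤ) → ℂ}
  {u : Fin d → ℝ → L2T} {T : ℝ} {C : ℝ≥0∞}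

open Classical in
/-- The bound for the contribution of a block to the norm of `N_k`, in terms of bounds `a j k` for
the pieces of the entries. -/
def blockSize (η : ℝ → ℝ) (S : ℤ → Set (Fin d → ℤ)) (c : ℤ → (Fin d → ℤ) → ℂ) (C : ℝ≥0∞)
    (a : Fin d → ℕ → ℝ≥0∞) (k : ℕ) (kk : Fin d → ℕ) : ℝ≥0∞ :=
  if ∃ n m, bcoef η S c k kk n m ≠ 0 then
    -- With the infimum over `i`, a single quantity can be used with whichever entry is to be
    -- spared.
    C * (⨅ i, ∏ j ∈ Finset.univ.erase i, 2 ^ kk j) * ∏ j, a j (kk j) else 0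

/-- The pieces of the entries. -/
def dyadicPiece (η : ℝ → ℝ) (u : Fin d → ℝ → L2T) (kk : Fin d → ℕ) (j : Fin d) (t : ℝ) (m : ℤ) : ℂ :=
  (chi η (kk j) m : ℂ) * hat (u j t) m

/-- Near-optimal extensions of the pieces supply the local representations, and the block bound is
applied with the index attaining the infimum. If all coefficients vanish, so does the block. -/
theorem xNorm_blkT_piece_le [Nonempty (Fin d)] (hη : IsBump η) (hC : BlockBoundWith η c₁ c₂ S c C)
    (hCt : C ≠ ⊤)
    (hu : ∀ j k, ContinuousOn (fun t => proj η k (hat (u j t))) (Icc (-T) T))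
    (ha : ∀ j k, normFkT η c₁ c₂ k T (fun t => proj η k (hat (u j t))) < ⊤) (k : ℕ) (t₀ : ℝ)
    (kk : Fin d → ℕ) :
    xNorm η c₁ c₂ (modInv c₁ c₂ k fun τ n =>
      ft (fun t => blkT η T k t₀ (bcoef η S c k kk) kk (dyadicPiece η u kk) t n) τ) ≤
    blockSize η S c C (fun j k => normFkT η c₁ c₂ k T (fun t => proj η k (hat (u j t)))) k kk := by
  unfold blockSize
  split_ifs with h0
  · obtain ⟨i, hi⟩ := exists_eq_ciInf_of_finite
      (f := fun i => ∏ j ∈ Finset.univ.erase i, (2 : ℝ≥0∞) ^ kk j)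
    rw [← hi]
    refine le_mul_prod_of_forall_pos ?_ (fun j => (ha j (kk j)).ne) fun δ hδ => ?_
    · exact ENNReal.mul_ne_top hCt (ENNReal.prod_ne_top fun j _ => by finiteness)
    have hF : ∀ j, ∃ F, MemFk η c₁ c₂ (kk j) F ∧
        IsExtension T (fun t => proj η (kk j) (hat (u j t))) F ∧ normFk η c₁ c₂ (kk j) F <
          normFkT η c₁ c₂ (kk j) T (fun t => proj η (kk j) (hat (u j t))) + δ := by
      intro j
      have h1 := ENNReal.lt_add_right (ha j (kk j)).ne (ENNReal.coe_pos.mpr hδ).ne'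
      conv_lhs at h1 => rw [normFkT]
      simp only [iInf_lt_iff] at h1
      obtain ⟨F, hF, hext, hlt⟩ := h1
      exact ⟨F, hF, hext, hlt⟩
    choose F hF hext hlt using hF
    refine (hC T k t₀ kk _ _ (fun j t₀ => exists_localRep hη (hF j) (hext j) (hu j (kk j)) t₀)
      (fun j => (hF j).2.ne) i).trans ?_
    gcongr with j
    exact (hlt j).le
  · push Not at h0
    have : ∀ n τ, ft (fun t => blkT η T k t₀ (bcoef η S c k kk) kk (dyadicPiece η u kk) t n) τ = 0 := by
      intro n τ
      have e : (fun t => blkT η T k t₀ (bcoef η S c k kk) kk (dyadicPiece η u kk) t n) = fun _ => 0 := by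
        ext t
        simp [blkT, blk, h0]
      rw [e]; simp [ft]
    simp_rw [this]
    simp [xNorm, modInv]

theorem integrable_indicator_bump_mul (hη : IsBump η) {g : ℝ → ℂ}
    (hg : ContinuousOn g (Icc (-T) T)) (w t₀ : ℝ) :
    Integrable ((Ioo (-T) T).indicator fun t => (η (w * (t - t₀)) : ℂ) * g t) := by
  rw [integrable_indicator_iff measurableSet_Ioo]
  have h1 : Continuous fun t => (η (w * (t - t₀)) : ℂ) := by
    have := hη.smooth.continuous; fun_prop
  exact (h1.continuousOn.mul hg).integrableOn_Icc.mono_set Ioo_subset_Icc_self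

/-- The finitely many blocks with `kk j ≤ R` add up to the form with all entries truncated by
`P_{≤R}`. Absolute convergence gives the limit `R → ∞` at each time and `exists_bound` dominates it,
so the triangle inequality passes to infinitely many blocks. -/
theorem enorm_ft_multi_le (hη : IsBump η)
    (hu : ∀ j m, ContinuousOn (fun t => hat (u j t) m) (Icc (-T) T))
    (hconv : MultiConverges S c T u) (k : ℕ) (t₀ τ : ℝ) (n : ℤ) :
    ‖ft ((Ioo (-T) T).indicator fun t => (η (2 ^ (2 * k) * (t - t₀)) : ℂ) *
      ((chi η k n : ℂ) * multi S c u t n)) τ‖ₑ ≤ ∑' kk : Fin d → ℕ,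
      ‖ft (fun t => blkT η T k t₀ (bcoef η S c k kk) kk (dyadicPiece η u kk) t n) τ‖ₑ := by
  obtain ⟨M, hM⟩ := (hconv n).exists_bound fun m => continuousOn_multiTerm hu n m
  set Φ : ℕ → ℝ → ℂ := fun R => (Ioo (-T) T).indicator fun t => (η (2 ^ (2 * k) * (t - t₀)) : ℂ) *
      ((chi η k n : ℂ) * multi S c (fun j t => projLE η R (u j t)) t n) with hΦ
  have hint : ∀ kk, Integrable fun t =>
      blkT η T k t₀ (bcoef η S c k kk) kk (dyadicPiece η u kk) t n := fun kk =>
    integrable_indicator_bump_mul hη (by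
      refine continuousOn_finsetSum _ fun m _ => continuousOn_const.mul ?_
      exact continuousOn_finsetProd _ fun j _ => continuousOn_const.mul (hu j (m j))) _ _
  have hΦs : ∀ R, Φ R = fun t => ∑ kk ∈ Fintype.piFinset fun _ : Fin d => Finset.range (R + 1),
      blkT η T k t₀ (bcoef η S c k kk) kk (dyadicPiece η u kk) t n := by
    intro R; ext t
    rw [hΦ]
    dsimp only
    unfold blkT
    by_cases ht : t ∈ Ioo (-T) T
    · simp_rw [indicator_of_mem ht]
      rw [← sum_blk_eq_multi hη, Finset.mul_sum]
      rfl
    · simp_rw [indicator_of_notMem ht]; simp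
  have hle : ∀ R, ‖ft (Φ R) τ‖ₑ ≤ ∑' kk : Fin d → ℕ,
      ‖ft (fun t => blkT η T k t₀ (bcoef η S c k kk) kk (dyadicPiece η u kk) t n) τ‖ₑ := by
    intro R
    have e : ft (Φ R) τ = ∑ kk ∈ Fintype.piFinset fun _ : Fin d => Finset.range (R + 1),
        ft (fun t => blkT η T k t₀ (bcoef η S c k kk) kk (dyadicPiece η u kk) t n) τ := by
      rw [hΦs]
      unfold ft
      simp_rw [Finset.mul_sum]
      rw [integral_finsetSum]
      intro kk _
      refine (hint kk).bdd_mul (c := 1) (by fun_prop) (Eventually.of_forall fun t => ?_)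
      rw [norm_exp_neg_I_mul]
    rw [e]
    exact (enorm_sum_le _ _).trans (ENNReal.sum_le_tsum _)
  have hlim : Tendsto (fun R => ft (Φ R) τ) atTop (𝓝 (ft ((Ioo (-T) T).indicator fun t =>
      (η (2 ^ (2 * k) * (t - t₀)) : ℂ) * ((chi η k n : ℂ) * multi S c u t n)) τ)) := by
    refine tendsto_integral_of_dominated_convergence ((Ioo (-T) T).indicator fun _ => M)
      (fun R => ?_) ?_ (fun R => Eventually.of_forall fun t => ?_)
      (Eventually.of_forall fun t => ?_)
    · refine (by fun_prop : Continuous fun t : ℝ =>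
        Complex.exp (-(Complex.I * (t : ℂ) * (τ : ℂ)))).aestronglyMeasurable.mul ?_
      rw [hΦs]
      exact (integrable_finsetSum _ fun kk _ => hint kk).aestronglyMeasurable
    · rw [integrable_indicator_iff measurableSet_Ioo]
      exact integrableOn_const measure_Ioo_lt_top.ne
    · rw [norm_mul, norm_exp_neg_I_mul, one_mul, hΦ]
      dsimp only
      by_cases ht : t ∈ Ioo (-T) T
      · rw [indicator_of_mem ht, indicator_of_mem ht, norm_mul, norm_mul]
        have ht' := Ioo_subset_Icc_self ht
        have h1 := (norm_multi_projLE_le hη ((hconv n).summable ht') R).trans (hM t ht')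
        have h2 : ‖(chi η k n : ℂ)‖ ≤ 1 := by
          rw [Complex.norm_real]; exact abs_chi_le hη _ _
        calc _ ≤ 1 * (1 * M) := by
              gcongr
              exact norm_bump_le hη _
          _ = M := by ring
      · rw [indicator_of_notMem ht, indicator_of_notMem ht]; simp
    · refine Tendsto.const_mul _ ?_
      rw [hΦ]
      dsimp only
      by_cases ht : t ∈ Ioo (-T) T
      · simp_rw [indicator_of_mem ht]
        exact ((tendsto_multi_projLE hη
          ((hconv n).summable (Ioo_subset_Icc_self ht))).const_mul _).const_mul _
      · simp_rw [indicator_of_notMem ht]; exact tendsto_const_nhds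
  exact le_of_tendsto hlim.enorm (Eventually.of_forall hle)

theorem continuousOn_proj_multi (hu : ∀ j m, ContinuousOn (fun t => hat (u j t) m) (Icc (-T) T))
    (hconv : MultiConverges S c T u) (k : ℕ) :
    ContinuousOn (fun t => proj η k (multi S c u t)) (Icc (-T) T) := by
  simp_rw [proj_eq_trig]
  exact continuousOn_trig fun n => continuousOn_const.mul (hconv.continuousOn hu n)

/-- The pieces of a multilinear form are bounded by the sum of the bounds of their blocks. -/
theorem normNkT_multi_le [Nonempty (Fin d)] (hη : IsBump η) (hC : BlockBoundWith η c₁ c₂ S c C)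
    (hCt : C ≠ ⊤)
    (hu : ∀ j k, ContinuousOn (fun t => proj η k (hat (u j t))) (Icc (-T) T))
    (hu' : ∀ j m, ContinuousOn (fun t => hat (u j t) m) (Icc (-T) T))
    (ha : ∀ j k, normFkT η c₁ c₂ k T (fun t => proj η k (hat (u j t))) < ⊤)
    (hconv : MultiConverges S c T u) (k : ℕ)
    (hfin : ∑' kk, blockSize η S c C
      (fun j k => normFkT η c₁ c₂ k T (fun t => proj η k (hat (u j t)))) k kk < ⊤) :
    normNkT η c₁ c₂ k T (fun t => proj η k (multi S c u t)) ≤ ∑' kk, blockSize η S c C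
      (fun j k => normFkT η c₁ c₂ k T (fun t => proj η k (hat (u j t)))) k kk := by
  -- Extension by zero. The blocks `blkT` already carry the sharp cut-off to `(-T,T)`, so no further
  -- estimate is needed.
  set G : ℝ → L2T := (Ioo (-T) T).indicator fun t => proj η k (multi S c u t) with hG
  have hcont := continuousOn_proj_multi (η := η) hu' hconv k
  have hhat : ∀ t n, hat (G t) n =
      (Ioo (-T) T).indicator (fun t => (chi η k n : ℂ) * multi S c u t n) t := by
    intro t n
    rw [hG]
    by_cases ht : t ∈ Ioo (-T) T
    · rw [indicator_of_mem ht, indicator_of_mem ht, hat_proj hη]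
    · rw [indicator_of_notMem ht, indicator_of_notMem ht, hat_zero]
  have hle : normNk η c₁ c₂ k G ≤ ∑' kk, blockSize η S c C
      (fun j k => normFkT η c₁ c₂ k T (fun t => proj η k (hat (u j t)))) k kk := by
    refine iSup_le fun t₀ => ?_
    have h1 : ∀ τ n, ‖spaceTimeFourier (window η k t₀ G) τ n‖ₑ ≤ ∑' kk : Fin d → ℕ,
        ‖ft (fun t => blkT η T k t₀ (bcoef η S c k kk) kk (dyadicPiece η u kk) t n) τ‖ₑ := by
      intro τ n
      refine le_trans (le_of_eq ?_) (enorm_ft_multi_le hη hu' hconv k t₀ τ n)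
      rw [spaceTimeFourier_eq_ft]
      congr 2; ext t
      rw [hat_window, hhat]
      by_cases ht : t ∈ Ioo (-T) T
      · rw [indicator_of_mem ht, indicator_of_mem ht]
      · rw [indicator_of_notMem ht, indicator_of_notMem ht, mul_zero]
    refine (xNorm_modInv_le_tsum hη (fun kk n => ?_) h1).trans
      (ENNReal.tsum_le_tsum fun kk => xNorm_blkT_piece_le hη hC hCt hu ha k t₀ kk)
    refine (continuous_ft (integrable_indicator_bump_mul hη ?_ _ _)).measurable
    refine continuousOn_finsetSum _ fun m _ => continuousOn_const.mul ?_
    exact continuousOn_finsetProd _ fun j _ => continuousOn_const.mul (hu' j (m j))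
  refine (iInf_le_of_le G <| iInf_le_of_le ⟨⟨?_, fun n hn => ?_⟩, hle.trans_lt hfin⟩ <|
    iInf_le_of_le ?_ hle)
  · rw [hG, memLp_indicator_iff_restrict measurableSet_Ioo]
    obtain ⟨M, hM⟩ := isCompact_Icc.exists_bound_of_continuousOn hcont
    have : IsFiniteMeasure ((volume : Measure ℝ).restrict (Ioo (-T) T)) := ⟨by simp⟩
    refine MemLp.of_bound ((hcont.mono Ioo_subset_Icc_self).aestronglyMeasurable
      measurableSet_Ioo) M ?_
    filter_upwards [ae_restrict_mem measurableSet_Ioo] with t ht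
    exact hM t (Ioo_subset_Icc_self ht)
  · refine Eventually.of_forall fun t => ?_
    rw [hhat]
    have : chi η k n = 0 := by
      by_contra h0; exact hn (mem_dyadic_of_chi_ne hη h0)
    simp [this]
  · unfold IsExtension
    rw [← Measure.restrict_congr_set Ioo_ae_eq_Icc]
    filter_upwards [ae_restrict_mem measurableSet_Ioo] with t ht
    rw [hG, indicator_of_mem ht]

end blocks

/-! ### The multilinear estimates. -/

section sums
variable {η : ℝ → ℝ} {c₁ c₂ : ℝ} {d : ℕ} {S : ℤ → Set (Fin d → ℤ)} {c : ℤ → (Fin d → ℤ) → ℂ}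
  {C : ℝ≥0∞}

theorem bcoef_ne_of_blockSize_ne {a : Fin d → ℕ → ℝ≥0∞} {k : ℕ} {kk : Fin d → ℕ}
    (h : blockSize η S c C a k kk ≠ 0) : ∃ n m, bcoef η S c k kk n m ≠ 0 := by
  by_contra h0
  exact h (if_neg h0)

theorem blockSize_le (a : Fin d → ℕ → ℝ≥0∞) (k : ℕ) (kk : Fin d → ℕ) (i : Fin d) :
    blockSize η S c C a k kk ≤
      C * (a i (kk i) * ∏ j ∈ Finset.univ.erase i, (2 ^ kk j * a j (kk j))) := by
  unfold blockSize
  split_ifs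
  · rw [Finset.prod_mul_distrib, ← Finset.mul_prod_erase _ _ (Finset.mem_univ i), mul_left_comm (a i _),
      mul_assoc]
    gcongr
    exact iInf_le _ i
  · exact zero_le

/-- The output frequency of a nonzero block is dominated by that of one of the entries. -/
theorem exists_le_of_bcoef_ne [Nonempty (Fin d)] (hη : IsBump η) (hd : d ≤ 6)
    (hS : ∀ n, ∀ m ∈ S n, ∑ j, m j = n) {k : ℕ} {kk : Fin d → ℕ} {n : ℤ} {m : Fin d → ℤ}
    (h : bcoef η S c k kk n m ≠ 0) : ∃ i, k ≤ kk i + 5 := by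
  obtain ⟨h1, h2, h3⟩ := bcoef_ne_zero h
  obtain ⟨i, -, hi⟩ := Finset.exists_mem_eq_sup Finset.univ Finset.univ_nonempty kk
  refine ⟨i, le_add_of_two_pow_le Finset.univ kk _ (by simp; omega) (fun j _ => ?_) ?_⟩
  · rw [← hi]; exact Finset.le_sup (Finset.mem_univ j)
  · have h4 : |n| ≤ ∑ j, 2 * 2 ^ kk j := by
      rw [← hS n m h1]
      exact (Finset.abs_sum_le_sum_abs _ _).trans
        (Finset.sum_le_sum fun j _ => abs_le_of_chi_ne' hη (h2 j))
    rw [← Finset.mul_sum] at h4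
    linarith [two_pow_le_of_chi_ne hη h3]

/-- The spare decay: with `ρ = 2^{-ε/2}`, the loss of one derivative is `ρ^{2k}` times the weight of
`F^{1+ε}`. -/
theorem pow_mul_wt (ε : ℝ) (k : ℕ) :
    ENNReal.ofReal ((2 : ℝ) ^ (-(ε / 2))) ^ (2 * k) * wt (1 + ε) k = 2 ^ k := by
  rw [mul_comm 2 k, pow_mul, ← wt_eq_pow, sq, ← wt_add, ← wt_add, ← wt_one]
  congr 1; ring

/-- The constant of the summation over the blocks. -/
def sumConst (d : ℕ) (ε : ℝ) : ℝ≥0∞ :=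
  (ENNReal.ofReal ((2 : ℝ) ^ (-(ε / 2))))⁻¹ ^ 5 *
    (2 * (1 - ENNReal.ofReal ((2 : ℝ) ^ (-(ε / 2))))⁻¹) *
    ((1 - ENNReal.ofReal ((2 : ℝ) ^ (-(ε / 2))))⁻¹) ^ (d - 1)

theorem sumConst_ne_top (d : ℕ) {ε : ℝ} (hε : 0 < ε) : sumConst d ε ≠ ⊤ := by
  have h1 := ofReal_two_rpow_neg_lt (half_pos hε)
  have h2 : ENNReal.ofReal ((2 : ℝ) ^ (-(ε / 2))) ≠ 0 := by
    rw [Ne, ENNReal.ofReal_eq_zero, not_le]; positivity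
  have h3 : 1 - ENNReal.ofReal ((2 : ℝ) ^ (-(ε / 2))) ≠ 0 := (tsub_pos_of_lt h1).ne'
  unfold sumConst
  finiteness

/-- The weight `w` sits on the spared entry `i`. It is `1` when that entry is rough and `2^{(1+ε)k}`
in the estimate with all entries smooth. -/
theorem sn_tsum_mul_blockSize_le (hη : IsBump η) (hd : d ≤ 6)
    (hS : ∀ n, ∀ m ∈ S n, ∑ j, m j = n) {ε : ℝ} (hε : 0 < ε) (a : Fin d → ℕ → ℝ≥0∞) (i : Fin d)
    (w : ℕ → ℝ≥0∞) :
    sn (fun k => ∑' kk, w (kk i) * blockSize η S c C a k kk) ≤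
      C * sumConst d ε * (sn (fun l => w l * a i l) *
        ∏ j ∈ Finset.univ.erase i, sn fun l => wt (1 + ε) l * a j l) := by
  have h2 : ENNReal.ofReal ((2 : ℝ) ^ (-(ε / 2))) ≠ 0 := by
    rw [Ne, ENNReal.ofReal_eq_zero, not_le]; positivity
  refine (sn_tsum_blocks_le i (ofReal_two_rpow_neg_lt (half_pos hε)).le h2
    (a := fun l => C * (w l * a i l)) (b := fun j l => wt (1 + ε) l * a j l)
    (fun k kk h => ?_) fun k kk => ?_).trans ?_
  · obtain ⟨n, m, hb⟩ := bcoef_ne_of_blockSize_ne (right_ne_zero_of_mul h)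
    exact nd_le_of_bcoef_ne hη hd hS hb i
  · calc _ ≤ w (kk i) * (C * (a i (kk i) * ∏ j ∈ Finset.univ.erase i, (2 ^ kk j * a j (kk j)))) := by
          gcongr; exact blockSize_le a k kk i
      _ = _ := by
          simp_rw [← mul_assoc (ENNReal.ofReal _ ^ _), pow_mul_wt]; ring
  · rw [sn_const_mul, sumConst]
    apply le_of_eq; ring

/-- The output weight moves to an entry with `k ≤ kk i + 5`. This entry depends on the block, so the
sum over all `i` is taken, which costs the factor `d`. -/
theorem sn_wt_mul_tsum_blockSize_le [Nonempty (Fin d)] (hη : IsBump η) (hd : d ≤ 6)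
    (hS : ∀ n, ∀ m ∈ S n, ∑ j, m j = n) {ε : ℝ} (hε : 0 < ε) (a : Fin d → ℕ → ℝ≥0∞) :
    sn (fun k => wt (1 + ε) k * ∑' kk, blockSize η S c C a k kk) ≤
      d * (wt (1 + ε) 5 * (C * sumConst d ε)) * ∏ j, sn fun l => wt (1 + ε) l * a j l := by
  have h1 : ∀ k, wt (1 + ε) k * ∑' kk, blockSize η S c C a k kk ≤
      ∑ i, wt (1 + ε) 5 * ∑' kk : Fin d → ℕ, wt (1 + ε) (kk i) * blockSize η S c C a k kk := by
    intro k
    simp_rw [← ENNReal.tsum_mul_left]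
    rw [← Summable.tsum_finsetSum fun _ _ => ENNReal.summable]
    refine ENNReal.tsum_le_tsum fun kk => ?_
    by_cases h0 : blockSize η S c C a k kk = 0
    · simp [h0]
    · obtain ⟨n, m, hb⟩ := bcoef_ne_of_blockSize_ne h0
      obtain ⟨i, hi⟩ := exists_le_of_bcoef_ne hη hd hS hb
      refine le_trans ?_ (Finset.single_le_sum (f := fun i => wt (1 + ε) 5 *
        (wt (1 + ε) (kk i) * blockSize η S c C a k kk)) (fun _ _ => zero_le) (Finset.mem_univ i))
      rw [← mul_assoc, ← wt_add_right, add_comm 5]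
      gcongr
      exact wt_mono (by linarith) hi
  calc _ ≤ _ := sn_mono h1
    _ ≤ ∑ i, sn fun k => wt (1 + ε) 5 *
          ∑' kk : Fin d → ℕ, wt (1 + ε) (kk i) * blockSize η S c C a k kk := sn_sum_le _ _
    _ ≤ ∑ _i : Fin d, wt (1 + ε) 5 * (C * sumConst d ε * ∏ j, sn fun l => wt (1 + ε) l * a j l) := by
        refine Finset.sum_le_sum fun i _ => ?_
        rw [sn_const_mul, ← Finset.mul_prod_erase _ _ (Finset.mem_univ i)]
        gcongr
        exact sn_tsum_mul_blockSize_le hη hd hS hε a i _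
    _ = _ := by simp; ring

/-- The estimate of a multilinear form with one entry in `F^0(T)`. -/
theorem multi_normN_zero_le [Nonempty (Fin d)] (hη : IsBump η) (hd : d ≤ 6)
    (hS : ∀ n, ∀ m ∈ S n, ∑ j, m j = n) (hB : BlockBound η c₁ c₂ S c) {ε : ℝ} (hε : 0 < ε) :
    ∃ D : ℝ≥0, ∀ (T : ℝ) (i : Fin d) (u : Fin d → ℝ → L2T), MemF η c₁ c₂ 0 T (u i) →
      (∀ j, j ≠ i → MemF η c₁ c₂ (1 + ε) T (u j)) → MultiConverges S c T u →
      MemN η c₁ c₂ 0 T (multi S c u) ∧ normN η c₁ c₂ 0 T (multi S c u) ≤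
        D * (normF η c₁ c₂ 0 T (u i) *
          ∏ j ∈ Finset.univ.erase i, normF η c₁ c₂ (1 + ε) T (u j)) := by
  obtain ⟨C, hCt, hC⟩ := hB
  have hDt : C * sumConst d ε ≠ ⊤ := ENNReal.mul_ne_top hCt (sumConst_ne_top d hε)
  refine ⟨(C * sumConst d ε).toNNReal, fun T i u hui huj hconv => ?_⟩
  rw [ENNReal.coe_toNNReal hDt]
  have hu0 : ∀ j, MemF η c₁ c₂ 0 T (u j) := fun j => by
    by_cases h : j = i
    · exact h ▸ hui
    · exact (huj j h).mono (by linarith)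
  set a : Fin d → ℕ → ℝ≥0∞ := fun j k => normFkT η c₁ c₂ k T (fun t => proj η k (hat (u j t)))
    with ha
  have hu' : ∀ j m, ContinuousOn (fun t => hat (u j t) m) (Icc (-T) T) :=
    fun j m => (hu0 j).continuousOn_hat hη m
  have hsum : sn (fun k => ∑' kk, blockSize η S c C a k kk) ≤ C * sumConst d ε *
      (normF η c₁ c₂ 0 T (u i) * ∏ j ∈ Finset.univ.erase i, normF η c₁ c₂ (1 + ε) T (u j)) := by
    have := sn_tsum_mul_blockSize_le (S := S) (c := c) (C := C) hη hd hS hε a i fun _ => 1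
    simp_rw [normF_eq_sn, wt_zero]
    simpa using this
  have hfin : C * sumConst d ε *
      (normF η c₁ c₂ 0 T (u i) * ∏ j ∈ Finset.univ.erase i, normF η c₁ c₂ (1 + ε) T (u j)) < ⊤ := by
    refine ENNReal.mul_lt_top hDt.lt_top (ENNReal.mul_lt_top hui.2 ?_)
    exact ENNReal.prod_lt_top fun j hj => (huj j (Finset.ne_of_mem_erase hj)).2
  have hN : normN η c₁ c₂ 0 T (multi S c u) ≤ sn (fun k => ∑' kk, blockSize η S c C a k kk) := by
    rw [normN_eq_sn]
    refine sn_mono fun k => ?_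
    rw [wt_zero, one_mul]
    exact normNkT_multi_le hη hC hCt (fun j => (hu0 j).1) hu' (fun j => normFkT_lt_top (hu0 j))
      hconv k ((le_sn (fun k => ∑' kk, blockSize η S c C a k kk) k).trans_lt (hsum.trans_lt hfin))
  exact ⟨⟨fun k => continuousOn_proj_multi hu' hconv k, (hN.trans hsum).trans_lt hfin⟩,
    hN.trans hsum⟩

/-- The estimate of a multilinear form in `N^s(T)`. -/
theorem multi_normN_le [Nonempty (Fin d)] (hη : IsBump η) (hd : d ≤ 6)
    (hS : ∀ n, ∀ m ∈ S n, ∑ j, m j = n) (hB : BlockBound η c₁ c₂ S c) {s : ℝ} (hs : 1 < s) :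
    ∃ D : ℝ≥0, ∀ (T : ℝ) (u : Fin d → ℝ → L2T), (∀ j, MemF η c₁ c₂ s T (u j)) →
      MultiConverges S c T u →
      MemN η c₁ c₂ s T (multi S c u) ∧ normN η c₁ c₂ s T (multi S c u) ≤
        D * ∏ j, normF η c₁ c₂ s T (u j) := by
  obtain ⟨ε, hε, rfl⟩ : ∃ ε, 0 < ε ∧ s = 1 + ε := ⟨s - 1, by linarith, by ring⟩
  obtain ⟨C, hCt, hC⟩ := hB
  have hst := sumConst_ne_top d hε
  have hDt : d * (wt (1 + ε) 5 * (C * sumConst d ε)) ≠ ⊤ := by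
    have := wt_ne_top (1 + ε) 5
    finiteness
  refine ⟨(d * (wt (1 + ε) 5 * (C * sumConst d ε))).toNNReal, fun T u hu hconv => ?_⟩
  rw [ENNReal.coe_toNNReal hDt]
  set a : Fin d → ℕ → ℝ≥0∞ := fun j k => normFkT η c₁ c₂ k T (fun t => proj η k (hat (u j t)))
    with ha
  have hu' : ∀ j m, ContinuousOn (fun t => hat (u j t) m) (Icc (-T) T) :=
    fun j m => (hu j).continuousOn_hat hη m
  have hsum : sn (fun k => wt (1 + ε) k * ∑' kk, blockSize η S c C a k kk) ≤
      d * (wt (1 + ε) 5 * (C * sumConst d ε)) * ∏ j, normF η c₁ c₂ (1 + ε) T (u j) := by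
    simp_rw [normF_eq_sn]
    exact sn_wt_mul_tsum_blockSize_le hη hd hS hε a
  have hfin : d * (wt (1 + ε) 5 * (C * sumConst d ε)) * ∏ j, normF η c₁ c₂ (1 + ε) T (u j) < ⊤ :=
    ENNReal.mul_lt_top hDt.lt_top (ENNReal.prod_lt_top fun j _ => (hu j).2)
  have hN : normN η c₁ c₂ (1 + ε) T (multi S c u) ≤
      sn (fun k => wt (1 + ε) k * ∑' kk, blockSize η S c C a k kk) := by
    rw [normN_eq_sn]
    refine sn_mono fun k => ?_
    gcongr
    refine normNkT_multi_le hη hC hCt (fun j => (hu j).1) hu' (fun j => normFkT_lt_top (hu j))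
      hconv k ?_
    have := (le_sn (fun k => wt (1 + ε) k * ∑' kk, blockSize η S c C a k kk) k).trans_lt
      (hsum.trans_lt hfin)
    exact ENNReal.lt_top_of_mul_ne_top_right this.ne (wt_ne_zero _ k)
  exact ⟨⟨fun k => continuousOn_proj_multi hu' hconv k, (hN.trans hsum).trans_lt hfin⟩,
    hN.trans hsum⟩

end sums

/-! ### Convergence of the defining series. -/

theorem convergesOn_of_tail {ι : Type*} {T : ℝ} {f : ι → ℝ → ℂ}
    (h : ∀ ε : ℝ≥0∞, 0 < ε → ∃ s : Finset ι, ∀ t ∈ Icc (-T) T,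
      ∑' i : {i // i ∉ s}, ‖f i t‖ₑ ≤ ε) : ConvergesOn T f := by
  have hsum : ∀ t ∈ Icc (-T) T, Summable fun i => ‖f i t‖ := by
    intro t ht
    obtain ⟨s, hs⟩ := h 1 one_pos
    refine (s.summable_compl_iff (f := fun i => ‖f i t‖)).mp ?_
    have h1 : ∑' i : {i // i ∉ s}, ‖f i t‖ₑ ≠ ⊤ := ne_top_of_le_ne_top ENNReal.one_ne_top (hs t ht)
    have h2 := ENNReal.summable_toReal h1
    simpa using h2
  refine HasSumUniformlyOn.summableUniformlyOn (g := fun t => ∑' i, ‖f i t‖) ?_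
  rw [hasSumUniformlyOn_iff_tendstoUniformlyOn, Metric.tendstoUniformlyOn_iff]
  intro ε hε
  obtain ⟨s, hs⟩ := h (ENNReal.ofReal (ε / 2)) (by simpa using hε)
  filter_upwards [eventually_ge_atTop s] with I hI t ht
  have h1 := hsum t ht
  rw [← h1.sum_add_tsum_subtype_compl I, dist_eq_norm, add_sub_cancel_left, Real.norm_eq_abs,
    abs_of_nonneg (tsum_nonneg fun _ => norm_nonneg _)]
  refine lt_of_le_of_lt ?_ (half_lt_self hε)
  rw [← ENNReal.ofReal_le_ofReal_iff (half_pos hε).le,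
    ENNReal.ofReal_tsum_of_nonneg (fun _ => norm_nonneg _) (h1.subtype _)]
  simp_rw [ofReal_norm]
  exact (ENNReal.tsum_comp_le_tsum_of_injective
    (f := fun i : {i // i ∉ I} => (⟨i, fun h => i.2 (hI h)⟩ : {i // i ∉ s}))
    (fun i j h => Subtype.ext (congrArg (fun x => x.1) h)) fun i => ‖f i t‖ₑ).trans (hs t ht)

section blocks
variable {η : ℝ → ℝ} {c₁ c₂ : ℝ} {d : ℕ} {T : ℝ}

theorem enorm_le_tsum_dyadicPiece (hη : IsBump η) (z : ℂ) (m : ℤ) :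
    ‖z‖ₑ ≤ ∑' k, ‖(chi η k m : ℂ) * z‖ₑ := by
  obtain ⟨K, hK⟩ := exists_two_pow_ge (m : ℝ)
  have e : z = ∑ k ∈ Finset.range (K + 1), (chi η k m : ℂ) * z := by
    rw [← Finset.sum_mul, ← Complex.ofReal_sum, sum_chi, bump_div_eq_one hη hK]; simp
  calc ‖z‖ₑ = ‖∑ k ∈ Finset.range (K + 1), (chi η k m : ℂ) * z‖ₑ := by rw [← e]
    _ ≤ _ := (enorm_sum_le _ _).trans (ENNReal.sum_le_tsum _)

theorem dyadicPiece_eq_zero (hη : IsBump η) {u : Fin d → ℝ → L2T} {kk : Fin d → ℕ} {m : Fin d → ℤ}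
    (hm : m ∉ box kk) (t : ℝ) : ∏ j, dyadicPiece η u kk j t (m j) = 0 := by
  rw [mem_box] at hm
  push Not at hm
  obtain ⟨j, hj⟩ := hm
  have : chi η (kk j) (m j) = 0 := by
    by_contra h0; exact hj.not_ge (abs_int_le_of_chi_ne hη h0)
  exact Finset.prod_eq_zero (Finset.mem_univ j) (by simp [dyadicPiece, this])

/-- A multilinear form converges as soon as its blocks have summable uniform bounds. -/
theorem convergesOn_multiTerm_of_blocks (hη : IsBump η) (hT : 0 < T) {S : Set (Fin d → ℤ)}
    {c : (Fin d → ℤ) → ℂ} {u : Fin d → ℝ → L2T}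
    (hu : ∀ j m, ContinuousOn (fun t => hat (u j t) m) (Icc (-T) T))
    {D : (Fin d → ℕ) → ℝ≥0∞} (hD : ∑' kk, D kk ≠ ⊤)
    (h : ∀ kk, ∀ t ∈ Ioo (-T) T,
      ∑ m ∈ box kk, ‖S.indicator c m * ∏ j, dyadicPiece η u kk j t (m j)‖ₑ ≤ D kk) :
    ConvergesOn T fun (m : S) t => c m * ∏ j, hat (u j t) (m.1 j) := by
  classical
  set Q : (Fin d → ℕ) → (Fin d → ℤ) → ℝ → ℂ := fun kk m t =>
    S.indicator c m * ∏ j, dyadicPiece η u kk j t (m j) with hQ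
  have h1 : ∀ kk, ∀ t ∈ Icc (-T) T, ∑ m ∈ box kk, ‖Q kk m t‖ₑ ≤ D kk := by
    intro kk t ht
    -- The representations bound the pieces only at interior times; a finite sum of continuous
    -- functions carries the bound to the end points.
    have hcl : closure (Ioo (-T) T) = Icc (-T) T := closure_Ioo (by linarith)
    refine le_on_closure (h kk) ?_ continuousOn_const (hcl ▸ ht)
    rw [hcl]
    refine continuousOn_finsetSum _ fun m _ => ContinuousOn.enorm ?_
    exact continuousOn_const.mul
      (continuousOn_finsetProd _ fun j _ => continuousOn_const.mul (hu j (m j)))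
  have h2 : ∀ kk, ∀ t ∈ Icc (-T) T, ∑' m, ‖Q kk m t‖ₑ ≤ D kk := by
    intro kk t ht
    rw [tsum_eq_sum (s := box kk)]
    · exact h1 kk t ht
    · intro m hm
      rw [hQ]; dsimp only
      rw [dyadicPiece_eq_zero hη hm, mul_zero, enorm_zero]
  have h3 : ∀ (m : S) t, ‖c m * ∏ j, hat (u j t) (m.1 j)‖ₑ ≤ ∑' kk, ‖Q kk m t‖ₑ := by
    intro m t
    rw [hQ]
    dsimp only
    simp_rw [indicator_of_mem m.2, enorm_mul, ENNReal.tsum_mul_left, enorm_finset_prod]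
    gcongr
    calc _ ≤ ∏ j, ∑' k, ‖(chi η k (m.1 j) : ℂ) * hat (u j t) (m.1 j)‖ₑ :=
          Finset.prod_le_prod' fun j _ => enorm_le_tsum_dyadicPiece hη _ _
      _ = _ := (tsum_prod_eq_prod_tsum fun j k => ‖(chi η k (m.1 j) : ℂ) * hat (u j t) (m.1 j)‖ₑ).symm
  refine convergesOn_of_tail fun ε hε => ?_
  obtain ⟨W, hW⟩ := ((tendsto_order.mp (ENNReal.tendsto_tsum_compl_atTop_zero hD)).2 ε hε).exists
  -- A frequency vector outside all boxes of `W` contributes only to blocks outside `W`, whose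
  -- bounds add up to at most `ε`, uniformly in time.
  refine ⟨(W.biUnion box).subtype (· ∈ S), fun t ht => ?_⟩
  calc _ ≤ ∑' m : {m : S // m ∉ (W.biUnion box).subtype (· ∈ S)},
        ∑' kk : {kk // kk ∉ W}, ‖Q kk m.1 t‖ₑ := by
        refine ENNReal.tsum_le_tsum fun m => (h3 m.1 t).trans (le_of_eq ?_)
        refine (Subtype.val_injective.tsum_eq fun kk hkk => ?_).symm
        refine ⟨⟨kk, fun hW => hkk ?_⟩, rfl⟩
        have hm : (m.1 : Fin d → ℤ) ∉ box kk := fun h0 => m.2 (by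
          rw [Finset.mem_subtype, Finset.mem_biUnion]; exact ⟨kk, hW, h0⟩)
        rw [hQ]
        dsimp only
        rw [dyadicPiece_eq_zero hη hm, mul_zero, enorm_zero]
    _ = ∑' kk : {kk // kk ∉ W}, ∑' m : {m : S // m ∉ (W.biUnion box).subtype (· ∈ S)},
        ‖Q kk m.1 t‖ₑ := ENNReal.tsum_comm
    _ ≤ ∑' kk : {kk // kk ∉ W}, D kk := by
        refine ENNReal.tsum_le_tsum fun kk => le_trans ?_ (h2 kk t ht)
        exact ENNReal.tsum_comp_le_tsum_of_injective
          (Subtype.val_injective.comp Subtype.val_injective) fun m => ‖Q kk m t‖ₑ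
    _ ≤ ε := hW.le

theorem sn_dyadicPiece_le (hη : IsBump η) {k : ℕ} {u : ℝ → L2T}
    (hu : ContinuousOn (fun t => proj η k (hat (u t))) (Icc (-T) T)) {t : ℝ} (ht : t ∈ Ioo (-T) T) :
    sn (fun n : ℤ => ‖(chi η k n : ℂ) * hat (u t) n‖ₑ) ≤
      2 * normFkT η c₁ c₂ k T fun t => proj η k (hat (u t)) := by
  rw [← ENNReal.div_le_iff' (by simp) (by simp)]
  refine le_iInf fun F => le_iInf fun hF => le_iInf fun hext => ?_
  rw [ENNReal.div_le_iff' (by simp) (by simp)]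
  exact HasRep.sn_le hη (fun t₀ => exists_localRep hη hF hext hu t₀) ht

/-- Uniform bounds for the blocks of a multilinear form at a fixed output frequency. -/
theorem sum_block_le {d : ℕ} (hη : IsBump η) {n : ℤ} {S : Set (Fin (d + 2) → ℤ)}
    (hS : ∀ m ∈ S, ∑ j, m j = n)
    {c : (Fin (d + 2) → ℤ) → ℂ} {u : Fin (d + 2) → ℝ → L2T}
    (hu : ∀ j k, ContinuousOn (fun t => proj η k (hat (u j t))) (Icc (-T) T))
    {kk : Fin (d + 2) → ℕ} {B : ℝ≥0∞} {i l : Fin (d + 2)} (hil : l ≠ i)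
    (hB : ∀ m ∈ S, (∀ j, chi η (kk j) (m j) ≠ 0) → ‖c m‖ₑ ≤ B) {t : ℝ} (ht : t ∈ Ioo (-T) T) :
    ∑ m ∈ box kk, ‖S.indicator c m * ∏ j, dyadicPiece η u kk j t (m j)‖ₑ ≤
      B * ((∏ j ∈ (Finset.univ.erase i).erase l, rt ^ (kk j + 3)) *
        ∏ j, (2 * normFkT η c₁ c₂ (kk j) T fun t => proj η (kk j) (hat (u j t)))) := by
  set P : Set (Fin (d + 2) → ℤ) := {m | m ∈ S ∧ ∀ j, chi η (kk j) (m j) ≠ 0} with hP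
  set b : ℤ → (Fin (d + 2) → ℤ) → ℂ := fun _ => P.indicator c with hb
  have hPmem : ∀ m, m ∈ P ↔ m ∈ S ∧ ∀ j, chi η (kk j) (m j) ≠ 0 := fun _ => Iff.rfl
  have hbne : ∀ m, b n m ≠ 0 → m ∈ P := by
    intro m hm
    by_contra h0
    exact hm (indicator_of_notMem h0 c)
  calc _ = ∑ m ∈ box kk, ‖b n m‖ₑ * ∏ j, ‖dyadicPiece η u kk j t (m j)‖ₑ := by
        refine Finset.sum_congr rfl fun m _ => ?_
        rw [← enorm_finset_prod, ← enorm_mul]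
        by_cases hz : ∀ j, chi η (kk j) (m j) ≠ 0
        · rw [hb]
          dsimp only
          by_cases hm : m ∈ S
          · rw [indicator_of_mem hm, indicator_of_mem ((hPmem m).mpr ⟨hm, hz⟩)]
          · rw [indicator_of_notMem hm, indicator_of_notMem fun h => hm ((hPmem m).mp h).1]
        · push Not at hz
          obtain ⟨j, hj⟩ := hz
          rw [Finset.prod_eq_zero (Finset.mem_univ j) (by simp [dyadicPiece, hj])]
          simp
    _ ≤ B * conv (fun j m => if |m| ≤ 2 ^ (kk j + 1) then ‖dyadicPiece η u kk j t m‖ₑ else 0) n := by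
        refine sum_box_le_conv (fun m _ => ?_) (fun m _ hm => hS m ((hPmem m).mp (hbne m hm)).1)
          (fun j m => ‖dyadicPiece η u kk j t m‖ₑ)
        by_cases hm : b n m = 0
        · rw [hm]; simp
        · have := hbne m hm
          rw [hb]
          dsimp only
          rw [indicator_of_mem this]
          exact hB m ((hPmem m).mp this).1 ((hPmem m).mp this).2
    _ ≤ B * ((∏ j ∈ (Finset.univ.erase i).erase l, rt ^ (kk j + 3)) *
          ∏ j, sn fun m => if |m| ≤ 2 ^ (kk j + 1) then ‖dyadicPiece η u kk j t m‖ₑ else 0) := by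
        gcongr
        refine conv_le_of_support i l hil _ kk (fun j m h => ?_) n
        by_contra h0; exact h (if_neg h0)
    _ ≤ _ := by
        gcongr with j
        exact (sn_cut_le _ _).trans (sn_dyadicPiece_le hη (hu j (kk j)) ht)

/-- A multilinear form converges if its coefficients are small enough on dyadic blocks. -/
theorem convergesOn_multiTerm {d : ℕ} (hη : IsBump η) (hT : 0 < T) {n : ℤ}
    {S : Set (Fin (d + 2) → ℤ)} (hS : ∀ m ∈ S, ∑ j, m j = n)
    {c : (Fin (d + 2) → ℤ) → ℂ} {u : Fin (d + 2) → ℝ → L2T} (hu : ∀ j, MemF η c₁ c₂ 0 T (u j))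
    {w : Fin (d + 2) → ℕ → ℝ≥0∞} {E : ℝ≥0∞} (hE : E ≠ ⊤)
    (hw : ∀ j, ∑' k, w j k * normFkT η c₁ c₂ k T (fun t => proj η k (hat (u j t))) ≠ ⊤)
    (h : ∀ (kk : Fin (d + 2) → ℕ), ∀ m ∈ S, (∀ j, chi η (kk j) (m j) ≠ 0) →
      ∃ i l, l ≠ i ∧ ∃ B, (∀ m ∈ S, (∀ j, chi η (kk j) (m j) ≠ 0) → ‖c m‖ₑ ≤ B) ∧
        B * ∏ j ∈ (Finset.univ.erase i).erase l, rt ^ (kk j + 3) ≤ E * ∏ j, w j (kk j)) :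
    ConvergesOn T fun (m : S) t => c m * ∏ j, hat (u j t) (m.1 j) := by
  refine convergesOn_multiTerm_of_blocks hη hT (fun j m => (hu j).continuousOn_hat hη m)
    (D := fun kk => E * 2 ^ (d + 2) *
      ∏ j, (w j (kk j) * normFkT η c₁ c₂ (kk j) T fun t => proj η (kk j) (hat (u j t)))) ?_ ?_
  · rw [ENNReal.tsum_mul_left, tsum_prod_eq_prod_tsum fun j k =>
      w j k * normFkT η c₁ c₂ k T fun t => proj η k (hat (u j t))]
    have := ENNReal.prod_ne_top (s := Finset.univ) fun j _ => hw j
    finiteness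
  · intro kk t ht
    by_cases hex : ∃ m ∈ S, ∀ j, chi η (kk j) (m j) ≠ 0
    · obtain ⟨m, hm, hz⟩ := hex
      obtain ⟨i, l, hil, B, hB, hle⟩ := h kk m hm hz
      refine (sum_block_le (c₁ := c₁) (c₂ := c₂) hη hS (fun j => (hu j).1) hil hB ht).trans ?_
      rw [← mul_assoc, Finset.prod_mul_distrib, Finset.prod_mul_distrib]
      refine (mul_le_mul_left hle _).trans (le_of_eq ?_)
      simp
      ring
    · refine le_trans (le_of_eq ?_) zero_le
      refine Finset.sum_eq_zero fun m _ => ?_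
      by_cases hm : m ∈ S
      · push Not at hex
        obtain ⟨j, hj⟩ := hex m hm
        rw [Finset.prod_eq_zero (Finset.mem_univ j) (by simp [dyadicPiece, hj])]
        simp
      · rw [indicator_of_notMem hm]; simp

/-- The excess `2^{-(s-1)k}` is summable, and each `2^{sk}` times the norm of a piece is at most the
full norm. -/
theorem tsum_two_pow_mul_ne_top {s : ℝ} (hs : 1 < s) {u : ℝ → L2T} (hu : MemF η c₁ c₂ s T u) :
    ∑' k, 2 ^ k * normFkT η c₁ c₂ k T (fun t => proj η k (hat (u t))) ≠ ⊤ := by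
  have h1 := ofReal_two_rpow_neg_lt (sub_pos.mpr hs)
  have h2 := hu.2
  rw [normF_eq_sn] at h2
  refine ne_top_of_le_ne_top ?_ (le_trans (le_of_eq ?_) (tsum_geom_mul_le
    (ENNReal.ofReal ((2 : ℝ) ^ (-(s - 1)))) fun k => wt s k *
      normFkT η c₁ c₂ k T fun t => proj η k (hat (u t))))
  · have := (tsub_pos_of_lt h1).ne'
    finiteness
  · congr 1; ext k
    rw [← wt_eq_pow, ← mul_assoc, ← wt_add, ← wt_one]
    congr 2; ring

theorem tsum_inv_rt_pow_mul_ne_top {u : ℝ → L2T} (hu : MemF η c₁ c₂ 0 T u) :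
    ∑' k, rt⁻¹ ^ k * normFkT η c₁ c₂ k T (fun t => proj η k (hat (u t))) ≠ ⊤ := by
  have h2 := hu.2
  rw [normF_eq_sn] at h2
  simp_rw [wt_zero, one_mul] at h2
  refine ne_top_of_le_ne_top ?_ (tsum_geom_mul_le rt⁻¹ fun k =>
    normFkT η c₁ c₂ k T fun t => proj η k (hat (u t)))
  have := (tsub_pos_of_lt rt_inv_lt_one).ne'
  finiteness

/-- Convergence of the cubic nonlinearities. -/
theorem multiConverges_cubic (hη : IsBump η) (hT : 0 < T) {σ : (Fin 3 → ℤ) → ℤ}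
    (hσ : σ = sigma₃ ∨ σ = sigma₄) {s : ℝ} (hs : 1 < s) {u : Fin 3 → ℝ → L2T}
    (hu : ∀ j, MemF η c₁ c₂ s T (u j)) : MultiConverges nonres3 (cubicCoef σ) T u := by
  intro n
  obtain ⟨κ, hκ⟩ : ∃ κ : ℕ, |n| ≤ 2 ^ κ := by
    obtain ⟨κ, hκ⟩ := exists_two_pow_ge (n : ℝ)
    exact ⟨κ, by exact_mod_cast hκ⟩
  have hκ0 : (0 : ℤ) ≤ 2 ^ κ := by positivity
  refine convergesOn_multiTerm (d := 1) hη hT (c := cubicCoef σ n) (sum_nonres3 n)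
    (fun j => (hu j).mono (by linarith)) (w := fun _ k => 2 ^ k) (E := 10 * rt ^ (4 * κ + 19))
    (by have := rt_ne_top; finiteness) (fun j => tsum_two_pow_mul_ne_top hs (hu j)) ?_
  intro kk m hm hz
  have hrel : ∀ i, ∀ E, κ ≤ E → (∀ j ∈ Finset.univ.erase i, kk j ≤ E) → kk i ≤ E + 5 :=
    fun i E hkE hE => le_add_of_sum_eq hη (by norm_num) (by linarith) (sum_nonres3 n m hm) hz i hkE hE
  have hr0 := hrel 0 (κ + max (kk 1) (kk 2)) (by omega) (fun j hj => by
    fin_cases j <;> simp at hj ⊢ <;> omega)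
  have hr1 := hrel 1 (κ + max (kk 0) (kk 2)) (by omega) (fun j hj => by
    fin_cases j <;> simp at hj ⊢ <;> omega)
  have hr2 := hrel 2 (κ + max (kk 0) (kk 1)) (by omega) (fun j hj => by
    fin_cases j <;> simp at hj ⊢ <;> omega)
  set K := max (kk 0) (max (kk 1) (kk 2)) with hK
  have hkkK : ∀ j, kk j ≤ K := fun j => by fin_cases j <;> simp [hK]
  -- As the output frequency is fixed, the two largest entries are comparable up to a constant
  -- depending on `n`. They are kept in `ℓ²` and each pays one derivative for the symbol, of size
  -- `2^{2K}`; the smallest entry `p` costs `2^{kk p/2}`.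
  have hp : ∃ i l p : Fin 3, l ≠ i ∧ (Finset.univ.erase i).erase l = {p} ∧
      2 * K + kk p ≤ kk 0 + kk 1 + kk 2 + κ + 5 := by
    rcases le_total (kk 0) (kk 1) with h01 | h01 <;> rcases le_total (kk 0) (kk 2) with h02 | h02 <;>
      rcases le_total (kk 1) (kk 2) with h12 | h12
    · exact ⟨1, 2, 0, by decide, by decide, by omega⟩
    · exact ⟨1, 2, 0, by decide, by decide, by omega⟩
    · exact ⟨1, 2, 0, by decide, by decide, by omega⟩
    · exact ⟨0, 1, 2, by decide, by decide, by omega⟩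
    · exact ⟨0, 2, 1, by decide, by decide, by omega⟩
    · exact ⟨1, 2, 0, by decide, by decide, by omega⟩
    · exact ⟨0, 2, 1, by decide, by decide, by omega⟩
    · exact ⟨0, 1, 2, by decide, by decide, by omega⟩
  obtain ⟨i, l, p, hil, he, hp⟩ := hp
  refine ⟨i, l, hil, 10 * rt ^ (2 * κ + 4 * K + 6), fun m' _ hz' => ?_, ?_⟩
  · refine enorm_cubicCoef_le hσ (by rw [pow_succ]; linarith) fun j => ?_
    exact (abs_int_le_of_chi_ne hη (hz' j)).trans
      (pow_le_pow_right₀ (by norm_num) (by have := hkkK j; omega))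
  · rw [he, Finset.prod_singleton, prod_two_pow, Fin.sum_univ_three, mul_assoc, mul_assoc, ← pow_add,
      ← pow_add]
    exact mul_le_mul' le_rfl (pow_le_pow_right₀ one_lt_rt.le (by omega))

/-- Convergence of the quintic nonlinearity. -/
theorem multiConverges_quintic (hη : IsBump η) (hT : 0 < T) {s : ℝ} (hs : 1 < s) (i : Fin 5)
    {u : Fin 5 → ℝ → L2T} (hui : MemF η c₁ c₂ 0 T (u i)) (hu : ∀ j, j ≠ i → MemF η c₁ c₂ s T (u j)) :
    MultiConverges nonres5 quinticCoef T u := by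
  intro n
  obtain ⟨κ, hκ⟩ : ∃ κ : ℕ, |n| ≤ 2 ^ κ := by
    obtain ⟨κ, hκ⟩ := exists_two_pow_ge (n : ℝ)
    exact ⟨κ, by exact_mod_cast hκ⟩
  have hκ0 : (0 : ℤ) ≤ 2 ^ κ := by positivity
  have hrt := rt_ne_top
  refine convergesOn_multiTerm (c₁ := c₁) (c₂ := c₂) (d := 3) hη hT (c := quinticCoef n) (sum_nonres5 n) (fun j => ?_)
    (w := fun j k => if j = i then rt⁻¹ ^ k else 2 ^ k)
    (E := ‖quinticCoef n 0‖ₑ * rt ^ (κ + 17)) (by finiteness) (fun j => ?_) ?_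
  · by_cases h : j = i
    · exact h ▸ hui
    · exact (hu j h).mono (by linarith)
  · by_cases h : j = i
    · subst h; simpa using tsum_inv_rt_pow_mul_ne_top hui
    · simpa [h] using tsum_two_pow_mul_ne_top hs (hu j h)
  intro kk m hm hz
  obtain ⟨l, hl⟩ : ∃ l, l ≠ i := exists_ne i
  refine ⟨i, l, hl, ‖quinticCoef n 0‖ₑ, fun m' _ _ => le_rfl, ?_⟩
  have hle : ∀ j ∈ Finset.univ.erase i, kk j ≤ ∑ j ∈ Finset.univ.erase i, kk j :=
    fun j hj => Finset.single_le_sum (f := kk) (fun _ _ => Nat.zero_le _) hj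
  -- An entry in `F^0` is summable only with a decaying weight, here `2^{-kk i/2}`. The sum
  -- condition bounds the compensating factor `2^{kk i/2}` by half a derivative on each of the other
  -- entries, which have it to spare.
  have hrel : kk i ≤ (κ + ∑ j ∈ Finset.univ.erase i, kk j) + 5 :=
    le_add_of_sum_eq hη (by norm_num) (k := κ) (by linarith) (sum_nonres5 n m hm) hz i (by omega)
      fun j hj => by have := hle j hj; omega
  have e : ∏ j, (if j = i then rt⁻¹ ^ kk j else 2 ^ kk j) =
      rt⁻¹ ^ kk i * rt ^ (2 * ∑ j ∈ Finset.univ.erase i, kk j) := by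
    rw [← Finset.mul_prod_erase _ _ (Finset.mem_univ i), if_pos rfl, ← prod_two_pow]
    congr 1
    exact Finset.prod_congr rfl fun j hj => by rw [if_neg (Finset.ne_of_mem_erase hj)]
  rw [e, prod_rt_pow, mul_assoc]
  have hsub : ∑ j ∈ (Finset.univ.erase i).erase l, kk j ≤ ∑ j ∈ Finset.univ.erase i, kk j :=
    Finset.sum_le_sum_of_subset (Finset.erase_subset _ _)
  have hcard : ((Finset.univ.erase i).erase l).card = 3 := by
    rw [Finset.card_erase_of_mem (Finset.mem_erase.mpr ⟨hl, Finset.mem_univ l⟩),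
      Finset.card_erase_of_mem (Finset.mem_univ i)]; simp
  rw [hcard]
  set E := ∑ j ∈ Finset.univ.erase i, kk j
  set E' := ∑ j ∈ (Finset.univ.erase i).erase l, kk j
  gcongr
  calc rt ^ (E' + 3 * 3) = rt ^ (E' + 3 * 3) * (rt ^ kk i * rt⁻¹ ^ kk i) := by
        rw [rt_pow_mul_inv, mul_one]
    _ = rt ^ (E' + 3 * 3 + kk i) * rt⁻¹ ^ kk i := by rw [pow_add]; ring
    _ ≤ rt ^ (κ + 17 + 2 * E) * rt⁻¹ ^ kk i := by
        exact mul_le_mul' (pow_le_pow_right₀ one_lt_rt.le (by omega)) le_rfl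
    _ = _ := by rw [pow_add]; ring

end blocks

/-! ### The nonlinearities as multilinear forms. -/

theorem cubicTerm_eq (σ : (Fin 3 → ℤ) → ℤ) (u : Fin 3 → ℝ → L2T) (n : ℤ) (m : Fin 3 → ℤ) :
    cubicTerm σ u n m = multiTerm (cubicCoef σ) u n m := by
  ext t
  rw [cubicTerm, multiTerm, cubicCoef]; ring

theorem cubicNonres_eq_multi (σ : (Fin 3 → ℤ) → ℤ) (u : Fin 3 → ℝ → L2T) :
    cubicNonres σ u = multi nonres3 (cubicCoef σ) u := by
  ext t n
  simp_rw [cubicNonres, multi, cubicTerm_eq]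

theorem cubicConverges_iff {σ : (Fin 3 → ℤ) → ℤ} {T : ℝ} {u : Fin 3 → ℝ → L2T} :
    CubicConverges σ T u ↔ MultiConverges nonres3 (cubicCoef σ) T u := by
  unfold CubicConverges MultiConverges
  simp_rw [← cubicTerm_eq]

theorem N₁_eq_multi (u : Fin 3 → ℝ → L2T) : N₁ u = multi resSet resCoef u := by
  ext t n
  rw [N₁, multi, tsum_subtype (resSet n) fun m => multiTerm resCoef u n m t,
    tsum_eq_single ![n, -n, n]]
  · rw [indicator_of_mem (show ![n, -n, n] ∈ resSet n from mem_singleton _), multiTerm, resCoef, Fin.prod_univ_three]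
    rfl
  · intro m hm
    exact indicator_of_notMem (fun h => hm (mem_singleton_iff.mp h)) _

theorem multiConverges_res (T : ℝ) (u : Fin 3 → ℝ → L2T) : MultiConverges resSet resCoef T u := by
  intro n
  have : Finite (resSet n) := (finite_singleton _).to_subtype
  have := Fintype.ofFinite (resSet n)
  refine convergesOn_of_tail fun ε _ => ⟨Finset.univ, fun t _ => ?_⟩
  have : IsEmpty {i // i ∉ (Finset.univ : Finset (resSet n))} := ⟨fun i => i.2 (Finset.mem_univ _)⟩
  simp

/-! ### Frequency truncation and the Cauchy property. -/

section multiplier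
variable {η : ℝ → ℝ} {c₁ c₂ s T : ℝ} {u U : ℝ → L2T} {w : ℤ → ℂ}

theorem continuousOn_proj_of_multiplier (hη : IsBump η)
    (h : ∀ t n, hat (U t) n = w n * hat (u t) n) {k : ℕ}
    (hu : ContinuousOn (fun t => proj η k (hat (u t))) (Icc (-T) T)) :
    ContinuousOn (fun t => proj η k (hat (U t))) (Icc (-T) T) := by
  have e : ∀ t, proj η k (hat (U t)) = trig k fun n => w n * hat (proj η k (hat (u t))) n := by
    intro t
    rw [proj_eq_trig]
    congr 1; ext n
    rw [h, hat_proj hη]; ring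
  simp_rw [e]
  exact continuousOn_trig fun n => continuousOn_const.mul (continuousOn_hat hu n)

theorem normF_multiplier_le (hη : IsBump η) (hw : ∀ n, ‖w n‖ ≤ 1)
    (h : ∀ t n, hat (U t) n = w n * hat (u t) n) :
    normF η c₁ c₂ s T U ≤ normF η c₁ c₂ s T u := by
  rw [normF_eq_sn, normF_eq_sn]
  exact sn_mono fun k => by gcongr; exact normFkT_mono hη hw h

theorem MemF.multiplier (hη : IsBump η) (hu : MemF η c₁ c₂ s T u) (hw : ∀ n, ‖w n‖ ≤ 1)
    (h : ∀ t n, hat (U t) n = w n * hat (u t) n) : MemF η c₁ c₂ s T U :=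
  ⟨fun k => continuousOn_proj_of_multiplier hη h (hu.1 k), (normF_multiplier_le hη hw h).trans_lt hu.2⟩

theorem normFkT_multiplier_eq_zero (h : ∀ t n, hat (U t) n = w n * hat (u t) n) {k : ℕ}
    (hk : ∀ n : ℤ, chi η k n ≠ 0 → w n = 0) :
    normFkT η c₁ c₂ k T (fun t => proj η k (hat (U t))) = 0 := by
  have e : ∀ t, proj η k (hat (U t)) = 0 := by
    intro t
    rw [proj_eq_trig]
    refine Finset.sum_eq_zero fun n _ => ?_
    dsimp only
    rw [h]
    by_cases h0 : chi η k n = 0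
    · simp [h0]
    · simp [hk n h0]
  simp_rw [e]
  exact normFkT_zero

/-- Band-limited multipliers map `F^s(T)` to all other spaces of the scale. -/
theorem MemF.multiplier_bandlimited (hη : IsBump η) (hu : MemF η c₁ c₂ s T u) (hw : ∀ n, ‖w n‖ ≤ 1)
    (h : ∀ t n, hat (U t) n = w n * hat (u t) n) {K : ℕ} (hK : ∀ n, w n ≠ 0 → |n| ≤ 2 ^ K)
    (s' : ℝ) : MemF η c₁ c₂ s' T U := by
  refine ⟨(hu.multiplier hη hw h).1, ?_⟩
  rw [normF_eq_sn, sn, tsum_eq_sum (s := Finset.range (K + 1))]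
  · refine ENNReal.rpow_lt_top_of_nonneg (by norm_num) (ENNReal.sum_lt_top.mpr fun k _ => ?_).ne
    have h1 := normFkT_lt_top (hu.multiplier hη hw h) k
    have h2 := wt_ne_top s' k
    finiteness
  · intro k hk
    rw [Finset.mem_range, not_lt] at hk
    rw [normFkT_multiplier_eq_zero h]
    · simp
    · intro n hn
      by_contra h0
      obtain ⟨k, rfl⟩ : ∃ k', k = k' + 1 := ⟨k - 1, by omega⟩
      have h1 := lt_abs_int_of_chi_ne hη hn
      have h2 : (2 : ℤ) ^ K ≤ 2 ^ k := pow_le_pow_right₀ (by norm_num) (by omega)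
      linarith [hK n h0]

end multiplier

theorem exists_sn_tail_le {a : ℕ → ℝ≥0∞} (ha : sn a < ⊤) {δ : ℝ≥0∞} (hδ : 0 < δ) :
    ∃ K₀ : ℕ, sn (fun k => if k < K₀ then 0 else a k) ≤ δ := by
  have h1 : ∑' k, a k ^ 2 ≠ ⊤ := by rw [← sn_sq]; finiteness
  obtain ⟨K₀, hK₀⟩ := ((tendsto_order.mp (ENNReal.tendsto_sum_nat_add _ h1)).2 (δ ^ 2)
    (pos_iff_ne_zero.mpr (pow_ne_zero 2 hδ.ne'))).exists
  refine ⟨K₀, sn_le_iff.mpr (le_trans (le_of_eq ?_) hK₀.le)⟩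
  rw [← (add_left_injective K₀).tsum_eq]
  · congr 1; ext k; simp
  · intro k hk
    refine ⟨k - K₀, Nat.sub_add_cancel ?_⟩
    by_contra! h0
    exact hk (by simp [h0])

section cubic
variable {η : ℝ → ℝ} {c₁ c₂ T : ℝ} {σ : (Fin 3 → ℤ) → ℤ} {u : Fin 3 → ℝ → L2T} {i : Fin 3}

theorem prod_erase_update {M : Type*} [CommMonoid M] {d : ℕ} {α : Type*} (i : Fin d) (u : Fin d → α)
    (U : α) (f : α → M) :
    ∏ j ∈ Finset.univ.erase i, f (Function.update u i U j) = ∏ j ∈ Finset.univ.erase i, f (u j) :=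
  Finset.prod_congr rfl fun j hj => by rw [Function.update_of_ne (Finset.ne_of_mem_erase hj)]

/-- The form is linear in the entry `i`; termwise subtraction is where both convergence hypotheses
enter. -/
theorem cubicNonres_update_sub (V W : ℝ → L2T) (hV : CubicConverges σ T (Function.update u i V))
    (hW : CubicConverges σ T (Function.update u i W)) {t : ℝ} (ht : t ∈ Icc (-T) T) :
    (cubicNonres σ (Function.update u i V) - cubicNonres σ (Function.update u i W)) t =
      cubicNonres σ (Function.update u i fun t => V t - W t) t := by
  ext n
  simp only [Pi.sub_apply, cubicNonres]
  rw [← ((hV n).summable ht).of_norm.tsum_sub ((hW n).summable ht).of_norm]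
  congr 1; ext m
  have e : ∀ X : ℝ → L2T, ∏ j, hat (Function.update u i X j t) (m.1 j) =
      hat (X t) (m.1 i) * ∏ j ∈ Finset.univ.erase i, hat (u j t) (m.1 j) := by
    intro X
    rw [← Finset.mul_prod_erase _ _ (Finset.mem_univ i), Function.update_self]
    congr 1
    exact Finset.prod_congr rfl fun j hj => by
      rw [Function.update_of_ne (Finset.ne_of_mem_erase hj)]
  simp only [cubicTerm, e, hat_sub]
  ring

/-- The cubic nonlinearities with a frequency-truncated entry. -/
theorem cubicConverges_update (hη : IsBump η) (hT : 0 < T) (hσ : σ = sigma₃ ∨ σ = sigma₄) {ε : ℝ}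
    (hε : 0 < ε) (hui : MemF η c₁ c₂ 0 T (u i)) (hu : ∀ j, j ≠ i → MemF η c₁ c₂ (1 + ε) T (u j))
    {U : ℝ → L2T} {w : ℤ → ℂ} (hw : ∀ n, ‖w n‖ ≤ 1) (h : ∀ t n, hat (U t) n = w n * hat (u i t) n)
    {K : ℕ} (hK : ∀ n, w n ≠ 0 → |n| ≤ 2 ^ K) :
    CubicConverges σ T (Function.update u i U) := by
  rw [cubicConverges_iff]
  -- A band-limited entry of `F^0` lies in every `F^s`, so convergence follows from the case of
  -- smooth entries, while the bounds keep using its `F^0` norm.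
  refine multiConverges_cubic hη hT hσ (c₁ := c₁) (c₂ := c₂) (s := 1 + ε) (by linarith) fun j => ?_
  by_cases hj : j = i
  · subst hj
    rw [Function.update_self]
    exact hui.multiplier_bandlimited hη hw h hK _
  · rw [Function.update_of_ne hj]
    exact hu j hj

theorem norm_bump_sub_le (hη : IsBump η) (x y : ℝ) : ‖(η x : ℂ) - (η y : ℂ)‖ ≤ 1 := by
  rw [← Complex.ofReal_sub, Complex.norm_real, Real.norm_eq_abs, abs_le]
  have h1 := hη.mem_Icc x
  have h2 := hη.mem_Icc y
  constructor <;> linarith [h1.1, h1.2, h2.1, h2.2]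

theorem cubicConverges_truncAt (hη : IsBump η) (hT : 0 < T) (hσ : σ = sigma₃ ∨ σ = sigma₄) {ε : ℝ}
    (hε : 0 < ε) (hui : MemF η c₁ c₂ 0 T (u i)) (hu : ∀ j, j ≠ i → MemF η c₁ c₂ (1 + ε) T (u j))
    (K : ℕ) : CubicConverges σ T (truncAt η i K u) :=
  cubicConverges_update hη hT hσ hε hui hu (w := fun n => (η ((n : ℝ) / 2 ^ K) : ℂ)) (K := K + 1)
    (fun n => norm_bump_le hη _) (fun t n => hat_projLE hη K (u i t) n)
    fun n hn => bump_ne_zero_imp hη (by simpa using hn)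

/-- The bounds for the cubic nonlinearities with one entry in `F^0(T)`. -/
theorem cubic_normN_zero_le (hη : IsBump η) (hc₁ : 0 ≤ c₁) (hσ : σ = sigma₃ ∨ σ = sigma₄) {ε : ℝ}
    (hε : 0 < ε) : ∃ D : ℝ≥0, ∀ (T : ℝ), 0 < T → ∀ (i : Fin 3) (u : Fin 3 → ℝ → L2T),
      MemF η c₁ c₂ 0 T (u i) → (∀ j, j ≠ i → MemF η c₁ c₂ (1 + ε) T (u j)) →
      (CubicConverges σ T u → MemN η c₁ c₂ 0 T (cubicNonres σ u) ∧
        normN η c₁ c₂ 0 T (cubicNonres σ u) ≤ D * (normF η c₁ c₂ 0 T (u i) *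
          ∏ j ∈ Finset.univ.erase i, normF η c₁ c₂ (1 + ε) T (u j))) ∧
      (∀ K : ℕ, CubicConverges σ T (truncAt η i K u) ∧
        MemN η c₁ c₂ 0 T (cubicNonres σ (truncAt η i K u)) ∧
        normN η c₁ c₂ 0 T (cubicNonres σ (truncAt η i K u)) ≤ D * (normF η c₁ c₂ 0 T (u i) *
          ∏ j ∈ Finset.univ.erase i, normF η c₁ c₂ (1 + ε) T (u j))) ∧
      (∀ δ : ℝ≥0∞, 0 < δ → ∃ K₀ : ℕ, ∀ K L : ℕ, K₀ ≤ K → K₀ ≤ L →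
        normN η c₁ c₂ 0 T
          (cubicNonres σ (truncAt η i K u) - cubicNonres σ (truncAt η i L u)) ≤ δ) := by
  obtain ⟨D, hD⟩ := multi_normN_zero_le hη (by norm_num) sum_nonres3
    (blockBound_cubic hη hc₁ c₂ hσ) hε
  refine ⟨D, fun T hT i u hui hu => ?_⟩
  have hupd : ∀ U : ℝ → L2T, MemF η c₁ c₂ 0 T U → CubicConverges σ T (Function.update u i U) →
      MemN η c₁ c₂ 0 T (cubicNonres σ (Function.update u i U)) ∧
      normN η c₁ c₂ 0 T (cubicNonres σ (Function.update u i U)) ≤ D * (normF η c₁ c₂ 0 T U *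
          ∏ j ∈ Finset.univ.erase i, normF η c₁ c₂ (1 + ε) T (u j)) := by
    intro U hU hconv
    have := hD T i (Function.update u i U) (by rwa [Function.update_self])
      (fun j hj => by rw [Function.update_of_ne hj]; exact hu j hj) (cubicConverges_iff.mp hconv)
    rw [Function.update_self, prod_erase_update i u U fun v => normF η c₁ c₂ (1 + ε) T v] at this
    rwa [cubicNonres_eq_multi]
  have htr := cubicConverges_truncAt (σ := σ) hη hT hσ hε hui hu
  refine ⟨fun hconv => ?_, fun K => ⟨htr K, ?_⟩, fun δ hδ => ?_⟩
  · have := hupd (u i) hui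
    rw [Function.update_eq_self] at this
    exact this hconv
  · have hw : ∀ n : ℤ, ‖(η ((n : ℝ) / 2 ^ K) : ℂ)‖ ≤ 1 := fun n => norm_bump_le hη _
    have hU : ∀ t n, hat (projLE η K (u i t)) n = (η ((n : ℝ) / 2 ^ K) : ℂ) * hat (u i t) n :=
      fun t n => hat_projLE hη K (u i t) n
    obtain ⟨h1, h2⟩ := hupd _ (hui.multiplier hη hw hU) (htr K)
    refine ⟨h1, h2.trans ?_⟩
    gcongr
    exact normF_multiplier_le hη hw hU
  -- The difference of two truncations at levels beyond `K₀` is the multiplier `w`, which vanishes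
  -- for `|n| ≤ 2^{K₀}`. Its `F^0` norm is at most a tail of that of `u i`, and the bound for the
  -- form is applied to it.
  · set M := D * ∏ j ∈ Finset.univ.erase i, normF η c₁ c₂ (1 + ε) T (u j) with hM
    have hMt : M ≠ ⊤ := by
      have := ENNReal.prod_lt_top fun j (hj : j ∈ Finset.univ.erase i) =>
        (hu j (Finset.ne_of_mem_erase hj)).2
      rw [hM]; finiteness
    obtain ⟨δ', hδ', hlt⟩ := ENNReal.exists_pos_mul_lt hMt hδ.ne'
    have hsn := hui.2
    rw [normF_eq_sn] at hsn
    obtain ⟨K₀, hK₀⟩ := exists_sn_tail_le hsn hδ'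
    refine ⟨K₀, fun K L hK hL => ?_⟩
    set w : ℤ → ℂ := fun n => (η ((n : ℝ) / 2 ^ K) : ℂ) - (η ((n : ℝ) / 2 ^ L) : ℂ) with hwdef
    set U : ℝ → L2T := fun t => projLE η K (u i t) - projLE η L (u i t) with hUdef
    have hw : ∀ n, ‖w n‖ ≤ 1 := fun n => norm_bump_sub_le hη _ _
    have hU : ∀ t n, hat (U t) n = w n * hat (u i t) n := by
      intro t n
      rw [hUdef, hwdef]
      dsimp only
      rw [hat_sub, hat_projLE hη, hat_projLE hη]; ring
    have hband : ∀ n, w n ≠ 0 → |n| ≤ 2 ^ (max K L + 1) := by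
      intro n hn
      by_cases h1 : η ((n : ℝ) / 2 ^ K) = 0
      · refine (bump_ne_zero_imp hη (R := L) fun h2 => hn ?_).trans
          (pow_le_pow_right₀ (by norm_num) (by omega))
        simp [hwdef, h1, h2]
      · exact (bump_ne_zero_imp hη h1).trans (pow_le_pow_right₀ (by norm_num) (by omega))
    have e : normN η c₁ c₂ 0 T
        (cubicNonres σ (truncAt η i K u) - cubicNonres σ (truncAt η i L u)) =
        normN η c₁ c₂ 0 T (cubicNonres σ (Function.update u i U)) :=
      normN_congr fun t ht => cubicNonres_update_sub _ _ (htr K) (htr L) ht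
    rw [e]
    refine (hupd U (hui.multiplier hη hw hU)
      (cubicConverges_update hη hT hσ hε hui hu hw hU hband)).2.trans (le_trans ?_ hlt.le)
    rw [hM, mul_left_comm]
    gcongr
    rw [normF_eq_sn]
    refine (sn_mono fun k => ?_).trans hK₀
    split_ifs with hk
    · rw [normFkT_multiplier_eq_zero hU, mul_zero]
      intro n hn
      have h1 := abs_int_le_of_chi_ne hη hn
      have h2 : ∀ R : ℕ, K₀ ≤ R → η ((n : ℝ) / 2 ^ R) = 1 := by
        intro R hR
        apply bump_div_eq_one hη
        have h3 : |n| ≤ 2 ^ R := h1.trans (pow_le_pow_right₀ (by norm_num) (by omega))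
        exact_mod_cast h3
      simp [hwdef, h2 K hK, h2 L hL]
    · gcongr
      exact normFkT_mono hη hw hU

end cubic

end FifthMKdV

end

/-! ### Assembly of the estimates. -/

theorem mainTheorem6 (η : ℝ → ℝ) (hη : IsBump η) (c₁ c₂ : ℝ) (hc₁ : 0 ≤ c₁) (hc₂ : 0 ≤ c₂) :
    -- (a)
    (∀ s : ℝ, 1 < s → ∃ C : ℝ≥0, ∀ T : ℝ, 0 < T → T ≤ 1 →
      (∀ u : Fin 3 → ℝ → L2T, (∀ j, MemF η c₁ c₂ s T (u j)) →
        (MemN η c₁ c₂ s T (N₁ u) ∧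
          normN η c₁ c₂ s T (N₁ u) ≤ C * ∏ j, normF η c₁ c₂ s T (u j)) ∧
        (CubicConverges sigma₃ T u ∧ MemN η c₁ c₂ s T (N₃ u) ∧
          normN η c₁ c₂ s T (N₃ u) ≤ C * ∏ j, normF η c₁ c₂ s T (u j)) ∧
        (CubicConverges sigma₄ T u ∧ MemN η c₁ c₂ s T (N₄ u) ∧
          normN η c₁ c₂ s T (N₄ u) ≤ C * ∏ j, normF η c₁ c₂ s T (u j))) ∧
      (∀ v : Fin 5 → ℝ → L2T, (∀ j, MemF η c₁ c₂ s T (v j)) →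
        QuinticConverges T v ∧ MemN η c₁ c₂ s T (N₂ v) ∧
          normN η c₁ c₂ s T (N₂ v) ≤ C * ∏ j, normF η c₁ c₂ s T (v j))) ∧
    -- (b)
    (∀ ε : ℝ, 0 < ε → ∃ C : ℝ≥0, ∀ T : ℝ, 0 < T → T ≤ 1 →
      (∀ (i : Fin 3) (u : Fin 3 → ℝ → L2T), MemF η c₁ c₂ 0 T (u i) →
        (∀ j, j ≠ i → MemF η c₁ c₂ (1 + ε) T (u j)) →
        (MemN η c₁ c₂ 0 T (N₁ u) ∧
          normN η c₁ c₂ 0 T (N₁ u) ≤ C * (normF η c₁ c₂ 0 T (u i) *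
            ∏ j ∈ Finset.univ.erase i, normF η c₁ c₂ (1 + ε) T (u j))) ∧
        (∀ σ : (Fin 3 → ℤ) → ℤ, σ = sigma₃ ∨ σ = sigma₄ →
          -- the bound, whenever the defining series converges
          (CubicConverges σ T u →
            MemN η c₁ c₂ 0 T (cubicNonres σ u) ∧
            normN η c₁ c₂ 0 T (cubicNonres σ u) ≤ C * (normF η c₁ c₂ 0 T (u i) *
              ∏ j ∈ Finset.univ.erase i, normF η c₁ c₂ (1 + ε) T (u j))) ∧
          -- frequency truncations of the rough entry: convergence and the uniform bound
          (∀ K : ℕ, CubicConverges σ T (truncAt η i K u) ∧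
            MemN η c₁ c₂ 0 T (cubicNonres σ (truncAt η i K u)) ∧
            normN η c₁ c₂ 0 T (cubicNonres σ (truncAt η i K u)) ≤
              C * (normF η c₁ c₂ 0 T (u i) *
                ∏ j ∈ Finset.univ.erase i, normF η c₁ c₂ (1 + ε) T (u j))) ∧
          -- the truncations form a Cauchy sequence in `N^0(T)`
          (∀ δ : ℝ≥0∞, 0 < δ → ∃ K₀ : ℕ, ∀ K L : ℕ, K₀ ≤ K → K₀ ≤ L →
            normN η c₁ c₂ 0 T
              (cubicNonres σ (truncAt η i K u) - cubicNonres σ (truncAt η i L u)) ≤ δ))) ∧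
      (∀ (i : Fin 5) (v : Fin 5 → ℝ → L2T), MemF η c₁ c₂ 0 T (v i) →
        (∀ j, j ≠ i → MemF η c₁ c₂ (1 + ε) T (v j)) →
        QuinticConverges T v ∧ MemN η c₁ c₂ 0 T (N₂ v) ∧
          normN η c₁ c₂ 0 T (N₂ v) ≤ C * (normF η c₁ c₂ 0 T (v i) *
            ∏ j ∈ Finset.univ.erase i, normF η c₁ c₂ (1 + ε) T (v j)))) := by
  have hres := blockBound_res hη c₁ c₂
  have hquint := blockBound_quintic hη c₁ c₂
  have hcub : ∀ σ, σ = sigma₃ ∨ σ = sigma₄ → BlockBound η c₁ c₂ nonres3 (cubicCoef σ) :=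
    fun σ hσ => blockBound_cubic hη hc₁ c₂ hσ
  have hle : ∀ {D C : ℝ≥0} {X Y : ℝ≥0∞}, X ≤ D * Y → D ≤ C → X ≤ C * Y := fun h hDC =>
    h.trans (by gcongr)
  constructor
  · intro s hs
    obtain ⟨D₁, h₁⟩ := multi_normN_le hη (by norm_num) sum_resSet hres hs
    obtain ⟨D₂, h₂⟩ := multi_normN_le hη (by norm_num) sum_nonres5 hquint hs
    obtain ⟨D₃, h₃⟩ := multi_normN_le hη (by norm_num) sum_nonres3 (hcub sigma₃ (Or.inl rfl)) hs
    obtain ⟨D₄, h₄⟩ := multi_normN_le hη (by norm_num) sum_nonres3 (hcub sigma₄ (Or.inr rfl)) hs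
    refine ⟨D₁ ⊔ D₂ ⊔ (D₃ ⊔ D₄), fun T hT _ => ⟨fun u hu => ⟨?_, ?_, ?_⟩, fun v hv => ?_⟩⟩
    · rw [N₁_eq_multi]
      obtain ⟨h, h'⟩ := h₁ T u hu (multiConverges_res T u)
      exact ⟨h, hle h' (le_sup_left.trans le_sup_left)⟩
    · have hconv := multiConverges_cubic hη hT (Or.inl rfl) hs hu
      obtain ⟨h, h'⟩ := h₃ T u hu hconv
      rw [N₃, cubicNonres_eq_multi]
      exact ⟨cubicConverges_iff.mpr hconv, h, hle h' (le_sup_left.trans le_sup_right)⟩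
    · have hconv := multiConverges_cubic hη hT (Or.inr rfl) hs hu
      obtain ⟨h, h'⟩ := h₄ T u hu hconv
      rw [N₄, cubicNonres_eq_multi]
      exact ⟨cubicConverges_iff.mpr hconv, h, hle h' (le_sup_right.trans le_sup_right)⟩
    -- As `F^s ⊂ F^0`, any entry, here entry `0`, may be regarded as the rough one.
    · have hconv := multiConverges_quintic hη hT hs 0 ((hv 0).mono (by linarith)) fun j _ => hv j
      obtain ⟨h, h'⟩ := h₂ T v hv hconv
      exact ⟨hconv, h, hle h' (le_sup_right.trans le_sup_left)⟩
  · intro ε hε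
    obtain ⟨D₁, h₁⟩ := multi_normN_zero_le hη (by norm_num) sum_resSet hres hε
    obtain ⟨D₂, h₂⟩ := multi_normN_zero_le hη (by norm_num) sum_nonres5 hquint hε
    obtain ⟨D₃, h₃⟩ := cubic_normN_zero_le (c₂ := c₂) hη hc₁ (Or.inl rfl) hε
    obtain ⟨D₄, h₄⟩ := cubic_normN_zero_le (c₂ := c₂) hη hc₁ (Or.inr rfl) hε
    refine ⟨D₁ ⊔ D₂ ⊔ (D₃ ⊔ D₄), fun T hT _ =>
      ⟨fun i u hui hu => ⟨?_, fun σ hσ => ?_⟩, fun i v hvi hv => ?_⟩⟩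
    · rw [N₁_eq_multi]
      obtain ⟨h, h'⟩ := h₁ T i u hui hu (multiConverges_res T u)
      exact ⟨h, hle h' (le_sup_left.trans le_sup_left)⟩
    · rcases hσ with rfl | rfl
      · have hDC : D₃ ≤ D₁ ⊔ D₂ ⊔ (D₃ ⊔ D₄) := le_sup_left.trans le_sup_right
        obtain ⟨ha, hb, hc⟩ := h₃ T hT i u hui hu
        exact ⟨fun h => ⟨(ha h).1, hle (ha h).2 hDC⟩,
          fun K => ⟨(hb K).1, (hb K).2.1, hle (hb K).2.2 hDC⟩, hc⟩
      · have hDC : D₄ ≤ D₁ ⊔ D₂ ⊔ (D₃ ⊔ D₄) := le_sup_right.trans le_sup_right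
        obtain ⟨ha, hb, hc⟩ := h₄ T hT i u hui hu
        exact ⟨fun h => ⟨(ha h).1, hle (ha h).2 hDC⟩,
          fun K => ⟨(hb K).1, (hb K).2.1, hle (hb K).2.2 hDC⟩, hc⟩
    · have hconv := multiConverges_quintic hη hT (by linarith : (1 : ℝ) < 1 + ε) i hvi hv
      obtain ⟨h, h'⟩ := h₂ T i v hvi hv hconv
      exact ⟨hconv, h, hle h' (le_sup_right.trans le_sup_left)⟩
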